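/- Let $\mathbb T^2=\mathbb R^2/(2\pi\mathbb Z)^2$. Let $\Phi\in C([-1,1])\cap C^\infty((-1,1))$ and let $\phi=\Phi'$ on $(-1,1)$ satisfy $\phi(r)\to-\infty$ as $r\to-1^+$, $\phi(r)\to+\infty$ as $r\to1^-$, and, for some constants $\alpha,C_1,C_2,C_3>0$, $\phi'(r)\ge-\alpha$ and $|\phi'(r)|\le C_1e^{C_2|\phi(r)|}+C_3$ for all $r\in(-1,1)$. Let $\nu$ be a smooth positive function on $[-1,1]$, let $s>1$, $\delta_0\in(0,1)$, $0<T<\infty$, and let $u_0\in H^s(\mathbb T^2;\mathbb R^2)$, $\theta_0\in H^s(\mathbb T^2)$ satisfy $\operatorname{div}u_0=0$, $\int_{\mathbb T^2}\theta_0\,dx=0$ and $\|\theta_0\|_{L^\infty(\mathbb T^2)}\le1-\delta_0$. Consider the Navier--Stokes--Cahn--Hilliard system $$\begin{cases}\partial_tu+u\cdot\nabla u-\operatorname{div}(2\nu(\theta)Du)+\nabla g=\mu\nabla\theta,\\ \partial_t\theta+u\cdot\nabla\theta=\Delta\mu,\qquad \mu=\phi(\theta)-\Delta\theta,\\ \operatorname{div}u=0,\\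 (u,\theta)|_{t=0}=(u_0,\theta_0),\end{cases}\qquad Du=\tfrac12(\nabla u+\nabla u^{T}).$$ **Lemma 3.1.** Let $(u,\theta)$ be a smooth solution of this system on $[0,T)$, that is, $u,\theta$, the chemical potential $\mu$ and the pressure $g$ are $C^\infty$ on $(0,T)\times\mathbb T^2$ and satisfy the equations there, and suppose that $$u\in C([0,T);H^s(\mathbb T^2))\cap L^2_{loc}([0,T);H^{s+1}(\mathbb T^2)),\qquad \theta\in C([0,T);H^s(\mathbb T^2))\cap L^2_{loc}([0,T);H^{s+2}(\mathbb T^2)),$$ with $u(0)=u_0$ and $\theta(0)=\theta_0$. Then $$\|\theta\|_{L^\infty((0,T)\times\mathbb T^2)}\le1,$$ and $$\|u\|^2_{L^\infty((0,T);H^1)}+\|u_t\|^2_{L^2((0,T);L^2)}+\|u\|^2_{L^2((0,T);H^2)}+\|\theta\|^2_{L^\infty((0,T);H^1)}+\|\theta\|^2_{L^2((0,T);H^2)}+\|\nabla\mu\|^2_{L^2((0,T);L^2)}\le C_T(u_0,\theta_0),$$ where all spatial norms are over $\mathbb T^2$ and the constant $C_T(u_0,\theta_0)<\infty$ depends only on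 $T$, $u_0$, $\theta_0$ and the fixed functions $\Phi$ and $\nu$. -/

import Mathlib

open Set Filter Topology MeasureTheory
open scoped NNReal ENNReal ContDiff

noncomputable section

namespace NSCH

/-- Points of `ℝ²`. The torus is `𝕋² = ℝ² / (2π ℤ)²`, and a function on `𝕋²` is a function on `ℝ²`
that is `2π`-periodic in each variable. -/
abbrev Plane : Type := Fin 2 → ℝ

/-- `2π`-periodicity in each variable, i.e. `f` is a function on `𝕋²`. -/
def Periodic {E : Type*} (f : Plane → E) : Prop :=
  ∀ (x : Plane) (i : Fin 2), f (x + Pi.single i (2 * Real.pi)) = f x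

/-- The periodicity cell `[0, 2π]²`; integrals over `𝕋²` are integrals over it. -/
def cell : Set Plane := Set.Icc 0 (fun _ => 2 * Real.pi)

/-- The partial derivative `∂ᵢ f (x)`. -/
def pd (i : Fin 2) (f : Plane → ℝ) (x : Plane) : ℝ := fderiv ℝ f x (Pi.single i 1)

/-- The Laplacian `Δ f = ∂₁∂₁ f + ∂₂∂₂ f`. -/
def lap (f : Plane → ℝ) (x : Plane) : ℝ := ∑ i, pd i (pd i f) x

/-- The symmetric gradient `D v = (∇v + (∇v)ᵀ) / 2`. -/
def symGrad (v : Plane → Plane) (x : Plane) (i j : Fin 2) : ℝ :=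
  (pd i (fun y => v y j) x + pd j (fun y => v y i) x) / 2

/-- The Fourier coefficient `f̂(n) = (2π)⁻² ∫_{𝕋²} f(x) e^{-i n·x} dx`. -/
def fourierCoef (f : Plane → ℝ) (n : Fin 2 → ℤ) : ℂ :=
  (((2 * Real.pi) ^ 2 : ℝ) : ℂ)⁻¹ *
    ∫ x in cell, (f x : ℂ) * Complex.exp (-(Complex.I * ((∑ i, (n i : ℝ) * x i : ℝ) : ℂ)))

/-- `‖f‖²_{H^r(𝕋²)} = (2π)² ∑ₙ (1 + |n|²)^r |f̂(n)|²`, as an extended nonnegative number. The factor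
`(2π)²` makes the case `r = 0` the square of the `L²` norm. -/
def hsNormSq (r : ℝ) (f : Plane → ℝ) : ℝ≥0∞ :=
  ∑' n : Fin 2 → ℤ, ENNReal.ofReal
    ((2 * Real.pi) ^ 2 * ((1 + ∑ i, (n i : ℝ) ^ 2) ^ r * ‖fourierCoef f n‖ ^ 2))

/-- `f ∈ H^r(𝕋²)`, for `r ≥ 0`. -/
structure MemHs (r : ℝ) (f : Plane → ℝ) : Prop where
  periodic : Periodic f
  memLp : MemLp f 2 (volume.restrict cell)
  finite : hsNormSq r f < ⊤

/-- `f ∈ C([0,T); H^r(𝕋²))`. -/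
structure ContHs (r T : ℝ) (f : ℝ → Plane → ℝ) : Prop where
  mem : ∀ t ∈ Ico 0 T, MemHs r (f t)
  cont : ∀ t₀ ∈ Ico 0 T,
    Tendsto (fun t => hsNormSq r (fun x => f t x - f t₀ x)) (𝓝[Ico 0 T] t₀) (𝓝 0)

/-- The bound defining `L²_loc([0,T); H^r(𝕋²))`: the square of the norm is integrable on `(0,T')` for
every `T' < T`. It is used only for functions in `C([0,T); H^s(𝕋²))`, for which measurability in time
is automatic. -/
def L2locHs (r T : ℝ) (f : ℝ → Plane → ℝ) : Prop :=
  ∀ T' < T, ∫⁻ t in Ioo 0 T', hsNormSq r (f t) < ⊤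

/-- The assumption on the singular free energy density `Φ` on `[-1,1]`, with `φ = Φ'` on `(-1,1)`.
The values of `Φ` off `[-1,1]` play no role. -/
structure SingularPotential (Φ : ℝ → ℝ) : Prop where
  cont : ContinuousOn Φ (Icc (-1) 1)
  smooth : ContDiffOn ℝ ∞ Φ (Ioo (-1) 1)
  lim_left : Tendsto (deriv Φ) (𝓝[>] (-1)) atBot
  lim_right : Tendsto (deriv Φ) (𝓝[<] 1) atTop
  bounds : ∃ α C₁ C₂ C₃ : ℝ, 0 < α ∧ 0 < C₁ ∧ 0 < C₂ ∧ 0 < C₃ ∧ ∀ r ∈ Ioo (-1 : ℝ) 1,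
    -α ≤ deriv (deriv Φ) r ∧ |deriv (deriv Φ) r| ≤ C₁ * Real.exp (C₂ * |deriv Φ r|) + C₃

/-- The viscosity is a smooth, positive function on `[-1,1]`. -/
structure Viscosity (ν : ℝ → ℝ) : Prop where
  smooth : ContDiffOn ℝ ∞ ν (Icc (-1) 1)
  pos : ∀ r ∈ Icc (-1 : ℝ) 1, 0 < ν r

/-- `div v = 0` on `𝕋²` in the sense of distributions. -/
def WeakDivFree (v : Plane → Plane) : Prop :=
  ∀ ψ : Plane → ℝ, ContDiff ℝ ∞ ψ → Periodic ψ → ∫ x in cell, ∑ i, v x i * pd i ψ x = 0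

/-- The assumptions on the initial data: `u₀, θ₀ ∈ H^s`, `div u₀ = 0`, `∫ θ₀ = 0` and
`‖θ₀‖_{L^∞} ≤ 1 - δ₀`. -/
structure InitialData (s δ₀ : ℝ) (u₀ : Plane → Plane) (θ₀ : Plane → ℝ) : Prop where
  u_mem : ∀ i, MemHs s (fun x => u₀ x i)
  θ_mem : MemHs s θ₀
  div_free : WeakDivFree u₀
  mean_zero : ∫ x in cell, θ₀ x = 0
  separated : eLpNorm θ₀ ⊤ (volume.restrict cell) ≤ ENNReal.ofReal (1 - δ₀)

/-- `f` is `C^∞` on `(0,T) × 𝕋²`. -/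
structure SmoothOn {E : Type*} [NormedAddCommGroup E] [NormedSpace ℝ E] (T : ℝ)
    (f : ℝ → Plane → E) : Prop where
  smooth : ContDiffOn ℝ ∞ (fun p : ℝ × Plane => f p.1 p.2) (Ioo 0 T ×ˢ univ)
  periodic : ∀ t ∈ Ioo 0 T, Periodic (f t)

/-- `(u, θ)`, with chemical potential `μ` and total pressure `g`, is a smooth solution on `[0,T)` of
`∂ₜu + u·∇u - div(2ν(θ)Du) + ∇g = μ∇θ`, `∂ₜθ + u·∇θ = Δμ`, `μ = φ(θ) - Δθ`, `div u = 0`, where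
`φ = Φ'`, with initial data `(u₀, θ₀)`. That `θ` takes its values in `(-1,1)` is not part of the
definition. -/
structure IsSmoothSolution (Φ ν : ℝ → ℝ) (T : ℝ) (u₀ : Plane → Plane) (θ₀ : Plane → ℝ)
    (u : ℝ → Plane → Plane) (θ μ g : ℝ → Plane → ℝ) : Prop where
  u_smooth : SmoothOn T u
  θ_smooth : SmoothOn T θ
  μ_smooth : SmoothOn T μ
  g_smooth : SmoothOn T g
  momentum : ∀ t ∈ Ioo 0 T, ∀ (x : Plane) (i : Fin 2),
    deriv (fun τ => u τ x i) t + ∑ j, u t x j * pd j (fun y => u t y i) x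
      - ∑ j, pd j (fun y => 2 * ν (θ t y) * symGrad (u t) y i j) x + pd i (g t) x
      = μ t x * pd i (θ t) x
  transport : ∀ t ∈ Ioo 0 T, ∀ x : Plane,
    deriv (fun τ => θ τ x) t + ∑ j, u t x j * pd j (θ t) x = lap (μ t) x
  potential : ∀ t ∈ Ioo 0 T, ∀ x : Plane, μ t x = deriv Φ (θ t x) - lap (θ t) x
  div_free : ∀ t ∈ Ioo 0 T, ∀ x : Plane, ∑ i, pd i (fun y => u t y i) x = 0
  u_init : u 0 =ᵐ[volume] u₀
  θ_init : θ 0 =ᵐ[volume] θ₀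

/-- `u ∈ C([0,T); H^s) ∩ L²_loc([0,T); H^{s+1})` and `θ ∈ C([0,T); H^s) ∩ L²_loc([0,T); H^{s+2})`. -/
structure InSolutionSpace (s T : ℝ) (u : ℝ → Plane → Plane) (θ : ℝ → Plane → ℝ) : Prop where
  u_cont : ∀ i, ContHs s T (fun t x => u t x i)
  u_L2loc : ∀ i, L2locHs (s + 1) T (fun t x => u t x i)
  θ_cont : ContHs s T θ
  θ_L2loc : L2locHs (s + 2) T θ

/-- `‖f‖²_{L^∞((0,T); H^r(𝕋²))}`. -/
def LinftyHsSq (r T : ℝ) (f : ℝ → Plane → ℝ) : ℝ≥0∞ :=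
  essSup (fun t => hsNormSq r (f t)) (volume.restrict (Ioo 0 T))

/-- `‖f‖²_{L²((0,T); H^r(𝕋²))}`. -/
def L2HsSq (r T : ℝ) (f : ℝ → Plane → ℝ) : ℝ≥0∞ :=
  ∫⁻ t in Ioo 0 T, hsNormSq r (f t)

/-- `‖f‖²_{L²((0,T); L²(𝕋²))}`. -/
def L2L2Sq (T : ℝ) (f : ℝ → Plane → ℝ) : ℝ≥0∞ :=
  ∫⁻ t in Ioo 0 T, ∫⁻ x in cell, ENNReal.ofReal (f t x ^ 2)

end NSCH

end

/-! The concentration never leaves `(-1, 1)`. Near `t = 0` it is separated from `±1` because `H^s ⊂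
L^∞` for `s > 1`. Afterwards `φ(θ) = μ + Δθ` is locally bounded, since `μ` and `θ` are smooth, while
`φ` blows up at `±1`. So the set of times at which `|θ| < 1` is both open and closed in the
connected interval `(0, T)` (`abs_lt_one`).

The energy `E = ‖u‖²/2 + ‖∇θ‖²/2 + ∫ Φ(θ)` then satisfies `E' ≤ -(κ ‖∇u‖² + ‖∇μ‖²)`, because the
work of the capillary force cancels the transport of `θ` (`energyDeriv_le`). As `Φ` is bounded on
`[-1, 1]`, this controls `‖u‖`, `‖∇θ‖` and `|E|`. Testing `μ = φ(θ) - Δθ` with `-Δθ` and using only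
`φ' ≥ -α` bounds `‖Δθ‖²` by `‖∇μ‖²` and `‖∇θ‖²` (`integ_lap_sq_le`).

The higher bound on `u` comes from testing the momentum equation with `-Δu`. Modulo gradients the
capillary force is `-θ∇μ`, of `L²` norm at most `‖∇μ‖`. Convection is handled by Ladyzhenskaya's
inequality. The variable viscosity leaves the term `2 ν'(θ) Du ∇θ`, handled by Ladyzhenskaya for
`∇u` and by `‖∂ᵢθ‖₄⁴ ≤ 9 ‖Δθ‖²`, which holds because `|θ| ≤ 1`. With `y = ‖∇u‖²`, `z = ‖Δu‖²`, `m =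
‖∇μ‖²` the outcome is `y' ≤ -(κ/2) z + P (1 + y + m) y + P m`.

The rate `1 + y + m` is integrable by the energy inequality, so Gronwall's lemma closes the
estimate. It is applied through the integrating factor `exp(Q (E - t))`, for which the energy itself
serves as the clock (`NormInequalities.exists_bound`). Parseval's identity translates the integral
norms into the Fourier-side norms of the statement. -/

noncomputable section

namespace NSCH

/-! ### Calculus and integration by parts for smooth functions on the torus. -/

/-- `f` is a smooth function on `𝕋²`. -/
structure TorusSmooth (f : Plane → ℝ) : Prop where
  contDiff : ContDiff ℝ ∞ f
  periodic : Periodic f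

/-- The integral of `f` over `𝕋²`. -/
def integ (f : Plane → ℝ) : ℝ := ∫ x in cell, f x

lemma isCompact_cell : IsCompact cell := isCompact_Icc

lemma measurableSet_cell : MeasurableSet cell := measurableSet_Icc

lemma integrableOn_cell {E : Type*} [NormedAddCommGroup E] {f : Plane → E} (hf : Continuous f) :
    IntegrableOn f cell :=
  hf.continuousOn.integrableOn_compact isCompact_cell

/-- The integral over `𝕋²` of a partial derivative vanishes. -/
lemma integral_cell_fderiv_eq_zero {E : Type*} [NormedAddCommGroup E] [NormedSpace ℝ E]
    [CompleteSpace E] {f : Plane → E} (hf : ContDiff ℝ 1 f) (hp : Periodic f) (i : Fin 2) :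
    ∫ x in cell, fderiv ℝ f x (Pi.single i 1) = 0 := by
  have hd : Differentiable ℝ f := hf.differentiable one_ne_zero
  have hc : Continuous fun x => fderiv ℝ f x (Pi.single i 1) :=
    (hf.continuous_fderiv one_ne_zero).clm_apply continuous_const
  -- Divergence theorem on the box for the field `f eᵢ`: only the two faces orthogonal to `eᵢ`
  -- contribute, and they cancel by periodicity.
  have key := integral_divergence_of_hasFDerivAt_off_countable' (n := 1) (E := E)
    (a := (0 : Plane)) (b := fun _ => 2 * Real.pi)
    (fun _ => by simpa using Real.two_pi_pos.le)
    (fun j x => if j = i then f x else 0)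
    (fun j x => if j = i then fderiv ℝ f x else 0) ∅ countable_empty
    (fun j => by
      by_cases h : j = i
      · simpa [h] using hf.continuous.continuousOn
      · simpa [h] using continuousOn_const)
    (fun x _ j => by
      by_cases h : j = i
      · simpa [h] using (hd x).hasFDerivAt
      · simpa [h] using hasFDerivAt_const (0 : E) x)
    (by
      have : (fun x => ∑ j, (if j = i then fderiv ℝ f x else 0) (Pi.single j 1)) =
          fun x => fderiv ℝ f x (Pi.single i 1) := by
        funext x
        rw [Finset.sum_eq_single i]
        · simp
        · intro j _ hj; simp [hj]
        · simp
      rw [this]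
      exact integrableOn_cell hc)
  have h1 : ∀ x : Plane, ∑ j, (if j = i then fderiv ℝ f x else 0) (Pi.single j (1 : ℝ)) =
      fderiv ℝ f x (Pi.single i 1) := by
    intro x
    rw [Finset.sum_eq_single i]
    · simp
    · intro j _ hj; simp [hj]
    · simp
  simp only [h1] at key
  rw [cell]
  refine key.trans (Finset.sum_eq_zero fun j _ => ?_)
  by_cases h : j = i
  · subst h
    simp only [if_true]
    rw [sub_eq_zero]
    congr 1
    funext y
    refine Eq.trans ?_ (hp (j.insertNth (0 : ℝ) y) j)
    congr 1
    ext k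
    refine Fin.succAboveCases j ?_ (fun l => ?_) k
    · simp
    · simp
  · simp [h]

namespace TorusSmooth

variable {f g : Plane → ℝ}

lemma differentiable (hf : TorusSmooth f) : Differentiable ℝ f :=
  hf.contDiff.differentiable (by simp)

lemma continuous (hf : TorusSmooth f) : Continuous f := hf.contDiff.continuous

lemma add (hf : TorusSmooth f) (hg : TorusSmooth g) : TorusSmooth fun x => f x + g x :=
  ⟨hf.1.add hg.1, fun x i => by simp only [hf.2 x i, hg.2 x i]⟩

lemma sub (hf : TorusSmooth f) (hg : TorusSmooth g) : TorusSmooth fun x => f x - g x :=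
  ⟨hf.1.sub hg.1, fun x i => by simp only [hf.2 x i, hg.2 x i]⟩

lemma mul (hf : TorusSmooth f) (hg : TorusSmooth g) : TorusSmooth fun x => f x * g x :=
  ⟨hf.1.mul hg.1, fun x i => by simp only [hf.2 x i, hg.2 x i]⟩

lemma neg (hf : TorusSmooth f) : TorusSmooth fun x => -f x :=
  ⟨hf.1.neg, fun x i => by simp only [hf.2 x i]⟩

lemma pow (hf : TorusSmooth f) (n : ℕ) : TorusSmooth fun x => f x ^ n :=
  ⟨hf.1.pow n, fun x i => by simp only [hf.2 x i]⟩

lemma const (c : ℝ) : TorusSmooth fun _ => c := ⟨contDiff_const, fun _ _ => rfl⟩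

lemma sum {ι : Type*} {s : Finset ι} {F : ι → Plane → ℝ} (h : ∀ j, TorusSmooth (F j)) :
    TorusSmooth fun x => ∑ j ∈ s, F j x :=
  ⟨ContDiff.sum fun j _ => (h j).1, fun x i => by simp only [(h _).2 x i]⟩

lemma pd (hf : TorusSmooth f) (i : Fin 2) : TorusSmooth (NSCH.pd i f) := by
  refine ⟨(hf.1.fderiv_right (m := ∞) (by simp)).clm_apply contDiff_const, fun x j => ?_⟩
  have : (fun y => f (y + Pi.single j (2 * Real.pi))) = f := funext fun y => hf.2 y j
  rw [NSCH.pd, NSCH.pd]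
  conv_rhs => rw [← this, fderiv_comp_add_right]

lemma lap (hf : TorusSmooth f) : TorusSmooth (NSCH.lap f) :=
  TorusSmooth.sum fun i => (hf.pd i).pd i

lemma comp (hf : TorusSmooth f) {φ : ℝ → ℝ} {s : Set ℝ} (hs : IsOpen s)
    (hφ : ContDiffOn ℝ ∞ φ s) (h : ∀ x, f x ∈ s) : TorusSmooth fun x => φ (f x) :=
  ⟨contDiff_iff_contDiffAt.2 fun x => (hφ.contDiffAt (hs.mem_nhds (h x))).comp x hf.1.contDiffAt,
    fun x i => by simp only [hf.2 x i]⟩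

lemma integrableOn (hf : TorusSmooth f) : IntegrableOn f cell := integrableOn_cell hf.continuous

end TorusSmooth

section Calculus

variable {f g : Plane → ℝ}

lemma pd_add (hf : TorusSmooth f) (hg : TorusSmooth g) (i : Fin 2) (x : Plane) :
    pd i (fun y => f y + g y) x = pd i f x + pd i g x := by
  simp only [pd]
  rw [fderiv_fun_add (hf.differentiable x) (hg.differentiable x)]; rfl

lemma pd_sub (hf : TorusSmooth f) (hg : TorusSmooth g) (i : Fin 2) (x : Plane) :
    pd i (fun y => f y - g y) x = pd i f x - pd i g x := by
  simp only [pd]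
  rw [fderiv_fun_sub (hf.differentiable x) (hg.differentiable x)]; rfl

lemma pd_mul (hf : TorusSmooth f) (hg : TorusSmooth g) (i : Fin 2) (x : Plane) :
    pd i (fun y => f y * g y) x = pd i f x * g x + f x * pd i g x := by
  simp only [pd]
  rw [fderiv_fun_mul (hf.differentiable x) (hg.differentiable x)]
  simp only [add_apply, smul_apply, smul_eq_mul]
  ring

lemma pd_const_mul (c : ℝ) (hf : TorusSmooth f) (i : Fin 2) (x : Plane) :
    pd i (fun y => c * f y) x = c * pd i f x := by
  simp only [pd]
  rw [fderiv_const_mul (hf.differentiable x)]; rfl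

lemma pd_pow (hf : TorusSmooth f) (n : ℕ) (i : Fin 2) (x : Plane) :
    pd i (fun y => f y ^ n) x = n * f x ^ (n - 1) * pd i f x := by
  simp only [pd]
  rw [fderiv_fun_pow _ (hf.differentiable x)]
  simp

lemma pd_sum {ι : Type*} {s : Finset ι} {F : ι → Plane → ℝ} (h : ∀ j, TorusSmooth (F j))
    (i : Fin 2) (x : Plane) : pd i (fun y => ∑ j ∈ s, F j y) x = ∑ j ∈ s, pd i (F j) x := by
  simp only [pd]
  rw [fderiv_fun_sum fun j _ => (h j).differentiable x]
  simp

lemma pd_comp (hf : TorusSmooth f) {φ : ℝ → ℝ} (i : Fin 2) (x : Plane)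
    (hφ : DifferentiableAt ℝ φ (f x)) :
    pd i (fun y => φ (f y)) x = deriv φ (f x) * pd i f x := by
  simp only [pd]
  have := (hφ.hasDerivAt.comp_hasFDerivAt x (hf.differentiable x).hasFDerivAt).fderiv
  rw [show (fun y => φ (f y)) = φ ∘ f from rfl, this]
  rfl

lemma pd_comm (hf : TorusSmooth f) (i j : Fin 2) (x : Plane) :
    pd i (pd j f) x = pd j (pd i f) x := by
  have hd : Differentiable ℝ (fderiv ℝ f) :=
    (hf.1.fderiv_right (m := ∞) (by simp)).differentiable (by simp)
  have h : ∀ i j : Fin 2, pd i (pd j f) x =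
      fderiv ℝ (fderiv ℝ f) x (Pi.single i 1) (Pi.single j 1) := by
    intro i j
    change fderiv ℝ (fun y => fderiv ℝ f y (Pi.single j 1)) x (Pi.single i 1) = _
    rw [fderiv_clm_apply (hd x) (differentiableAt_const _)]
    simp
  rw [h, h]
  exact (hf.1.contDiffAt.isSymmSndFDerivAt (by
    rw [minSmoothness_of_isRCLikeNormedField]
    exact WithTop.coe_le_coe.2 (le_top : (2 : ℕ∞) ≤ ⊤))) _ _

lemma pd_lap (hf : TorusSmooth f) (i : Fin 2) (x : Plane) : pd i (lap f) x = lap (pd i f) x := by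
  have : lap f = fun x => ∑ j, pd j (pd j f) x := rfl
  rw [this, pd_sum fun j => (hf.pd j).pd j]
  refine Finset.sum_congr rfl fun j _ => ?_
  rw [pd_comm (hf.pd j) i j]
  congr 1
  funext y
  exact pd_comm hf i j y

lemma integ_add (hf : Continuous f) (hg : Continuous g) :
    integ (fun x => f x + g x) = integ f + integ g :=
  integral_add (integrableOn_cell hf) (integrableOn_cell hg)

lemma integ_sub (hf : Continuous f) (hg : Continuous g) :
    integ (fun x => f x - g x) = integ f - integ g :=
  integral_sub (integrableOn_cell hf) (integrableOn_cell hg)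

lemma integ_neg : integ (fun x => -f x) = -integ f := integral_neg _

lemma integ_const_mul (c : ℝ) : integ (fun x => c * f x) = c * integ f :=
  integral_const_mul _ _

lemma integ_sum {ι : Type*} {s : Finset ι} {F : ι → Plane → ℝ} (h : ∀ j, Continuous (F j)) :
    integ (fun x => ∑ j ∈ s, F j x) = ∑ j ∈ s, integ (F j) :=
  integral_finsetSum _ fun j _ => integrableOn_cell (h j)

lemma integ_mono (hf : Continuous f) (hg : Continuous g) (h : ∀ x, f x ≤ g x) :
    integ f ≤ integ g :=
  integral_mono (integrableOn_cell hf) (integrableOn_cell hg) h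

lemma integ_nonneg (h : ∀ x, 0 ≤ f x) : 0 ≤ integ f := integral_nonneg h

lemma integ_pd (hf : TorusSmooth f) (i : Fin 2) : integ (pd i f) = 0 :=
  integral_cell_fderiv_eq_zero (hf.1.of_le (by simp)) hf.2 i

/-- Integration by parts on `𝕋²`. -/
lemma integ_mul_pd (hf : TorusSmooth f) (hg : TorusSmooth g) (i : Fin 2) :
    integ (fun x => f x * pd i g x) = -integ (fun x => pd i f x * g x) := by
  have h := integ_pd (hf.mul hg) i
  simp_rw [show pd i (fun x => f x * g x) = fun x => pd i f x * g x + f x * pd i g x from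
    funext fun x => pd_mul hf hg i x] at h
  rw [integ_add ((hf.pd i).mul hg).continuous (hf.mul (hg.pd i)).continuous] at h
  linarith

/-- The Cauchy-Schwarz inequality on `𝕋²`. -/
lemma sq_integ_mul_le (hf : Continuous f) (hg : Continuous g) :
    integ (fun x => f x * g x) ^ 2 ≤ integ (fun x => f x ^ 2) * integ (fun x => g x ^ 2) := by
  have h : ∀ r : ℝ, 0 ≤ integ (fun x => g x ^ 2) * (r * r) +
      (2 * integ (fun x => f x * g x)) * r + integ (fun x => f x ^ 2) := by
    intro r
    have h0 : 0 ≤ integ fun x => (r * g x + f x) ^ 2 := integ_nonneg fun x => sq_nonneg _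
    have h1 : integ (fun x => (r * g x + f x) ^ 2) = integ (fun x => (r * r) * g x ^ 2 +
        (2 * r) * (f x * g x) + f x ^ 2) := by congr 1; funext x; ring
    rw [h1, integ_add (by fun_prop) (by fun_prop), integ_add (by fun_prop) (by fun_prop),
      integ_const_mul, integ_const_mul] at h0
    linarith
  have := discrim_le_zero h
  rw [discrim] at this
  nlinarith

/-- Young's inequality on `𝕋²`. -/
lemma integ_mul_le (hf : Continuous f) (hg : Continuous g) {ε : ℝ} (hε : 0 < ε) :
    integ (fun x => f x * g x) ≤
      ε * integ (fun x => f x ^ 2) + (4 * ε)⁻¹ * integ (fun x => g x ^ 2) := by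
  rw [← integ_const_mul, ← integ_const_mul, ← integ_add (by fun_prop) (by fun_prop)]
  refine integ_mono (by fun_prop) (by fun_prop) fun x => ?_
  have h : ε * f x ^ 2 + (4 * ε)⁻¹ * g x ^ 2 - f x * g x = ε * (f x - (2 * ε)⁻¹ * g x) ^ 2 := by
    field_simp; ring
  nlinarith [mul_nonneg hε.le (sq_nonneg (f x - (2 * ε)⁻¹ * g x))]

end Calculus

/-! ### Hessian, `L⁴` and Ladyzhenskaya inequalities. -/

section Inequalities

variable {f g : Plane → ℝ}

/-- Two integrations by parts exchange the derivatives `∂ᵢ` and `∂ⱼ` between the factors. Summed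
over `i, j`, the right side becomes `∫ (Δf)²`. -/
lemma integ_sq_hess (hf : TorusSmooth f) (i j : Fin 2) :
    integ (fun x => pd j (pd i f) x ^ 2) =
      integ (fun x => pd i (pd i f) x * pd j (pd j f) x) := by
  have h1 : (fun x => pd j (pd i f) x ^ 2) = fun x => pd j (pd i f) x * pd i (pd j f) x := by
    funext x; rw [pd_comm hf i j]; ring
  rw [h1, integ_mul_pd ((hf.pd i).pd j) (hf.pd j) i, integ_mul_pd ((hf.pd i).pd i) (hf.pd j) j]
  simp_rw [pd_comm (hf.pd i) i j]

/-- The full Hessian is controlled by the Laplacian. -/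
lemma sum_integ_sq_hess (hf : TorusSmooth f) :
    ∑ i, ∑ j, integ (fun x => pd j (pd i f) x ^ 2) = integ (fun x => lap f x ^ 2) := by
  have h : ∀ i j, Continuous fun x => pd i (pd i f) x * pd j (pd j f) x := fun i j =>
    (((hf.pd i).pd i).mul ((hf.pd j).pd j)).continuous
  have h2 : (fun x => lap f x ^ 2) = fun x => ∑ i, ∑ j, pd i (pd i f) x * pd j (pd j f) x := by
    funext x; rw [lap, sq, Finset.sum_mul_sum]
  rw [h2, integ_sum fun i => continuous_finsetSum _ fun j _ => h i j]
  refine Finset.sum_congr rfl fun i _ => ?_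
  rw [integ_sum (h i)]
  exact Finset.sum_congr rfl fun j _ => integ_sq_hess hf i j

lemma integ_sq_hess_le (hf : TorusSmooth f) (i j : Fin 2) :
    integ (fun x => pd j (pd i f) x ^ 2) ≤ integ (fun x => lap f x ^ 2) := by
  rw [← sum_integ_sq_hess hf]
  have h0 : ∀ i j, 0 ≤ integ (fun x => pd j (pd i f) x ^ 2) := fun i j =>
    integ_nonneg fun x => sq_nonneg _
  exact (Finset.single_le_sum (f := fun j => integ (fun x => pd j (pd i f) x ^ 2))
    (fun j _ => h0 i j) (Finset.mem_univ j)).trans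
    (Finset.single_le_sum (f := fun i => ∑ j, integ (fun x => pd j (pd i f) x ^ 2))
    (fun i _ => Finset.sum_nonneg fun j _ => h0 i j) (Finset.mem_univ i))

/-- The `L⁴` norm of a derivative of a bounded function. -/
lemma integ_pd_pow_four_le (hf : TorusSmooth f) (hb : ∀ x, |f x| ≤ 1) (i : Fin 2) :
    integ (fun x => pd i f x ^ 4) ≤ 9 * integ (fun x => lap f x ^ 2) := by
  have hD := hf.pd i
  have hD2 := hD.pd i
  -- Writing `(∂f)⁴ = (∂f)³ ∂f` and integrating by parts moves one derivative off the bounded factor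
  -- `f`. Cauchy-Schwarz then gives `q² ≤ 9 q ∫ (Δf)²`, and one power of `q` is cancelled.
  have h1 : integ (fun x => pd i f x ^ 4) =
      -integ (fun x => 3 * (pd i f x ^ 2 * (pd i (pd i f) x * f x))) := by
    have : (fun x => pd i f x ^ 4) = fun x => pd i f x ^ 3 * pd i f x := by funext x; ring
    rw [this, integ_mul_pd (hD.pow 3) hf i]
    congr 2
    funext x
    rw [pd_pow hD]
    push_cast
    ring
  rw [integ_const_mul] at h1
  set q := integ (fun x => pd i f x ^ 4)
  set p := integ (fun x => pd i f x ^ 2 * (pd i (pd i f) x * f x))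
  have h2 : p ^ 2 ≤ q * integ (fun x => (pd i (pd i f) x * f x) ^ 2) := by
    have := sq_integ_mul_le (hD.pow 2).continuous (hD2.mul hf).continuous
    have e : (fun x => (pd i f x ^ 2) ^ 2) = fun x => pd i f x ^ 4 := by funext x; ring
    rwa [e] at this
  have h3 : integ (fun x => (pd i (pd i f) x * f x) ^ 2) ≤ integ (fun x => pd i (pd i f) x ^ 2) := by
    refine integ_mono ((hD2.mul hf).pow 2).continuous (hD2.pow 2).continuous fun x => ?_
    have := (sq_le_one_iff_abs_le_one _).2 (hb x)
    rw [mul_pow]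
    nlinarith [sq_nonneg (pd i (pd i f) x)]
  have h4 := integ_sq_hess_le hf i i
  have hq : 0 ≤ q := integ_nonneg fun x => by positivity
  have h5 : q ^ 2 ≤ q * (9 * integ (fun x => lap f x ^ 2)) := by
    have : p ^ 2 ≤ q * integ (fun x => lap f x ^ 2) :=
      h2.trans (mul_le_mul_of_nonneg_left (h3.trans h4) hq)
    rw [h1, neg_sq, ← h1]; linarith
  rcases hq.eq_or_lt with h | h
  · rw [← h]; exact mul_nonneg (by norm_num) (integ_nonneg fun x => sq_nonneg _)
  · rw [sq] at h5; exact le_of_mul_le_mul_left h5 h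

lemma integ_eq_iterated (hf : Continuous f) :
    integ f = ∫ x in (0 : ℝ)..2 * Real.pi, ∫ y in (0 : ℝ)..2 * Real.pi, f ![x, y] := by
  have e := (volume_preserving_finTwoArrow ℝ).symm
  have hpre : (MeasurableEquiv.finTwoArrow (α := ℝ)).symm ⁻¹' cell =
      Icc 0 (2 * Real.pi) ×ˢ Icc 0 (2 * Real.pi) := by
    ext ⟨x, y⟩
    simp [cell, Pi.le_def, Fin.forall_fin_two, MeasurableEquiv.finTwoArrow]
  rw [integ, ← e.setIntegral_preimage_emb (MeasurableEquiv.measurableEmbedding _), hpre,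
    Measure.volume_eq_prod, setIntegral_prod]
  · simp only [intervalIntegral.integral_of_le Real.two_pi_pos.le, integral_Icc_eq_integral_Ioc]
    rfl
  · refine ContinuousOn.integrableOn_compact (isCompact_Icc.prod isCompact_Icc)
      (Continuous.continuousOn ?_)
    exact hf.comp (by
      change Continuous fun p : ℝ × ℝ => (![p.1, p.2] : Fin 2 → ℝ)
      fun_prop)

lemma integ_eq_iterated_swap (hf : Continuous f) :
    integ f = ∫ y in (0 : ℝ)..2 * Real.pi, ∫ x in (0 : ℝ)..2 * Real.pi, f ![x, y] := by
  rw [integ_eq_iterated hf]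
  simp only [intervalIntegral.integral_of_le Real.two_pi_pos.le]
  refine integral_integral_swap (f := fun x y => f ![x, y]) ?_
  rw [Measure.prod_restrict]
  refine IntegrableOn.mono_set (t := Icc 0 (2 * Real.pi) ×ˢ Icc 0 (2 * Real.pi)) ?_
    (prod_mono Ioc_subset_Icc_self Ioc_subset_Icc_self)
  refine ContinuousOn.integrableOn_compact (isCompact_Icc.prod isCompact_Icc)
    (Continuous.continuousOn ?_)
  exact hf.comp (g := f) (f := fun p : ℝ × ℝ => (![p.1, p.2] : Fin 2 → ℝ)) (by fun_prop)

/-- One-dimensional sup bound by the mean and the total variation. -/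
lemma le_integral_add_integral_abs_deriv {h h' : ℝ → ℝ} (hh : ∀ x, HasDerivAt h (h' x) x)
    (hc : Continuous h') {l : ℝ} (hl : 1 ≤ l) (hpos : ∀ x, 0 ≤ h x) {x : ℝ} (hx : x ∈ Icc 0 l) :
    h x ≤ ∫ y in (0 : ℝ)..l, (h y + |h' y|) := by
  have hl0 : 0 ≤ l := by linarith
  have hcont : Continuous h := continuous_iff_continuousAt.2 fun x => (hh x).continuousAt
  rw [intervalIntegral.integral_add (hcont.intervalIntegrable _ _)
    (hc.abs.intervalIntegrable _ _)]
  set W := ∫ y in (0 : ℝ)..l, |h' y|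
  -- `h` drops by at most its total variation `W`, so averaging over `[0, l]` gives `l (h x - W) ≤ ∫
  -- h`. As `l ≥ 1`, the factor `l` can be dropped when `h x - W ≥ 0`; otherwise `h x < W` suffices.
  have hW : ∀ y ∈ Icc 0 l, h x - W ≤ h y := by
    intro y hy
    have h1 : h x - h y = ∫ s in y..x, h' s :=
      (intervalIntegral.integral_eq_sub_of_hasDerivAt (fun s _ => hh s)
        (hc.intervalIntegrable _ _)).symm
    have h2 : |(∫ s in y..x, h' s)| ≤ |(∫ s in y..x, |h' s|)| :=
      intervalIntegral.norm_integral_le_abs_integral_norm (f := h') (μ := volume)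
    have h3 : |(∫ s in y..x, |h' s|)| ≤ |W| := by
      refine intervalIntegral.abs_integral_mono_interval ?_ ?_ (hc.abs.intervalIntegrable _ _)
      · rw [uIoc_of_le hl0]
        intro s hs
        rcases mem_uIoc.1 hs with h | h
        · exact ⟨hy.1.trans_lt h.1, h.2.trans hx.2⟩
        · exact ⟨hx.1.trans_lt h.1, h.2.trans hy.2⟩
      · exact Eventually.of_forall fun s => abs_nonneg _
    have h4 : |W| = W := abs_of_nonneg
      (intervalIntegral.integral_nonneg hl0 fun s _ => abs_nonneg _)
    have := (le_abs_self _).trans (h2.trans (h3.trans h4.le))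
    linarith
  have h5 : ∫ _ in (0 : ℝ)..l, (h x - W) ≤ ∫ y in (0 : ℝ)..l, h y :=
    intervalIntegral.integral_mono_on hl0 (by simp) (hcont.intervalIntegrable _ _) hW
  rw [intervalIntegral.integral_const, smul_eq_mul, sub_zero] at h5
  by_cases hs : 0 ≤ h x - W
  · nlinarith
  · have : 0 ≤ ∫ y in (0 : ℝ)..l, h y := intervalIntegral.integral_nonneg hl0 fun s _ => hpos s
    linarith

lemma hasDerivAt_fst (hf : TorusSmooth f) (x y : ℝ) :
    HasDerivAt (fun s => f ![s, y]) (pd 0 f ![x, y]) x := by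
  have h : HasDerivAt (fun s : ℝ => (![s, y] : Fin 2 → ℝ)) (Pi.single 0 1) x := by
    rw [hasDerivAt_pi]
    intro i
    fin_cases i
    · simpa using hasDerivAt_id' x
    · simpa using hasDerivAt_const x y
  exact (hf.differentiable _).hasFDerivAt.comp_hasDerivAt x h

lemma hasDerivAt_snd (hf : TorusSmooth f) (x y : ℝ) :
    HasDerivAt (fun s => f ![x, s]) (pd 1 f ![x, y]) y := by
  have h : HasDerivAt (fun s : ℝ => (![x, s] : Fin 2 → ℝ)) (Pi.single 1 1) y := by
    rw [hasDerivAt_pi]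
    intro i
    fin_cases i
    · simpa using hasDerivAt_const y x
    · simpa using hasDerivAt_id' y
  exact (hf.differentiable _).hasFDerivAt.comp_hasDerivAt y h

/-- The two-dimensional product estimate `∫ g² ≤ ∫ (g + |∂₁g|) ∫ (g + |∂₂g|)` for `g ≥ 0`. -/
lemma integ_sq_le_mul (hg : TorusSmooth g) (hpos : ∀ x, 0 ≤ g x) :
    integ (fun x => g x ^ 2) ≤
      integ (fun x => g x + |pd 0 g x|) * integ (fun x => g x + |pd 1 g x|) := by
  have hl : 1 ≤ 2 * Real.pi := by linarith [Real.two_le_pi]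
  have hl0 : 0 ≤ 2 * Real.pi := by linarith
  have c0 : Continuous fun x => g x + |pd 0 g x| := hg.continuous.add (hg.pd 0).continuous.abs
  have c1 : Continuous fun x => g x + |pd 1 g x| := hg.continuous.add (hg.pd 1).continuous.abs
  have cv : Continuous fun p : ℝ × ℝ => (![p.1, p.2] : Fin 2 → ℝ) := by fun_prop
  -- The one-dimensional bound along each axis gives `g(x, y) ≤ A y` and `g(x, y) ≤ B x`, so the
  -- integral of `g² ≤ A y * B x` factorises.
  set A : ℝ → ℝ := fun y => ∫ x in (0 : ℝ)..2 * Real.pi, (g ![x, y] + |pd 0 g ![x, y]|)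
  set B : ℝ → ℝ := fun x => ∫ y in (0 : ℝ)..2 * Real.pi, (g ![x, y] + |pd 1 g ![x, y]|)
  have hA : Continuous A :=
    intervalIntegral.continuous_parametric_intervalIntegral_of_continuous'
      (f := fun y x => g ![x, y] + |pd 0 g ![x, y]|)
      ((c0.comp cv).comp continuous_swap) _ _
  have hB : Continuous B :=
    intervalIntegral.continuous_parametric_intervalIntegral_of_continuous'
      (f := fun x y => g ![x, y] + |pd 1 g ![x, y]|) (c1.comp cv) _ _
  rw [integ_eq_iterated_swap c0, integ_eq_iterated c1, integ_eq_iterated (hg.pow 2).continuous,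
    mul_comm (∫ y in (0 : ℝ)..2 * Real.pi, A y), ← intervalIntegral.integral_mul_const]
  refine intervalIntegral.integral_mono_on hl0 ?_ ?_ fun x hx => ?_
  · exact (intervalIntegral.continuous_parametric_intervalIntegral_of_continuous'
      (f := fun x y => g ![x, y] ^ 2) ((hg.pow 2).continuous.comp cv) _ _).intervalIntegrable _ _
  · exact (hB.mul continuous_const).intervalIntegrable _ _
  · change _ ≤ B x * ∫ y in (0 : ℝ)..2 * Real.pi, A y
    rw [← intervalIntegral.integral_const_mul]
    refine intervalIntegral.integral_mono_on hl0 ?_ ?_ fun y hy => ?_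
    · exact ((hg.pow 2).continuous.comp (by fun_prop)).intervalIntegrable _ _
    · exact (continuous_const.mul hA).intervalIntegrable _ _
    · have h1 : g ![x, y] ≤ A y := le_integral_add_integral_abs_deriv
        (h := fun s => g ![s, y]) (fun s => hasDerivAt_fst hg s y)
        ((hg.pd 0).continuous.comp (by fun_prop)) hl (fun _ => hpos _) hx
      have h2 : g ![x, y] ≤ B x := le_integral_add_integral_abs_deriv
        (h := fun s => g ![x, s]) (fun s => hasDerivAt_snd hg x s)
        ((hg.pd 1).continuous.comp (by fun_prop)) hl (fun _ => hpos _) hy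
      rw [sq]
      exact mul_le_mul h2 h1 (hpos _) ((hpos _).trans h2)

/-- Ladyzhenskaya's inequality on `𝕋²`. -/
lemma ladyzhenskaya (hf : TorusSmooth f) :
    integ (fun x => f x ^ 4) ≤ 4 * integ (fun x => f x ^ 2) *
      (integ (fun x => f x ^ 2) + ∑ i, integ (fun x => pd i f x ^ 2)) := by
  have h := integ_sq_le_mul (hf.pow 2) fun x => sq_nonneg _
  have e : (fun x => (f x ^ 2) ^ 2) = fun x => f x ^ 4 := by funext x; ring
  rw [e, integ_add (hf.pow 2).continuous ((hf.pow 2).pd 0).continuous.abs,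
    integ_add (hf.pow 2).continuous ((hf.pow 2).pd 1).continuous.abs] at h
  have hS : ∀ i, integ (fun x => |pd i (fun y => f y ^ 2) x|) ^ 2 ≤
      4 * integ (fun x => f x ^ 2) * integ (fun x => pd i f x ^ 2) := by
    intro i
    have := sq_integ_mul_le (f := fun x => |2 * f x|) (g := fun x => |pd i f x|)
      (by have := hf.continuous; fun_prop) (hf.pd i).continuous.abs
    simp_rw [← abs_mul, sq_abs, mul_pow, integ_const_mul] at this
    have e : (fun x => |pd i (fun y => f y ^ 2) x|) = fun x => |2 * f x * pd i f x| := by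
      funext x; rw [pd_pow hf]; simp
    rw [e]; linarith
  have h0 := hS 0
  have h1 := hS 1
  rw [Fin.sum_univ_two]
  have ha : 0 ≤ integ (fun x => f x ^ 2) := integ_nonneg fun x => sq_nonneg _
  set a := integ (fun x => f x ^ 2)
  set S0 := integ (fun x => |pd 0 (fun y => f y ^ 2) x|)
  set S1 := integ (fun x => |pd 1 (fun y => f y ^ 2) x|)
  -- `(a + S0)(a + S1) ≤ 2a² + S0² + S1²`, and each `Sᵢ²` is at most `4 a ∫ (∂ᵢf)²`.
  nlinarith [sq_nonneg (S0 - S1), sq_nonneg (a - S0), sq_nonneg (a - S1)]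

end Inequalities

/-! ### Solenoidal fields, Korn's inequality and `L²` bounds for the nonlinear terms. -/

/-- The convection term `v · ∇ vᵢ`. -/
def convec (v : Fin 2 → Plane → ℝ) (i : Fin 2) (x : Plane) : ℝ := ∑ j, v j x * pd j (v i) x

/-- The symmetric gradient of `v`. -/
def strain (v : Fin 2 → Plane → ℝ) (i j : Fin 2) (x : Plane) : ℝ :=
  (pd i (v j) x + pd j (v i) x) / 2

/-- The viscous force `div (2 c D v)`. -/
def viscForce (c : Plane → ℝ) (v : Fin 2 → Plane → ℝ) (i : Fin 2) (x : Plane) : ℝ :=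
  ∑ j, pd j (fun y => 2 * c y * strain v i j y) x

/-- The lower order part `2 D v ∇ c` of the viscous force. -/
def viscRest (c : Plane → ℝ) (v : Fin 2 → Plane → ℝ) (i : Fin 2) (x : Plane) : ℝ :=
  ∑ j, 2 * (pd j c x * strain v i j x)

/-- `‖v‖²_{L²}`. -/
def normSq (v : Fin 2 → Plane → ℝ) : ℝ := ∑ i, integ (fun x => v i x ^ 2)

/-- `‖∇ f‖²_{L²}` of a scalar function. -/
def gradSq (f : Plane → ℝ) : ℝ := ∑ i, integ (fun x => pd i f x ^ 2)

/-- `‖∇ v‖²_{L²}` of a vector field. -/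
def vgradSq (v : Fin 2 → Plane → ℝ) : ℝ := ∑ i, gradSq (v i)

/-- `‖Δ v‖²_{L²}` of a vector field. -/
def vlapSq (v : Fin 2 → Plane → ℝ) : ℝ := ∑ i, integ (fun x => lap (v i) x ^ 2)

/-- `v` is a smooth divergence free vector field on `𝕋²`. -/
structure Solenoidal (v : Fin 2 → Plane → ℝ) : Prop where
  smooth : ∀ i, TorusSmooth (v i)
  div_free : ∀ x, ∑ i, pd i (v i) x = 0

lemma integ_sq_nonneg (f : Plane → ℝ) : 0 ≤ integ (fun x => f x ^ 2) :=
  integ_nonneg fun _ => sq_nonneg _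

lemma normSq_nonneg (v : Fin 2 → Plane → ℝ) : 0 ≤ normSq v :=
  Finset.sum_nonneg fun _ _ => integ_sq_nonneg _

lemma gradSq_nonneg (f : Plane → ℝ) : 0 ≤ gradSq f :=
  Finset.sum_nonneg fun _ _ => integ_sq_nonneg _

lemma vgradSq_nonneg (v : Fin 2 → Plane → ℝ) : 0 ≤ vgradSq v :=
  Finset.sum_nonneg fun _ _ => gradSq_nonneg _

lemma vlapSq_nonneg (v : Fin 2 → Plane → ℝ) : 0 ≤ vlapSq v :=
  Finset.sum_nonneg fun _ _ => integ_sq_nonneg _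

lemma integ_sq_le_normSq (v : Fin 2 → Plane → ℝ) (i : Fin 2) :
    integ (fun x => v i x ^ 2) ≤ normSq v :=
  Finset.single_le_sum (f := fun i => integ (fun x => v i x ^ 2))
    (fun _ _ => integ_sq_nonneg _) (Finset.mem_univ i)

lemma integ_pd_sq_le_gradSq (f : Plane → ℝ) (i : Fin 2) :
    integ (fun x => pd i f x ^ 2) ≤ gradSq f :=
  Finset.single_le_sum (f := fun i => integ (fun x => pd i f x ^ 2))
    (fun _ _ => integ_sq_nonneg _) (Finset.mem_univ i)

lemma gradSq_le_vgradSq (v : Fin 2 → Plane → ℝ) (i : Fin 2) : gradSq (v i) ≤ vgradSq v :=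
  Finset.single_le_sum (f := fun i => gradSq (v i))
    (fun _ _ => gradSq_nonneg _) (Finset.mem_univ i)

lemma integ_lap_sq_le_vlapSq (v : Fin 2 → Plane → ℝ) (i : Fin 2) :
    integ (fun x => lap (v i) x ^ 2) ≤ vlapSq v :=
  Finset.single_le_sum (f := fun i => integ (fun x => lap (v i) x ^ 2))
    (fun _ _ => integ_sq_nonneg _) (Finset.mem_univ i)

lemma gradSq_pd_le {f : Plane → ℝ} (hf : TorusSmooth f) (i : Fin 2) :
    gradSq (pd i f) ≤ integ (fun x => lap f x ^ 2) := by
  rw [← sum_integ_sq_hess hf]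
  exact Finset.single_le_sum (f := fun i => ∑ j, integ (fun x => pd j (pd i f) x ^ 2))
    (fun i _ => Finset.sum_nonneg fun j _ => integ_sq_nonneg _) (Finset.mem_univ i)

section

variable {v w : Fin 2 → Plane → ℝ} {c θ μ g G : Plane → ℝ}

lemma TorusSmooth.convec (hv : ∀ i, TorusSmooth (v i)) (i : Fin 2) : TorusSmooth (convec v i) :=
  TorusSmooth.sum fun j => (hv j).mul ((hv i).pd j)

lemma TorusSmooth.strain (hv : ∀ i, TorusSmooth (v i)) (i j : Fin 2) :
    TorusSmooth (strain v i j) := by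
  have := (((hv j).pd i).add ((hv i).pd j)).mul (TorusSmooth.const (1 / 2))
  convert this using 2 with x
  simp [NSCH.strain]; ring

lemma TorusSmooth.viscForce (hc : TorusSmooth c) (hv : ∀ i, TorusSmooth (v i)) (i : Fin 2) :
    TorusSmooth (viscForce c v i) :=
  TorusSmooth.sum fun j =>
    (((TorusSmooth.const 2).mul hc).mul (TorusSmooth.strain hv i j)).pd j

lemma TorusSmooth.viscRest (hc : TorusSmooth c) (hv : ∀ i, TorusSmooth (v i)) (i : Fin 2) :
    TorusSmooth (viscRest c v i) :=
  TorusSmooth.sum fun j =>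
    (TorusSmooth.const 2).mul ((hc.pd j).mul (TorusSmooth.strain hv i j))

namespace Solenoidal

lemma sum_pd_pd (hv : Solenoidal v) (i : Fin 2) (x : Plane) :
    ∑ j, pd j (pd i (v j)) x = 0 := by
  have h : (fun x => ∑ j, pd j (v j) x) = fun _ => (0 : ℝ) := funext hv.div_free
  have h2 := pd_sum (s := Finset.univ) (fun j => (hv.smooth j).pd j) i x
  rw [h] at h2
  simp_rw [fun j => pd_comm (hv.smooth j) j i x, ← h2]
  simp [pd]

lemma neg_lap (hv : Solenoidal v) : Solenoidal fun i x => -lap (v i) x := by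
  refine ⟨fun i => (hv.smooth i).lap.neg, fun x => ?_⟩
  have h1 : ∀ i, pd i (fun x => -lap (v i) x) x = -∑ j, pd j (pd j (pd i (v i))) x := by
    intro i
    have := pd_const_mul (-1) (hv.smooth i).lap i x
    simp only [neg_mul, one_mul] at this
    rw [this, pd_lap (hv.smooth i)]
    rfl
  simp_rw [h1, Finset.sum_neg_distrib]
  rw [Finset.sum_comm, neg_eq_zero]
  refine Finset.sum_eq_zero fun j _ => ?_
  rw [← pd_sum (fun i => ((hv.smooth i).pd i).pd j)]
  have h2 : (fun y => ∑ i, pd j (pd i (v i)) y) = fun _ => 0 := by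
    funext y
    rw [← pd_sum (fun i => (hv.smooth i).pd i), funext hv.div_free]
    simp [pd]
  rw [h2]
  simp [pd]

/-- The product rule leaves `c (∂ⱼ∂ᵢvⱼ + ∂ⱼ∂ⱼvᵢ)` summed over `j`, and the first sum is `∂ᵢ div v =
0`. The remainder carries one derivative of `v` only. -/
lemma viscForce_eq (hv : Solenoidal v) (hc : TorusSmooth c) (i : Fin 2) (x : Plane) :
    viscForce c v i x = c x * lap (v i) x + viscRest c v i x := by
  have h1 : ∀ j, pd j (fun y => 2 * c y * strain v i j y) x =
      2 * (pd j c x * strain v i j x) +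
        c x * (pd j (pd i (v j)) x + pd j (pd j (v i)) x) := by
    intro j
    rw [pd_mul ((TorusSmooth.const 2).mul hc) (TorusSmooth.strain hv.smooth i j),
      pd_const_mul 2 hc]
    have : strain v i j = fun y => (1 / 2) * (pd i (v j) y + pd j (v i) y) := by
      funext y; rw [strain]; ring
    rw [this, pd_const_mul _ (((hv.smooth j).pd i).add ((hv.smooth i).pd j)),
      pd_add ((hv.smooth j).pd i) ((hv.smooth i).pd j)]
    ring
  simp_rw [viscForce, h1, Finset.sum_add_distrib, ← Finset.mul_sum, Finset.sum_add_distrib,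
    hv.sum_pd_pd i x, zero_add, viscRest, lap]
  rw [← Finset.mul_sum]
  ring

/-- A solenoidal field is orthogonal to gradients. -/
lemma sum_integ_mul_pd (hv : Solenoidal v) (hG : TorusSmooth G) :
    ∑ i, integ (fun x => v i x * pd i G x) = 0 := by
  simp_rw [fun i => integ_mul_pd (hv.smooth i) hG i, Finset.sum_neg_distrib]
  rw [← integ_sum fun i => ((hv.smooth i).pd i |>.mul hG).continuous]
  simp_rw [← Finset.sum_mul, hv.div_free]
  simp [integ]

/-- `v · (v · ∇v)` is half of `v · ∇|v|²`, and `v` is orthogonal to gradients. -/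
lemma sum_integ_mul_convec (hv : Solenoidal v) :
    ∑ i, integ (fun x => v i x * convec v i x) = 0 := by
  have hG : TorusSmooth fun x => ∑ i, v i x ^ 2 := TorusSmooth.sum fun i => (hv.smooth i).pow 2
  have h := hv.sum_integ_mul_pd hG
  have h1 : ∀ i x, pd i (fun x => ∑ i, v i x ^ 2) x = ∑ k, 2 * (v k x * pd i (v k) x) := by
    intro i x
    rw [pd_sum fun k => (hv.smooth k).pow 2]
    refine Finset.sum_congr rfl fun k _ => ?_
    rw [pd_pow (hv.smooth k)]; push_cast; ring
  rw [← integ_sum fun i => ((hv.smooth i).mul (hG.pd i)).continuous] at h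
  rw [← integ_sum fun i => ((hv.smooth i).mul (TorusSmooth.convec hv.smooth i)).continuous]
  have h2 : (fun x => ∑ i, v i x * pd i (fun x => ∑ i, v i x ^ 2) x) =
      fun x => 2 * ∑ i, v i x * convec v i x := by
    funext x
    simp only [h1]
    simp only [convec, Fin.sum_univ_two]
    ring
  rw [h2, integ_const_mul] at h
  linarith

lemma integ_sum_pd_mul_pd (hv : Solenoidal v) :
    integ (fun x => ∑ i, ∑ j, pd i (v j) x * pd j (v i) x) = 0 := by
  have hs : ∀ i j, TorusSmooth fun x => pd i (v j) x * pd j (v i) x := fun i j =>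
    ((hv.smooth j).pd i).mul ((hv.smooth i).pd j)
  rw [integ_sum fun i => (TorusSmooth.sum fun j => hs i j).continuous]
  refine Finset.sum_eq_zero fun i _ => ?_
  rw [integ_sum fun j => (hs i j).continuous]
  simp_rw [fun j => integ_mul_pd ((hv.smooth j).pd i) (hv.smooth i) j, Finset.sum_neg_distrib]
  rw [← integ_sum fun j => ((((hv.smooth j).pd i).pd j).mul (hv.smooth i)).continuous]
  simp_rw [← Finset.sum_mul, hv.sum_pd_pd i]
  simp [integ]

lemma vgradSq_eq (hv : ∀ i, TorusSmooth (v i)) :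
    vgradSq v = integ (fun x => ∑ i, ∑ j, pd j (v i) x ^ 2) := by
  have hs : ∀ i j, TorusSmooth fun x => pd j (v i) x ^ 2 := fun i j => ((hv i).pd j).pow 2
  rw [integ_sum fun i => (TorusSmooth.sum fun j => hs i j).continuous]
  exact Finset.sum_congr rfl fun i _ => (integ_sum fun j => (hs i j).continuous).symm

/-- Korn's inequality and the dissipation of the viscous force. -/
lemma sum_integ_mul_viscForce_le (hv : Solenoidal v) (hc : TorusSmooth c) {κ : ℝ}
    (hκ : ∀ x, κ ≤ c x) :
    ∑ i, integ (fun x => v i x * viscForce c v i x) ≤ -(κ * vgradSq v) := by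
  have hD := TorusSmooth.strain hv.smooth
  have hcD : ∀ i j, TorusSmooth fun y => 2 * c y * strain v i j y := fun i j =>
    ((TorusSmooth.const 2).mul hc).mul (hD i j)
  have hdiss : TorusSmooth fun x => 2 * c x * ∑ i, ∑ j, strain v i j x ^ 2 :=
    ((TorusSmooth.const 2).mul hc).mul (TorusSmooth.sum fun i => TorusSmooth.sum fun j =>
      (hD i j).pow 2)
  have h1 : ∑ i, integ (fun x => v i x * viscForce c v i x) =
      -integ (fun x => 2 * c x * ∑ i, ∑ j, strain v i j x ^ 2) := by
    have h2 : ∀ i, integ (fun x => v i x * viscForce c v i x) =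
        -integ (fun x => ∑ j, pd j (v i) x * (2 * c x * strain v i j x)) := by
      intro i
      simp_rw [viscForce, Finset.mul_sum]
      rw [integ_sum fun j => ((hv.smooth i).mul ((hcD i j).pd j)).continuous,
        integ_sum fun j => (((hv.smooth i).pd j).mul (hcD i j)).continuous,
        ← Finset.sum_neg_distrib]
      exact Finset.sum_congr rfl fun j _ => integ_mul_pd (hv.smooth i) (hcD i j) j
    simp_rw [h2, Finset.sum_neg_distrib]
    rw [← integ_sum fun i =>
      (TorusSmooth.sum fun j => ((hv.smooth i).pd j).mul (hcD i j)).continuous]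
    congr 2
    funext x
    simp only [Fin.sum_univ_two, strain]
    ring
  rw [h1, neg_le_neg_iff]
  have hp := TorusSmooth.sum (s := Finset.univ) fun i => TorusSmooth.sum (s := Finset.univ)
    fun j => ((hv.smooth j).pd i).mul ((hv.smooth i).pd j)
  have hq := TorusSmooth.sum (s := Finset.univ) fun i => TorusSmooth.sum (s := Finset.univ)
    fun j => ((hv.smooth i).pd j).pow 2
  -- The cross terms `∂ᵢvⱼ ∂ⱼvᵢ` integrate to zero; adding them completes `|∇v|²` to `2|Dv|²`, which
  -- is compared pointwise with the dissipation.
  have h3 : κ * vgradSq v = integ (fun x => κ * (∑ i, ∑ j, pd j (v i) x ^ 2 +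
      ∑ i, ∑ j, pd i (v j) x * pd j (v i) x)) := by
    rw [integ_const_mul, integ_add hq.continuous hp.continuous, hv.integ_sum_pd_mul_pd,
      vgradSq_eq hv.smooth, add_zero]
  rw [h3]
  refine integ_mono ((TorusSmooth.const κ).mul (hq.add hp)).continuous hdiss.continuous fun x => ?_
  have h4 : ∑ i, ∑ j, pd j (v i) x ^ 2 + ∑ i, ∑ j, pd i (v j) x * pd j (v i) x =
      2 * ∑ i, ∑ j, strain v i j x ^ 2 := by
    simp only [Fin.sum_univ_two, strain]; ring
  rw [h4]
  have : 0 ≤ ∑ i, ∑ j, strain v i j x ^ 2 :=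
    Finset.sum_nonneg fun i _ => Finset.sum_nonneg fun j _ => sq_nonneg _
  nlinarith [hκ x]

end Solenoidal

/-- Cauchy-Schwarz followed by `√(AB) ≤ εA + B/(4ε)`. In the applications `A = ‖∇v‖² + ‖Δv‖²`, to be
absorbed by the dissipation, and `B` contains no second derivative of `v`. -/
lemma integ_sq_mul_sq_le {p q : Plane → ℝ} (hp : TorusSmooth p) (hq : TorusSmooth q)
    {A B ε : ℝ} (hA : 0 ≤ A) (hB : 0 ≤ B) (hε : 0 < ε)
    (h : integ (fun x => p x ^ 4) * integ (fun x => q x ^ 4) ≤ A * B) :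
    integ (fun x => p x ^ 2 * q x ^ 2) ≤ ε * A + (4 * ε)⁻¹ * B := by
  have h1 := sq_integ_mul_le (hp.pow 2).continuous (hq.pow 2).continuous
  simp_rw [← pow_mul] at h1
  norm_num at h1
  refine (le_abs_self _).trans (abs_le_of_sq_le_sq (h1.trans (h.trans ?_)) (by positivity))
  have : (ε * A + (4 * ε)⁻¹ * B) ^ 2 - A * B = (ε * A - (4 * ε)⁻¹ * B) ^ 2 := by
    field_simp; ring
  nlinarith [sq_nonneg (ε * A - (4 * ε)⁻¹ * B)]

lemma integ_pow_four_le (hv : ∀ i, TorusSmooth (v i)) (i : Fin 2) :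
    integ (fun x => v i x ^ 4) ≤ 4 * normSq v * (normSq v + vgradSq v) := by
  refine (ladyzhenskaya (hv i)).trans ?_
  have h1 := integ_sq_le_normSq v i
  have h2 := gradSq_le_vgradSq v i
  have h3 := integ_sq_nonneg (v i)
  have h4 := gradSq_nonneg (v i)
  have h5 := normSq_nonneg v
  exact mul_le_mul (by linarith) (add_le_add h1 h2) (add_nonneg h3 h4) (by linarith)

lemma integ_pd_pow_four_le_vgradSq (hv : ∀ i, TorusSmooth (v i)) (i j : Fin 2) :
    integ (fun x => pd j (v i) x ^ 4) ≤ 4 * vgradSq v * (vgradSq v + vlapSq v) := by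
  refine (ladyzhenskaya ((hv i).pd j)).trans ?_
  have h1 := (integ_pd_sq_le_gradSq (v i) j).trans (gradSq_le_vgradSq v i)
  have h2 := (gradSq_pd_le (hv i) j).trans (integ_lap_sq_le_vlapSq v i)
  have h3 := integ_sq_nonneg (pd j (v i))
  have h4 := gradSq_nonneg (pd j (v i))
  have h5 := vgradSq_nonneg v
  exact mul_le_mul (by linarith) (add_le_add h1 h2) (add_nonneg h3 h4) (by linarith)

/-- The convection term in `L²`. -/
lemma normSq_convec_le (hv : ∀ i, TorusSmooth (v i)) {δ : ℝ} (hδ : 0 < δ) :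
    normSq (convec v) ≤ δ * (vgradSq v + vlapSq v) +
      256 / δ * (normSq v * (normSq v + vgradSq v) * vgradSq v) := by
  have ha := normSq_nonneg v
  have hy := vgradSq_nonneg v
  have hz := vlapSq_nonneg v
  set a := normSq v
  set y := vgradSq v
  set z := vlapSq v
  -- The weight is `δ/8` because four products enter, each doubled by `(p + q)² ≤ 2p² + 2q²`.
  have h1 : ∀ i j, integ (fun x => v j x ^ 2 * pd j (v i) x ^ 2) ≤
      δ / 8 * (y + z) + (4 * (δ / 8))⁻¹ * (16 * (a * (a + y) * y)) := by
    intro i j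
    refine integ_sq_mul_sq_le (hv j) ((hv i).pd j) (by positivity) (by positivity)
      (by positivity) ?_
    have h2 := mul_le_mul (integ_pow_four_le hv j) (integ_pd_pow_four_le_vgradSq hv i j)
      (integ_nonneg fun x => by positivity) (by positivity)
    refine h2.trans (le_of_eq ?_)
    ring
  have hs : ∀ i j, TorusSmooth fun x => v j x ^ 2 * pd j (v i) x ^ 2 := fun i j =>
    ((hv j).pow 2).mul (((hv i).pd j).pow 2)
  have h3 : ∀ i, integ (fun x => convec v i x ^ 2) ≤
      2 * ∑ j, integ (fun x => v j x ^ 2 * pd j (v i) x ^ 2) := by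
    intro i
    rw [← integ_sum fun j => (hs i j).continuous, ← integ_const_mul]
    refine integ_mono ((TorusSmooth.convec hv i).pow 2).continuous
      ((TorusSmooth.const 2).mul (TorusSmooth.sum (hs i))).continuous fun x => ?_
    simp only [convec, Fin.sum_univ_two]
    nlinarith [sq_nonneg (v 0 x * pd 0 (v i) x - v 1 x * pd 1 (v i) x)]
  have e : (4 * (δ / 8))⁻¹ * (16 * (a * (a + y) * y)) = 32 / δ * (a * (a + y) * y) := by
    field_simp; ring
  have e2 : 256 / δ * (a * (a + y) * y) = 8 * (32 / δ * (a * (a + y) * y)) := by ring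
  simp_rw [e] at h1
  rw [normSq, e2]
  simp only [Fin.sum_univ_two] at h3 ⊢
  linarith [h3 0, h3 1, h1 0 0, h1 0 1, h1 1 0, h1 1 1]

/-- The lower order part of the viscous force in `L²`. -/
lemma normSq_viscRest_le (hv : ∀ i, TorusSmooth (v i)) (hθ : TorusSmooth θ)
    (hb : ∀ x, |θ x| ≤ 1) (hc : TorusSmooth c) {L : ℝ} (hL : 0 < L)
    (hcθ : ∀ j x, |pd j c x| ≤ L * |pd j θ x|) {δ : ℝ} (hδ : 0 < δ) :
    normSq (viscRest c v) ≤ δ * (vgradSq v + vlapSq v) +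
      9216 * L ^ 4 / δ * (integ (fun x => lap θ x ^ 2) * vgradSq v) := by
  have hy := vgradSq_nonneg v
  have hz := vlapSq_nonneg v
  have hw := integ_sq_nonneg (lap θ)
  set y := vgradSq v
  set z := vlapSq v
  set w := integ (fun x => lap θ x ^ 2)
  -- Each of the two components collects four products with weight `4L²`, so the total weight is
  -- `32L²`. The `36` below is `9 * 4`, from the two `L⁴` bounds.
  set ε := δ / (32 * L ^ 2)
  have hε : 0 < ε := by positivity
  have h1 : ∀ j k l, integ (fun x => pd j θ x ^ 2 * pd k (v l) x ^ 2) ≤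
      ε * (y + z) + (4 * ε)⁻¹ * (36 * (w * y)) := by
    intro j k l
    refine integ_sq_mul_sq_le (hθ.pd j) ((hv l).pd k) (by positivity) (by positivity) hε ?_
    have h2 := mul_le_mul (integ_pd_pow_four_le hθ hb j) (integ_pd_pow_four_le_vgradSq hv l k)
      (integ_nonneg fun x => by positivity) (by positivity)
    refine h2.trans (le_of_eq ?_)
    ring
  have hs : ∀ j k l, TorusSmooth fun x => pd j θ x ^ 2 * pd k (v l) x ^ 2 := fun j k l =>
    ((hθ.pd j).pow 2).mul (((hv l).pd k).pow 2)
  have h3 : ∀ i, integ (fun x => viscRest c v i x ^ 2) ≤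
      4 * L ^ 2 * (∑ j, (integ (fun x => pd j θ x ^ 2 * pd i (v j) x ^ 2) +
        integ (fun x => pd j θ x ^ 2 * pd j (v i) x ^ 2))) := by
    intro i
    simp_rw [fun j => (integ_add (hs j i j).continuous (hs j j i).continuous).symm]
    rw [← integ_sum fun j => ((hs j i j).add (hs j j i)).continuous, ← integ_const_mul]
    refine integ_mono ((TorusSmooth.viscRest hc hv i).pow 2).continuous
      ((TorusSmooth.const _).mul (TorusSmooth.sum fun j =>
        (hs j i j).add (hs j j i))).continuous fun x => ?_
    have h4 : ∀ j, (2 * (pd j c x * strain v i j x)) ^ 2 ≤ 2 * L ^ 2 *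
        (pd j θ x ^ 2 * pd i (v j) x ^ 2 + pd j θ x ^ 2 * pd j (v i) x ^ 2) := by
      intro j
      have h5 : pd j c x ^ 2 ≤ L ^ 2 * pd j θ x ^ 2 := by
        rw [← sq_abs (pd j c x), ← sq_abs (pd j θ x), ← mul_pow]
        exact pow_le_pow_left₀ (abs_nonneg _) (hcθ j x) 2
      have h6 : (2 * strain v i j x) ^ 2 ≤ 2 * (pd i (v j) x ^ 2 + pd j (v i) x ^ 2) := by
        rw [strain]; nlinarith [sq_nonneg (pd i (v j) x - pd j (v i) x)]
      calc (2 * (pd j c x * strain v i j x)) ^ 2 = pd j c x ^ 2 * (2 * strain v i j x) ^ 2 := by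
            ring
        _ ≤ (L ^ 2 * pd j θ x ^ 2) * (2 * (pd i (v j) x ^ 2 + pd j (v i) x ^ 2)) :=
            mul_le_mul h5 h6 (sq_nonneg _) (by positivity)
        _ = _ := by ring
    have h40 := h4 0
    have h41 := h4 1
    simp only [viscRest, Fin.sum_univ_two]
    nlinarith [sq_nonneg (2 * (pd 0 c x * strain v i 0 x) - 2 * (pd 1 c x * strain v i 1 x))]
  have h7 : normSq (viscRest c v) ≤ 32 * L ^ 2 * (ε * (y + z) + (4 * ε)⁻¹ * (36 * (w * y))) := by
    have h8 : ∀ i, integ (fun x => viscRest c v i x ^ 2) ≤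
        4 * L ^ 2 * (4 * (ε * (y + z) + (4 * ε)⁻¹ * (36 * (w * y)))) := by
      intro i
      refine (h3 i).trans (mul_le_mul_of_nonneg_left ?_ (by positivity))
      rw [Fin.sum_univ_two]
      linarith [h1 0 i 0, h1 0 0 i, h1 1 i 1, h1 1 1 i]
    rw [normSq, Fin.sum_univ_two]
    linarith [h8 0, h8 1]
  refine h7.trans (le_of_eq ?_)
  simp only [ε]
  field_simp
  ring

end

/-! ### The momentum equation tested with the velocity, its negative Laplacian and the acceleration.
-/

/-- The momentum balance at a fixed time: `a` is the time derivative of the velocity `v`, the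
viscosity is `c`, and the capillary force is `μ ∇ θ`. -/
structure MomentumBalance (v a : Fin 2 → Plane → ℝ) (θ μ g c : Plane → ℝ) : Prop where
  vel : Solenoidal v
  acc : Solenoidal a
  θ_smooth : TorusSmooth θ
  μ_smooth : TorusSmooth μ
  g_smooth : TorusSmooth g
  c_smooth : TorusSmooth c
  balance : ∀ x i, a i x + convec v i x - viscForce c v i x + pd i g x = μ x * pd i θ x

namespace MomentumBalance

variable {v a : Fin 2 → Plane → ℝ} {θ μ g c : Plane → ℝ}

lemma sum_integ_mul (h : MomentumBalance v a θ μ g c) {w : Fin 2 → Plane → ℝ}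
    (hw : Solenoidal w) :
    ∑ i, integ (fun x => w i x * a i x) = -∑ i, integ (fun x => w i x * convec v i x) +
      ∑ i, integ (fun x => w i x * viscForce c v i x) +
      ∑ i, integ (fun x => μ x * (w i x * pd i θ x)) := by
  have hp := hw.sum_integ_mul_pd h.g_smooth
  have e : ∀ i, integ (fun x => w i x * a i x) = -integ (fun x => w i x * convec v i x) +
      integ (fun x => w i x * viscForce c v i x) - integ (fun x => w i x * pd i g x) +
      integ (fun x => μ x * (w i x * pd i θ x)) := by
    intro i
    have s1 := (hw.smooth i).mul (TorusSmooth.convec h.vel.smooth i)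
    have s2 := (hw.smooth i).mul (TorusSmooth.viscForce h.c_smooth h.vel.smooth i)
    have s3 := (hw.smooth i).mul (h.g_smooth.pd i)
    have s4 := h.μ_smooth.mul ((hw.smooth i).mul (h.θ_smooth.pd i))
    rw [← integ_neg, ← integ_add s1.neg.continuous s2.continuous,
      ← integ_sub (s1.neg.add s2).continuous s3.continuous,
      ← integ_add ((s1.neg.add s2).sub s3).continuous s4.continuous]
    congr 1
    funext x
    linear_combination (w i x) * h.balance x i
  simp only [Fin.sum_univ_two] at hp ⊢
  rw [e 0, e 1]
  linarith

/-- `μ∇θ` and `-θ∇μ` differ by the gradient of `μθ`, to which `w` is orthogonal. The second form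
needs only `|θ| ≤ 1` and `∇μ ∈ L²`. -/
lemma sum_integ_capillary (h : MomentumBalance v a θ μ g c) {w : Fin 2 → Plane → ℝ}
    (hw : Solenoidal w) :
    ∑ i, integ (fun x => μ x * (w i x * pd i θ x)) =
      -∑ i, integ (fun x => w i x * (θ x * pd i μ x)) := by
  have hp := hw.sum_integ_mul_pd (h.μ_smooth.mul h.θ_smooth)
  have e : ∀ i, integ (fun x => w i x * pd i (fun y => μ y * θ y) x) =
      integ (fun x => w i x * (θ x * pd i μ x)) +
      integ (fun x => μ x * (w i x * pd i θ x)) := by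
    intro i
    rw [← integ_add ((hw.smooth i).mul (h.θ_smooth.mul (h.μ_smooth.pd i))).continuous
      (h.μ_smooth.mul ((hw.smooth i).mul (h.θ_smooth.pd i))).continuous]
    congr 1
    funext x
    rw [pd_mul h.μ_smooth h.θ_smooth]
    ring
  simp only [Fin.sum_univ_two, e] at hp ⊢
  linarith

/-- The kinetic energy balance. -/
lemma sum_integ_vel_mul_acc_le (h : MomentumBalance v a θ μ g c) {κ : ℝ} (hκ : ∀ x, κ ≤ c x) :
    ∑ i, integ (fun x => v i x * a i x) ≤
      -(κ * vgradSq v) + ∑ i, integ (fun x => μ x * (v i x * pd i θ x)) := by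
  rw [h.sum_integ_mul h.vel, h.vel.sum_integ_mul_convec]
  linarith [h.vel.sum_integ_mul_viscForce_le h.c_smooth hκ]

lemma normSq_capillary_le (h : MomentumBalance v a θ μ g c) (hb : ∀ x, |θ x| ≤ 1) :
    normSq (fun i x => θ x * pd i μ x) ≤ gradSq μ := by
  refine Finset.sum_le_sum fun i _ => ?_
  refine integ_mono ((h.θ_smooth.mul (h.μ_smooth.pd i)).pow 2).continuous
    ((h.μ_smooth.pd i).pow 2).continuous fun x => ?_
  have := (sq_le_one_iff_abs_le_one _).2 (hb x)
  rw [mul_pow]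
  nlinarith [sq_nonneg (pd i μ x)]

lemma abs_sum_integ_mul_le {p q : Fin 2 → Plane → ℝ} (hp : ∀ i, TorusSmooth (p i))
    (hq : ∀ i, TorusSmooth (q i)) {ε : ℝ} (hε : 0 < ε) :
    |∑ i, integ (fun x => p i x * q i x)| ≤ ε * normSq p + (4 * ε)⁻¹ * normSq q := by
  have h1 : ∀ i, integ (fun x => p i x * q i x) ≤
      ε * integ (fun x => p i x ^ 2) + (4 * ε)⁻¹ * integ (fun x => q i x ^ 2) := fun i =>
    integ_mul_le (hp i).continuous (hq i).continuous hε
  have h2 : ∀ i, -integ (fun x => p i x * q i x) ≤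
      ε * integ (fun x => p i x ^ 2) + (4 * ε)⁻¹ * integ (fun x => q i x ^ 2) := by
    intro i
    have := integ_mul_le (hp i).neg.continuous (hq i).continuous hε
    simpa only [neg_mul, integ_neg, neg_sq] using this
  simp only [normSq, Fin.sum_univ_two]
  rw [abs_le]
  constructor <;> linarith [h1 0, h1 1, h2 0, h2 1]

/-- The enstrophy balance. -/
lemma sum_integ_neg_lap_mul_acc_le (h : MomentumBalance v a θ μ g c) {κ : ℝ} (hκ0 : 0 < κ)
    (hκ : ∀ x, κ ≤ c x) (hb : ∀ x, |θ x| ≤ 1) :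
    ∑ i, integ (fun x => -lap (v i) x * a i x) ≤ -(κ / 2 * vlapSq v) +
      3 / (2 * κ) * (normSq (convec v) + normSq (viscRest c v) + gradSq μ) := by
  have hw := h.vel.neg_lap
  -- Convection, lower order viscosity and capillarity each spend `κ/6` of the dissipation, leaving
  -- half of it.
  have hε : 0 < κ / 6 := by positivity
  have hn : normSq (fun i x => -lap (v i) x) = vlapSq v := by
    simp only [normSq, vlapSq, neg_sq]
  have hR := TorusSmooth.viscRest h.c_smooth h.vel.smooth
  have b1 := abs_le.1 (abs_sum_integ_mul_le hw.smooth (TorusSmooth.convec h.vel.smooth) hε)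
  have b2 := abs_le.1 (abs_sum_integ_mul_le hw.smooth hR hε)
  have b3 := abs_le.1 (abs_sum_integ_mul_le hw.smooth
    (fun i => h.θ_smooth.mul (h.μ_smooth.pd i)) hε)
  have b4 := h.normSq_capillary_le hb
  have b5 : ∑ i, integ (fun x => -lap (v i) x * viscForce c v i x) ≤
      -(κ * vlapSq v) + ∑ i, integ (fun x => -lap (v i) x * viscRest c v i x) := by
    rw [vlapSq, Finset.mul_sum, ← Finset.sum_neg_distrib, ← Finset.sum_add_distrib]
    refine Finset.sum_le_sum fun i _ => ?_
    have hl := (h.vel.smooth i).lap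
    rw [← integ_const_mul, ← integ_neg,
      ← integ_add ((TorusSmooth.const κ).mul (hl.pow 2)).neg.continuous
        (hl.neg.mul (hR i)).continuous]
    refine integ_mono (hl.neg.mul
      (TorusSmooth.viscForce h.c_smooth h.vel.smooth i)).continuous
      (((TorusSmooth.const κ).mul (hl.pow 2)).neg.add (hl.neg.mul (hR i))).continuous
      fun x => ?_
    rw [h.vel.viscForce_eq h.c_smooth]
    nlinarith [hκ x, sq_nonneg (lap (v i) x)]
  rw [h.sum_integ_mul hw, h.sum_integ_capillary hw]
  rw [hn] at b1 b2 b3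
  have e : (4 * (κ / 6))⁻¹ = 3 / (2 * κ) := by field_simp; ring
  rw [e] at b1 b2 b3
  have b6 := mul_le_mul_of_nonneg_left b4 (by positivity : 0 ≤ 3 / (2 * κ))
  linarith [b1.1, b2.2, b3.1]

/-- The acceleration in `L²`. -/
lemma normSq_acc_le (h : MomentumBalance v a θ μ g c) {K : ℝ} (hc : ∀ x, |c x| ≤ K)
    (hb : ∀ x, |θ x| ≤ 1) :
    normSq a ≤ 6 * (normSq (convec v) + K ^ 2 * vlapSq v + normSq (viscRest c v) + gradSq μ) := by
  have hR := TorusSmooth.viscRest h.c_smooth h.vel.smooth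
  have hL : ∀ i, TorusSmooth fun x => c x * lap (v i) x := fun i =>
    h.c_smooth.mul (h.vel.smooth i).lap
  -- Four terms at `1/8` use half of `‖a‖²`, which is absorbed on the left.
  have hε : (0 : ℝ) < 1 / 8 := by norm_num
  have b1 := abs_le.1 (abs_sum_integ_mul_le h.acc.smooth (TorusSmooth.convec h.vel.smooth) hε)
  have b2 := abs_le.1 (abs_sum_integ_mul_le h.acc.smooth hR hε)
  have b3 := abs_le.1 (abs_sum_integ_mul_le h.acc.smooth
    (fun i => h.θ_smooth.mul (h.μ_smooth.pd i)) hε)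
  have b4 := h.normSq_capillary_le hb
  have b5 := abs_le.1 (abs_sum_integ_mul_le h.acc.smooth hL hε)
  have b6 : normSq (fun i x => c x * lap (v i) x) ≤ K ^ 2 * vlapSq v := by
    rw [vlapSq, Finset.mul_sum]
    refine Finset.sum_le_sum fun i _ => ?_
    rw [← integ_const_mul]
    refine integ_mono ((hL i).pow 2).continuous
      ((TorusSmooth.const _).mul ((h.vel.smooth i).lap.pow 2)).continuous fun x => ?_
    have : c x ^ 2 ≤ K ^ 2 := by
      rw [← sq_abs]; exact pow_le_pow_left₀ (abs_nonneg _) (hc x) 2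
    rw [mul_pow]
    nlinarith [sq_nonneg (lap (v i) x)]
  have b7 : ∀ i, integ (fun x => a i x * viscForce c v i x) =
      integ (fun x => a i x * (c x * lap (v i) x)) + integ (fun x => a i x * viscRest c v i x) := by
    intro i
    rw [← integ_add ((h.acc.smooth i).mul (hL i)).continuous
      ((h.acc.smooth i).mul (hR i)).continuous]
    congr 1
    funext x
    rw [h.vel.viscForce_eq h.c_smooth]
    ring
  have b8 := h.sum_integ_mul h.acc
  rw [h.sum_integ_capillary h.acc] at b8
  have e : ∑ i, integ (fun x => a i x * a i x) = normSq a := by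
    simp only [normSq, sq]
  simp only [e, b7, Finset.sum_add_distrib] at b8
  rw [show (4 * (1 / 8 : ℝ))⁻¹ = 2 by norm_num] at b1 b2 b3 b5
  linarith [b1.1, b2.2, b3.1, b5.2, normSq_nonneg (convec v), normSq_nonneg (viscRest c v),
    gradSq_nonneg μ, mul_nonneg (sq_nonneg K) (vlapSq_nonneg v)]

end MomentumBalance

/-! ### Elliptic estimate for the concentration. -/

/-- Testing `μ = h - Δθ`, where `∇h = q ∇θ` and `q ≥ -α`, with `-Δθ`. -/
lemma integ_lap_sq_le {θ μ h q : Plane → ℝ} (hθ : TorusSmooth θ) (hμ : TorusSmooth μ)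
    (hh : TorusSmooth h) {α : ℝ} (hq : ∀ x, -α ≤ q x)
    (hp : ∀ i x, pd i h x = q x * pd i θ x) (hμθ : ∀ x, μ x = h x - lap θ x) :
    integ (fun x => lap θ x ^ 2) ≤ α * gradSq θ + (gradSq μ + gradSq θ) / 2 := by
  have hl := hθ.lap
  have e1 : ∀ i x, pd i μ x = pd i h x - pd i (lap θ) x := by
    intro i x
    rw [show μ = fun x => h x - lap θ x from funext hμθ, pd_sub hh hl]
  have h1 : ∀ i, -(α * integ (fun x => pd i θ x ^ 2)) + integ (fun x => lap θ x * pd i (pd i θ) x) ≤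
      (integ (fun x => pd i μ x ^ 2) + integ (fun x => pd i θ x ^ 2)) / 2 := by
    intro i
    have e2 : integ (fun x => lap θ x * pd i (pd i θ) x) =
        integ (fun x => pd i μ x * pd i θ x) - integ (fun x => pd i h x * pd i θ x) := by
      rw [integ_mul_pd hl (hθ.pd i) i, ← integ_sub ((hμ.pd i).mul (hθ.pd i)).continuous
        ((hh.pd i).mul (hθ.pd i)).continuous, ← integ_neg]
      congr 1
      funext x
      rw [e1]; ring
    -- After integration by parts the singular term is `∫ q (∂ᵢθ)²`, so only a lower bound on `q`
    -- enters.
    have e3 : -(α * integ (fun x => pd i θ x ^ 2)) ≤ integ (fun x => pd i h x * pd i θ x) := by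
      rw [← integ_const_mul, ← integ_neg]
      refine integ_mono ((TorusSmooth.const α).mul ((hθ.pd i).pow 2)).neg.continuous
        ((hh.pd i).mul (hθ.pd i)).continuous fun x => ?_
      rw [hp]
      nlinarith [hq x, sq_nonneg (pd i θ x)]
    have e4 := integ_mul_le (hμ.pd i).continuous (hθ.pd i).continuous
      (by norm_num : (0 : ℝ) < 1 / 2)
    norm_num at e4
    linarith
  have h2 : integ (fun x => lap θ x ^ 2) = ∑ i, integ (fun x => lap θ x * pd i (pd i θ) x) := by
    rw [← integ_sum fun i => (hl.mul ((hθ.pd i).pd i)).continuous]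
    congr 1
    funext x
    rw [← Finset.mul_sum, sq]
    rfl
  rw [h2]
  simp only [gradSq, Fin.sum_univ_two]
  linarith [h1 0, h1 1]

/-! ### Space-time smooth functions and differentiation under the integral. -/

/-- The time derivative `∂ₜ f (t, x)`. -/
def dt (f : ℝ → Plane → ℝ) (t : ℝ) (x : Plane) : ℝ := deriv (fun τ => f τ x) t

lemma isOpen_slab (T : ℝ) : IsOpen (Ioo 0 T ×ˢ (univ : Set Plane)) := isOpen_Ioo.prod isOpen_univ

namespace SmoothOn

variable {T : ℝ} {f g : ℝ → Plane → ℝ} {t : ℝ}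

lemma contDiffAt (hf : SmoothOn T f) (ht : t ∈ Ioo 0 T) (x : Plane) :
    ContDiffAt ℝ ∞ (fun p : ℝ × Plane => f p.1 p.2) (t, x) :=
  hf.smooth.contDiffAt ((isOpen_slab T).mem_nhds ⟨ht, mem_univ _⟩)

lemma torusSmooth (hf : SmoothOn T f) (ht : t ∈ Ioo 0 T) : TorusSmooth (f t) := by
  refine ⟨contDiff_iff_contDiffAt.2 fun x => ?_, hf.periodic t ht⟩
  exact (hf.contDiffAt ht x).comp x (contDiffAt_const.prodMk contDiffAt_id)

lemma hasFDerivAt (hf : SmoothOn T f) (ht : t ∈ Ioo 0 T) (x : Plane) :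
    HasFDerivAt (fun p : ℝ × Plane => f p.1 p.2)
      (fderiv ℝ (fun p : ℝ × Plane => f p.1 p.2) (t, x)) (t, x) :=
  ((hf.contDiffAt ht x).differentiableAt (by simp)).hasFDerivAt

lemma hasDerivAt_fderiv (hf : SmoothOn T f) (ht : t ∈ Ioo 0 T) (x : Plane) :
    HasDerivAt (fun τ => f τ x)
      (fderiv ℝ (fun p : ℝ × Plane => f p.1 p.2) (t, x) (1, 0)) t :=
  HasFDerivAt.comp_hasDerivAt (f := fun τ => (τ, x)) t (hf.hasFDerivAt ht x)
    ((hasDerivAt_id' t).prodMk (hasDerivAt_const t x))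

lemma dt_eq (hf : SmoothOn T f) (ht : t ∈ Ioo 0 T) (x : Plane) :
    dt f t x = fderiv ℝ (fun p : ℝ × Plane => f p.1 p.2) (t, x) (1, 0) :=
  (hf.hasDerivAt_fderiv ht x).deriv

lemma hasDerivAt (hf : SmoothOn T f) (ht : t ∈ Ioo 0 T) (x : Plane) :
    HasDerivAt (fun τ => f τ x) (dt f t x) t :=
  (hf.hasDerivAt_fderiv ht x).differentiableAt.hasDerivAt

lemma pd_eq (hf : SmoothOn T f) (ht : t ∈ Ioo 0 T) (i : Fin 2) (x : Plane) :
    NSCH.pd i (f t) x =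
      fderiv ℝ (fun p : ℝ × Plane => f p.1 p.2) (t, x) (0, Pi.single i 1) := by
  have h : HasFDerivAt (f t) ((fderiv ℝ (fun p : ℝ × Plane => f p.1 p.2) (t, x)).comp
      (ContinuousLinearMap.inr ℝ ℝ Plane)) x :=
    (hf.hasFDerivAt ht x).comp x (hasFDerivAt_prodMk_right t x)
  rw [NSCH.pd, h.fderiv]
  rfl

lemma contDiffOn_fderiv (hf : SmoothOn T f) (e : ℝ × Plane) :
    ContDiffOn ℝ ∞ (fun p => fderiv ℝ (fun p : ℝ × Plane => f p.1 p.2) p e)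
      (Ioo 0 T ×ˢ univ) :=
  (hf.smooth.fderiv_of_isOpen (isOpen_slab T) (m := ∞) (by simp)).clm_apply contDiffOn_const

lemma dt (hf : SmoothOn T f) : SmoothOn T (NSCH.dt f) := by
  refine ⟨(hf.contDiffOn_fderiv (1, 0)).congr fun p hp => hf.dt_eq hp.1 p.2, fun t ht x i => ?_⟩
  refine Filter.EventuallyEq.deriv_eq ?_
  filter_upwards [isOpen_Ioo.mem_nhds ht] with τ hτ using hf.periodic τ hτ x i

lemma pd (hf : SmoothOn T f) (i : Fin 2) : SmoothOn T fun t => NSCH.pd i (f t) :=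
  ⟨(hf.contDiffOn_fderiv (0, Pi.single i 1)).congr fun p hp => hf.pd_eq hp.1 i p.2,
    fun _ ht => ((hf.torusSmooth ht).pd i).periodic⟩

lemma add (hf : SmoothOn T f) (hg : SmoothOn T g) : SmoothOn T fun t x => f t x + g t x :=
  ⟨hf.1.add hg.1, fun t ht x i => by simp only [hf.2 t ht x i, hg.2 t ht x i]⟩

lemma pow (hf : SmoothOn T f) (n : ℕ) : SmoothOn T fun t x => f t x ^ n :=
  ⟨hf.1.pow n, fun t ht x i => by simp only [hf.2 t ht x i]⟩

lemma sum {ι : Type*} {s : Finset ι} {F : ι → ℝ → Plane → ℝ} (h : ∀ j, SmoothOn T (F j)) :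
    SmoothOn T fun t x => ∑ j ∈ s, F j t x :=
  ⟨ContDiffOn.sum fun j _ => (h j).1, fun t ht x i => by simp only [(h _).2 t ht x i]⟩

lemma lap (hf : SmoothOn T f) : SmoothOn T fun t => NSCH.lap (f t) :=
  SmoothOn.sum fun i => (hf.pd i).pd i

lemma comp (hf : SmoothOn T f) {φ : ℝ → ℝ} {s : Set ℝ}
    (hφ : ContDiffOn ℝ ∞ φ s) (h : ∀ t ∈ Ioo 0 T, ∀ x, f t x ∈ s) :
    SmoothOn T fun t x => φ (f t x) :=
  ⟨hφ.comp hf.1 fun p hp => h p.1 hp.1 p.2,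
    fun t ht x i => by simp only [hf.2 t ht x i]⟩

lemma apply {u : ℝ → Plane → Plane} (hu : SmoothOn T u) (i : Fin 2) :
    SmoothOn T fun t x => u t x i :=
  ⟨contDiffOn_pi.1 hu.1 i, fun t ht x j => by simp only [hu.2 t ht x j]⟩

lemma continuousOn (hf : SmoothOn T f) :
    ContinuousOn (fun p : ℝ × Plane => f p.1 p.2) (Ioo 0 T ×ˢ univ) := hf.1.continuousOn

/-- Time and space derivatives commute. -/
lemma dt_pd (hf : SmoothOn T f) (ht : t ∈ Ioo 0 T) (i : Fin 2) (x : Plane) :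
    NSCH.dt (fun t => NSCH.pd i (f t)) t x = NSCH.pd i (NSCH.dt f t) x := by
  set F : ℝ × Plane → ℝ := fun p => f p.1 p.2
  have hd : ∀ p ∈ Ioo 0 T ×ˢ (univ : Set Plane), DifferentiableAt ℝ (fderiv ℝ F) p := fun p hp =>
    ((hf.smooth.fderiv_of_isOpen (isOpen_slab T) (m := ∞) (by simp)).contDiffAt
      ((isOpen_slab T).mem_nhds hp)).differentiableAt (by simp)
  have hp : ((t, x) : ℝ × Plane) ∈ Ioo 0 T ×ˢ (univ : Set Plane) := ⟨ht, mem_univ _⟩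
  have key : ∀ e e' : ℝ × Plane, fderiv ℝ (fun p => fderiv ℝ F p e) (t, x) e' =
      fderiv ℝ (fderiv ℝ F) (t, x) e' e := by
    intro e e'
    rw [fderiv_clm_apply (hd _ hp) (differentiableAt_const _)]
    simp
  have h1 : NSCH.dt (fun t => NSCH.pd i (f t)) t x =
      fderiv ℝ (fun p => fderiv ℝ F p (0, Pi.single i 1)) (t, x) (1, 0) := by
    rw [(hf.pd i).dt_eq ht x]
    congr 1
    refine Filter.EventuallyEq.fderiv_eq ?_
    filter_upwards [(isOpen_slab T).mem_nhds hp] with p hp using hf.pd_eq hp.1 i p.2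
  have h2 : NSCH.pd i (NSCH.dt f t) x =
      fderiv ℝ (fun p => fderiv ℝ F p (1, 0)) (t, x) (0, Pi.single i 1) := by
    rw [hf.dt.pd_eq ht i x]
    congr 1
    refine Filter.EventuallyEq.fderiv_eq ?_
    filter_upwards [(isOpen_slab T).mem_nhds hp] with p hp using hf.dt_eq hp.1 p.2
  rw [h1, h2, key, key]
  refine ((hf.contDiffAt ht x).isSymmSndFDerivAt ?_) _ _
  rw [minSmoothness_of_isRCLikeNormedField]
  exact WithTop.coe_le_coe.2 (le_top : (2 : ℕ∞) ≤ ⊤)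

/-- Compactness of a closed time interval times the cell. This supplies the dominating constant for
differentiation under the integral, and later the local bound on `φ(θ)` that keeps `θ` off `±1`. -/
lemma bounded_near (hf : SmoothOn T f) (ht : t ∈ Ioo 0 T) :
    ∃ s ∈ 𝓝 t, s ⊆ Ioo 0 T ∧ ∃ C, ∀ τ ∈ s, ∀ x ∈ cell, |f τ x| ≤ C := by
  obtain ⟨ε, hε, hs⟩ := Metric.nhds_basis_closedBall.mem_iff.1 (isOpen_Ioo.mem_nhds ht)
  obtain ⟨C, hC⟩ := ((isCompact_closedBall t ε).prod isCompact_cell).exists_bound_of_continuousOn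
    (hf.continuousOn.mono (prod_mono hs (subset_univ _)))
  exact ⟨_, Metric.closedBall_mem_nhds t hε, hs, C, fun τ hτ x hx => hC (τ, x) ⟨hτ, hx⟩⟩

/-- Differentiation under the integral over `𝕋²`. -/
lemma hasDerivAt_integ (hf : SmoothOn T f) (ht : t ∈ Ioo 0 T) :
    HasDerivAt (fun τ => integ (f τ)) (integ (NSCH.dt f t)) t := by
  obtain ⟨s, hs, hsT, C, hC⟩ := hf.dt.bounded_near ht
  refine (hasDerivAt_integral_of_dominated_loc_of_deriv_le (F := f) (F' := NSCH.dt f)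
    (μ := volume.restrict cell) (bound := fun _ => C) hs ?_ (hf.torusSmooth ht).integrableOn
    (hf.dt.torusSmooth ht).continuous.aestronglyMeasurable ?_ ?_ ?_).2
  · filter_upwards [isOpen_Ioo.mem_nhds ht] with τ hτ
    exact (hf.torusSmooth hτ).continuous.aestronglyMeasurable
  · exact ae_restrict_of_forall_mem measurableSet_cell fun x hx τ hτ => hC τ hτ x hx
  · exact integrableOn_cell continuous_const
  · exact Eventually.of_forall fun x τ hτ => hf.hasDerivAt (hsT hτ) x

lemma continuousOn_integ (hf : SmoothOn T f) : ContinuousOn (fun τ => integ (f τ)) (Ioo 0 T) :=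
  fun _ ht => (hf.hasDerivAt_integ ht).continuousAt.continuousWithinAt

lemma hasDerivAt_integ_sq (hf : SmoothOn T f) (ht : t ∈ Ioo 0 T) :
    HasDerivAt (fun τ => integ (fun x => f τ x ^ 2))
      (2 * integ (fun x => f t x * NSCH.dt f t x)) t := by
  have h := (hf.pow 2).hasDerivAt_integ ht
  convert h using 1
  rw [← integ_const_mul]
  congr 1
  funext x
  have := ((hf.hasDerivAt ht x).fun_pow 2).deriv
  change _ = deriv (fun τ => f τ x ^ 2) t
  rw [this]
  push_cast
  ring

/-- `∂ₜ` commutes with `∂ᵢ`, and integration by parts moves `∂ᵢ` from `∂ₜf` onto `∂ᵢf`. -/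
lemma hasDerivAt_gradSq (hf : SmoothOn T f) (ht : t ∈ Ioo 0 T) :
    HasDerivAt (fun τ => gradSq (f τ))
      (2 * integ (fun x => -NSCH.lap (f t) x * NSCH.dt f t x)) t := by
  have h := HasDerivAt.fun_sum fun i (_ : i ∈ Finset.univ) => (hf.pd i).hasDerivAt_integ_sq ht
  refine h.congr_deriv ?_
  have hs := hf.torusSmooth ht
  have hd := hf.dt.torusSmooth ht
  rw [← Finset.mul_sum]
  congr 1
  have e : ∀ i, integ (fun x => NSCH.pd i (f t) x * NSCH.dt (fun t => NSCH.pd i (f t)) t x) =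
      integ (fun x => -NSCH.pd i (NSCH.pd i (f t)) x * NSCH.dt f t x) := by
    intro i
    simp_rw [hf.dt_pd ht i]
    rw [integ_mul_pd (hs.pd i) hd, ← integ_neg]
    simp only [neg_mul]
  simp_rw [e]
  rw [← integ_sum fun i => (((hs.pd i).pd i).neg.mul hd).continuous]
  congr 1
  funext x
  rw [← Finset.sum_mul, Finset.sum_neg_distrib]
  rfl

end SmoothOn

/-! ### Decreasing functionals and the integrability of their dissipation. -/

section Lyapunov

variable {T B : ℝ} {H H' D : ℝ → ℝ}

/-- A one-sided fundamental theorem of calculus, in which `D` is integrated and no integrability of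
`H'` is needed. -/
lemma integral_le_sub_of_deriv_le (hH : ∀ t ∈ Ioo 0 T, HasDerivAt H (H' t) t)
    (hD : ContinuousOn D (Ioo 0 T)) (hle : ∀ t ∈ Ioo 0 T, H' t ≤ -D t) {a b : ℝ}
    (ha : a ∈ Ioo 0 T) (hb : b ∈ Ioo 0 T) (hab : a ≤ b) :
    ∫ t in a..b, D t ≤ H a - H b := by
  have hsub : Icc a b ⊆ Ioo 0 T := fun t ht => ⟨ha.1.trans_le ht.1, ht.2.trans_lt hb.2⟩
  have h := intervalIntegral.integral_le_sub_of_hasDeriv_right_of_le (g := fun t => -H t)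
    (g' := fun t => -H' t) (φ := D) hab
    (fun t ht => (hH t (hsub ht)).continuousAt.continuousWithinAt.neg)
    (fun t ht => (hH t (hsub (Ioo_subset_Icc_self ht))).neg.hasDerivWithinAt)
    ((hD.mono hsub).integrableOn_compact isCompact_Icc)
    (fun t ht => by linarith [hle t (hsub (Ioo_subset_Icc_self ht))])
  linarith

/-- A functional which decreases along the evolution is bounded by its initial values. -/
lemma le_of_deriv_nonpos (hH : ∀ t ∈ Ioo 0 T, HasDerivAt H (H' t) t)
    (hle : ∀ t ∈ Ioo 0 T, H' t ≤ 0) (hB : ∀ᶠ t in 𝓝[>] 0, H t ≤ B) :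
    ∀ t ∈ Ioo 0 T, H t ≤ B := by
  intro t ht
  obtain ⟨s, hs, hst⟩ := (hB.and (Ioo_mem_nhdsGT ht.1)).exists
  have h := integral_le_sub_of_deriv_le (D := fun _ => 0) hH continuousOn_const
    (by simpa using hle) ⟨hst.1, hst.2.trans ht.2⟩ ht hst.2.le
  simp only [intervalIntegral.integral_zero] at h
  linarith

/-- The dissipation of a bounded functional is integrable. -/
lemma lintegral_le_of_deriv_le (hT : 0 < T) (hH : ∀ t ∈ Ioo 0 T, HasDerivAt H (H' t) t)
    (hD : ContinuousOn D (Ioo 0 T)) (hD0 : ∀ t ∈ Ioo 0 T, 0 ≤ D t)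
    (hle : ∀ t ∈ Ioo 0 T, H' t ≤ -D t) (hB : ∀ t ∈ Ioo 0 T, |H t| ≤ B) :
    ∫⁻ t in Ioo 0 T, ENNReal.ofReal (D t) ≤ ENNReal.ofReal (2 * B) := by
  -- `(0, T)` is exhausted by the compact intervals `[a n, b n]`, as nothing is assumed at the
  -- endpoints; the shift by `3` makes them nonempty from `n = 0` on.
  set a : ℕ → ℝ := fun n => T / (n + 3)
  set b : ℕ → ℝ := fun n => T - T / (n + 3)
  have hlim : Tendsto a atTop (𝓝 0) := by
    have h := (tendsto_natCast_atTop_atTop (R := ℝ)).atTop_add (tendsto_const_nhds (x := (3 : ℝ)))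
    exact h.const_div_atTop T
  have hlimb : Tendsto b atTop (𝓝 T) := by simpa using tendsto_const_nhds.sub hlim
  have hcov := aecover_Ioo_of_Icc (μ := (volume : Measure ℝ)) hlim hlimb
  have hmeas : AEMeasurable (fun t => ENNReal.ofReal (D t)) (volume.restrict (Ioo 0 T)) :=
    (hD.aemeasurable measurableSet_Ioo).ennreal_ofReal
  refine le_of_tendsto' (hcov.lintegral_tendsto_of_countably_generated hmeas) fun n => ?_
  have hn : (0 : ℝ) < n + 3 := by positivity
  have ha0 : 0 < a n := by positivity
  have hab : a n ≤ b n := by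
    have : T / (n + 3) ≤ T / 2 :=
      div_le_div_of_nonneg_left hT.le (by norm_num) (by linarith [Nat.cast_nonneg (α := ℝ) n])
    simp only [a, b]; linarith
  have haT : a n ∈ Ioo 0 T := ⟨ha0, by simp only [b] at hab; simp only [a] at *; linarith⟩
  have hbT : b n ∈ Ioo 0 T := ⟨ha0.trans_le hab, by simp only [a, b] at *; linarith⟩
  have hsub : Icc (a n) (b n) ⊆ Ioo 0 T := fun t ht => ⟨haT.1.trans_le ht.1, ht.2.trans_lt hbT.2⟩
  rw [Measure.restrict_restrict measurableSet_Icc, inter_eq_left.2 hsub,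
    ← ofReal_integral_eq_lintegral_ofReal
      ((hD.mono hsub).integrableOn_compact isCompact_Icc)
      (ae_restrict_of_forall_mem measurableSet_Icc fun t ht => hD0 t (hsub ht)),
    integral_Icc_eq_integral_Ioc, ← intervalIntegral.integral_of_le hab]
  refine ENNReal.ofReal_le_ofReal ((integral_le_sub_of_deriv_le hH hD hle haT hbT hab).trans ?_)
  linarith [(abs_le.1 (hB _ haT)).2, (abs_le.1 (hB _ hbT)).1]

end Lyapunov

/-! ### Fourier series on the cell, transported from the unit torus. -/

section Torus

/-- The Haar probability measure on `ℝ / ℤ`. -/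
local instance : MeasureSpace UnitAddCircle := ⟨AddCircle.haarAddCircle⟩

/-- The measure on `ℝ / ℤ` is a probability measure. -/
local instance : IsProbabilityMeasure (volume : Measure UnitAddCircle) :=
  inferInstanceAs (IsProbabilityMeasure AddCircle.haarAddCircle)

/-- The unit torus as a subset of the periodicity cell. -/
def toCell (z : UnitAddTorus (Fin 2)) : Plane :=
  (2 * Real.pi) • (UnitAddTorus.measurableEquivPiIoc (fun _ => 0) z).1

lemma measurableEmbedding_toCell : MeasurableEmbedding toCell := by
  have h1 := (UnitAddTorus.measurableEquivPiIoc (fun _ : Fin 2 => 0)).measurableEmbedding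
  have h2 := MeasurableEmbedding.subtype_coe
    (MeasurableSet.univ_pi' (fun _ : Fin 2 => measurableSet_Ioc (a := (0 : ℝ)) (b := 0 + 1)))
  have h3 := (Homeomorph.smulOfNeZero (2 * Real.pi) Real.two_pi_pos.ne'
    (α := Plane)).measurableEmbedding
  exact h3.comp (h2.comp h1)

/-- The torus is identified with `(0, 1]²` in a measure preserving way, and dilation by `2π` divides
Lebesgue measure by `(2π)²`. The half-open square `(0, 2π]²` differs from the cell by a null set. -/
lemma map_toCell : Measure.map toCell volume =
    ENNReal.ofReal (((2 * Real.pi) ^ 2)⁻¹) • volume.restrict cell := by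
  set S1 : Set Plane := {x | ∀ i, x i ∈ Ioc (0 : ℝ) (0 + 1)}
  set S2 : Set Plane := univ.pi fun _ => Ioc (0 : ℝ) (2 * Real.pi)
  have hS1 : MeasurableSet S1 := MeasurableSet.univ_pi' fun _ => measurableSet_Ioc
  have hS2 : MeasurableSet S2 := MeasurableSet.univ_pi fun _ => measurableSet_Ioc
  have hpre : (fun x : Plane => (2 * Real.pi) • x) ⁻¹' S2 = S1 := by
    ext x
    simp only [S1, S2, mem_preimage, mem_univ_pi, Pi.smul_apply, smul_eq_mul, mem_Ioc, zero_add,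
      mem_ofPred_eq]
    have := Real.two_pi_pos
    refine forall_congr' fun i => and_congr ?_ ?_
    · exact ⟨fun h => pos_of_mul_pos_right h this.le, fun h => by positivity⟩
    · exact ⟨fun h => by nlinarith, fun h => by nlinarith⟩
  have h1 : Measure.map (Subtype.val ∘ UnitAddTorus.measurableEquivPiIoc (fun _ : Fin 2 => 0))
      volume = volume.restrict S1 := by
    rw [← Measure.map_map measurable_subtype_coe
      (UnitAddTorus.measurableEquivPiIoc (fun _ : Fin 2 => 0)).measurable,
      (UnitAddTorus.measurePreserving_equivPiIoc (fun _ : Fin 2 => (0 : ℝ))).map_eq]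
    exact map_comap_subtype_coe hS1 volume
  have h2 : toCell = (fun x : Plane => (2 * Real.pi) • x) ∘
      (Subtype.val ∘ UnitAddTorus.measurableEquivPiIoc (fun _ : Fin 2 => 0)) := rfl
  rw [h2, ← Measure.map_map (measurable_const_smul _) (measurable_subtype_coe.comp
      (UnitAddTorus.measurableEquivPiIoc (fun _ : Fin 2 => 0)).measurable), h1, ← hpre,
    ← Measure.restrict_map (measurable_const_smul _) hS2,
    Measure.map_addHaar_smul _ Real.two_pi_pos.ne', Measure.restrict_smul]
  congr 1
  · congr 1
    rw [abs_of_pos (by positivity)]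
    simp
  · exact Measure.restrict_congr_set Measure.univ_pi_Ioc_ae_eq_Icc

lemma integral_comp_toCell {E : Type*} [NormedAddCommGroup E] [NormedSpace ℝ E] (F : Plane → E) :
    ∫ z, F (toCell z) = ((2 * Real.pi) ^ 2)⁻¹ • ∫ x in cell, F x := by
  rw [← measurableEmbedding_toCell.integral_map, map_toCell, integral_smul_measure,
    ENNReal.toReal_ofReal (by positivity)]

lemma memLp_comp_toCell {f : Plane → ℝ} (hf : MemLp f 2 (volume.restrict cell)) :
    MemLp (fun z => (f (toCell z) : ℂ)) 2 := by
  have h : MemLp f 2 (Measure.map toCell volume) := by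
    rw [map_toCell]
    exact hf.smul_measure ENNReal.ofReal_ne_top
  exact ((measurableEmbedding_toCell.memLp_map_measure_iff).1 h).ofReal

/-- `z i` is the class of `toCell z i / (2π)`, so the factor `2π` in the character of `ℝ/ℤ` is
absorbed by the dilation. -/
lemma mFourier_eq (n : Fin 2 → ℤ) (z : UnitAddTorus (Fin 2)) :
    UnitAddTorus.mFourier n z =
      Complex.exp (Complex.I * ((∑ i, (n i : ℝ) * toCell z i : ℝ) : ℂ)) := by
  have h : ∀ i, z i = (((UnitAddTorus.measurableEquivPiIoc (fun _ => 0) z).1 i : ℝ) :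
      UnitAddCircle) := fun i =>
    (congrFun ((UnitAddTorus.measurableEquivPiIoc (fun _ : Fin 2 => 0)).symm_apply_apply z) i).symm
  simp only [UnitAddTorus.mFourier, ContinuousMap.coe_mk]
  conv_lhs =>
    enter [2, i]
    rw [h i, fourier_coe_apply]
  rw [← Complex.exp_sum]
  congr 1
  push_cast
  rw [Finset.mul_sum]
  refine Finset.sum_congr rfl fun i _ => ?_
  simp only [toCell, Pi.smul_apply, smul_eq_mul]
  push_cast
  ring

lemma mFourierCoeff_comp_toCell (f : Plane → ℝ) (n : Fin 2 → ℤ) :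
    UnitAddTorus.mFourierCoeff (fun z => (f (toCell z) : ℂ)) n = fourierCoef f n := by
  have h := integral_comp_toCell fun x => (f x : ℂ) *
    Complex.exp (-(Complex.I * ((∑ i, (n i : ℝ) * x i : ℝ) : ℂ)))
  rw [UnitAddTorus.mFourierCoeff, fourierCoef, ← Complex.ofReal_inv, ← Complex.real_smul, ← h]
  congr 1
  funext z
  rw [mFourier_eq, smul_eq_mul, mul_comm]
  congr 2
  rw [← mul_neg, ← Complex.ofReal_neg, ← Finset.sum_neg_distrib]
  simp

/-- Parseval's identity. -/
lemma hasSum_sq_fourierCoef {f : Plane → ℝ} (hf : MemLp f 2 (volume.restrict cell)) :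
    HasSum (fun n => (2 * Real.pi) ^ 2 * ‖fourierCoef f n‖ ^ 2) (integ fun x => f x ^ 2) := by
  have hm := memLp_comp_toCell hf
  set F := MemLp.toLp _ hm
  have h := UnitAddTorus.hasSum_sq_mFourierCoeff F
  have h1 : ∀ n, UnitAddTorus.mFourierCoeff F n = fourierCoef f n := fun n => by
    rw [← mFourierCoeff_comp_toCell]
    exact integral_congr_ae (ae_eq_rfl.mul hm.coeFn_toLp)
  have h2 : ∫ z, ‖F z‖ ^ 2 = ((2 * Real.pi) ^ 2)⁻¹ * integ fun x => f x ^ 2 := by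
    rw [integ, ← smul_eq_mul, ← integral_comp_toCell]
    refine integral_congr_ae ?_
    filter_upwards [hm.coeFn_toLp] with z hz
    rw [hz]
    simp
  simp_rw [h1] at h
  rw [h2] at h
  have h3 := h.mul_left ((2 * Real.pi) ^ 2)
  rwa [mul_inv_cancel_left₀ (by positivity)] at h3

/-- A function with summable Fourier coefficients is bounded by their sum. -/
lemma ae_abs_le_tsum_fourierCoef {f : Plane → ℝ} (hf : MemLp f 2 (volume.restrict cell))
    (hs : Summable fun n => ‖fourierCoef f n‖) :
    ∀ᵐ x ∂volume.restrict cell, |f x| ≤ ∑' n, ‖fourierCoef f n‖ := by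
  have hm := memLp_comp_toCell hf
  set F := MemLp.toLp _ hm
  have h1 : ∀ n, UnitAddTorus.mFourierCoeff F n = fourierCoef f n := fun n => by
    rw [← mFourierCoeff_comp_toCell]
    exact integral_congr_ae (ae_eq_rfl.mul hm.coeFn_toLp)
  have hn : ∀ n, ‖fourierCoef f n • UnitAddTorus.mFourier (d := Fin 2) n‖ = ‖fourierCoef f n‖ :=
    fun n => by rw [norm_smul, UnitAddTorus.mFourier_norm, mul_one]
  have hs' : Summable fun n => ‖fourierCoef f n • UnitAddTorus.mFourier (d := Fin 2) n‖ := by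
    simpa only [hn] using hs
  set G := ∑' n, fourierCoef f n • UnitAddTorus.mFourier (d := Fin 2) n
  have hG : ‖G‖ ≤ ∑' n, ‖fourierCoef f n‖ := by
    simpa only [hn] using norm_tsum_le_tsum_norm hs'
  have h2 := UnitAddTorus.hasSum_mFourier_series_L2 F
  have h3 := (ContinuousMap.toLp (E := ℂ) 2 (volume : Measure (UnitAddTorus (Fin 2)))
    ℂ).hasSum hs'.of_norm.hasSum
  simp only [h1] at h2
  simp only [map_smul] at h3
  -- The series converges to `F` in `L²` and uniformly to the continuous function `G`, hence `F = G`
  -- almost everywhere.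
  have h4 := h2.unique h3
  have h5 : ∀ᵐ z : UnitAddTorus (Fin 2), |f (toCell z)| ≤ ∑' n, ‖fourierCoef f n‖ := by
    have h6 := ContinuousMap.coeFn_toLp (𝕜 := ℂ) (p := 2)
      (volume : Measure (UnitAddTorus (Fin 2))) G
    rw [← h4] at h6
    filter_upwards [hm.coeFn_toLp, h6] with z hz hz'
    have h7 := (G.norm_coe_le_norm z).trans hG
    rw [← hz', hz] at h7
    simpa using h7
  have h8 := (measurableEmbedding_toCell.ae_map_iff (μ := volume)
    (p := fun x => |f x| ≤ ∑' n, ‖fourierCoef f n‖)).2 h5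
  rw [map_toCell] at h8
  rwa [Measure.ae_ennreal_smul_measure_eq] at h8
  simp

end Torus

/-! ### Sobolev norms in terms of derivatives, and the embedding into `L^∞`. -/

variable {f g : Plane → ℝ}

lemma TorusSmooth.memLp (hf : TorusSmooth f) : MemLp f 2 (volume.restrict cell) := by
  have : IsFiniteMeasure (volume.restrict cell) := ⟨by
    simpa using isCompact_cell.measure_lt_top⟩
  obtain ⟨C, hC⟩ := isCompact_cell.exists_bound_of_continuousOn hf.continuous.continuousOn
  exact MemLp.of_bound hf.continuous.aestronglyMeasurable C
    (ae_restrict_of_forall_mem measurableSet_cell hC)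

lemma integrable_mul_exp (hf : IntegrableOn f cell) (n : Fin 2 → ℤ) :
    IntegrableOn (fun x => (f x : ℂ) *
      Complex.exp (-(Complex.I * ((∑ i, (n i : ℝ) * x i : ℝ) : ℂ)))) cell := by
  refine (Integrable.ofReal hf).mul_bdd (c := 1) ?_ ?_
  · exact Continuous.aestronglyMeasurable (by fun_prop)
  · refine Eventually.of_forall fun x => ?_
    rw [← mul_neg, ← Complex.ofReal_neg, mul_comm, Complex.norm_exp_ofReal_mul_I]

lemma fourierCoef_add (hf : IntegrableOn f cell) (hg : IntegrableOn g cell) (n : Fin 2 → ℤ) :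
    fourierCoef (fun x => f x + g x) n = fourierCoef f n + fourierCoef g n := by
  simp only [fourierCoef]
  rw [← mul_add, ← integral_add (integrable_mul_exp hf n) (integrable_mul_exp hg n)]
  simp only [Complex.ofReal_add, add_mul]

/-- Differentiation acts on Fourier coefficients by multiplication. -/
lemma fourierCoef_pd (hf : TorusSmooth f) (i : Fin 2) (n : Fin 2 → ℤ) :
    fourierCoef (pd i f) n = Complex.I * n i * fourierCoef f n := by
  set e : Plane → ℂ := fun x => Complex.exp (-(Complex.I * ((∑ i, (n i : ℝ) * x i : ℝ) : ℂ)))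
  have hl : ∀ x : Plane, HasFDerivAt (fun x : Plane => ∑ i, (n i : ℝ) * x i)
      (∑ i, (n i : ℝ) • ContinuousLinearMap.proj (R := ℝ) (φ := fun _ : Fin 2 => ℝ) i) x :=
    fun x => HasFDerivAt.fun_sum fun i _ => (hasFDerivAt_apply i x).const_mul _
  have he : ∀ x, fderiv ℝ e x (Pi.single i 1) = -(Complex.I * n i) * e x ∧
      DifferentiableAt ℝ e x := by
    intro x
    have h := (((Complex.ofRealCLM.hasFDerivAt.comp x (hl x)).const_mul Complex.I).neg).cexp
    refine ⟨?_, h.differentiableAt⟩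
    have h' : fderiv ℝ e x = _ := h.fderiv
    rw [h']
    fin_cases i <;> simp [e] <;> ring
  have hec : ContDiff ℝ ∞ e := by
    refine ContDiff.cexp (ContDiff.neg (contDiff_const.mul ?_))
    have hs : ContDiff ℝ ∞ fun x : Plane => ∑ i, (n i : ℝ) * x i :=
      ContDiff.sum fun i _ => contDiff_const.mul (contDiff_apply ℝ ℝ i)
    exact (Complex.ofRealCLM.contDiff (n := ∞)).comp hs
  have hep : Periodic e := by
    intro x j
    have h1 : ∑ i, (n i : ℝ) * (x + Pi.single j (2 * Real.pi) : Plane) i =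
        ∑ i, (n i : ℝ) * x i + n j * (2 * Real.pi) := by
      simp [mul_add, Finset.sum_add_distrib, Pi.single_apply]
    simp only [e]
    rw [h1, Complex.exp_eq_exp_iff_exists_int]
    refine ⟨-n j, ?_⟩
    push_cast
    ring
  have hfc : ContDiff ℝ ∞ fun x => (f x : ℂ) := Complex.ofRealCLM.contDiff.comp hf.1
  have hd : ∀ x, fderiv ℝ (fun x => (f x : ℂ) * e x) x (Pi.single i 1) =
      (pd i f x : ℂ) * e x + -(Complex.I * n i) * ((f x : ℂ) * e x) := by
    intro x
    have h1 : HasFDerivAt (fun x => (f x : ℂ)) (Complex.ofRealCLM.comp (fderiv ℝ f x)) x :=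
      Complex.ofRealCLM.hasFDerivAt.comp x (hf.differentiable x).hasFDerivAt
    rw [(h1.fun_mul (he x).2.hasFDerivAt).fderiv]
    simp only [add_apply, smul_apply, smul_eq_mul, (he x).1]
    simp [pd]
    ring
  -- Integration by parts against the periodic exponential: the integral of `∂ᵢ(f e)` vanishes.
  have h0 := integral_cell_fderiv_eq_zero (f := fun x => (f x : ℂ) * e x)
    ((hfc.mul hec).of_le (by simp))
    (fun x j => by simp only [hf.periodic x j, hep x j]) i
  simp_rw [hd] at h0
  rw [integral_add (integrable_mul_exp (hf.pd i).integrableOn n)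
    ((integrable_mul_exp hf.integrableOn n).const_mul _), integral_const_mul] at h0
  simp only [fourierCoef]
  linear_combination ((((2 * Real.pi) ^ 2 : ℝ) : ℂ)⁻¹) * h0

lemma tsum_sq_fourierCoef (hf : TorusSmooth f) :
    ∑' n, ENNReal.ofReal ((2 * Real.pi) ^ 2 * ‖fourierCoef f n‖ ^ 2) =
      ENNReal.ofReal (integ fun x => f x ^ 2) := by
  have h := hasSum_sq_fourierCoef hf.memLp
  rw [← h.tsum_eq, ENNReal.ofReal_tsum_of_nonneg (fun n => by positivity) h.summable]

lemma fourierCoef_lap (hf : TorusSmooth f) (n : Fin 2 → ℤ) :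
    fourierCoef (lap f) n = -((∑ i, (n i : ℝ) ^ 2 : ℝ) : ℂ) * fourierCoef f n := by
  have h : lap f = fun x => pd 0 (pd 0 f) x + pd 1 (pd 1 f) x := by
    funext x; rw [lap, Fin.sum_univ_two]
  rw [h, fourierCoef_add ((hf.pd 0).pd 0).integrableOn ((hf.pd 1).pd 1).integrableOn,
    fourierCoef_pd (hf.pd 0), fourierCoef_pd hf, fourierCoef_pd (hf.pd 1), fourierCoef_pd hf,
    Fin.sum_univ_two]
  push_cast
  linear_combination ((n 0 : ℂ) ^ 2 + (n 1 : ℂ) ^ 2) * fourierCoef f n * Complex.I_sq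

/-- The weight `1 + n₀² + n₁²` splits termwise into the squared coefficients of `f`, `∂₀f` and
`∂₁f`, each summed by Parseval. -/
lemma hsNormSq_one (hf : TorusSmooth f) :
    hsNormSq 1 f = ENNReal.ofReal ((integ fun x => f x ^ 2) + gradSq f) := by
  have h : ∀ n : Fin 2 → ℤ, ENNReal.ofReal ((2 * Real.pi) ^ 2 *
      ((1 + ∑ i, (n i : ℝ) ^ 2) ^ (1 : ℝ) * ‖fourierCoef f n‖ ^ 2)) =
      ENNReal.ofReal ((2 * Real.pi) ^ 2 * ‖fourierCoef f n‖ ^ 2) +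
        (ENNReal.ofReal ((2 * Real.pi) ^ 2 * ‖fourierCoef (pd 0 f) n‖ ^ 2) +
        ENNReal.ofReal ((2 * Real.pi) ^ 2 * ‖fourierCoef (pd 1 f) n‖ ^ 2)) := by
    intro n
    rw [← ENNReal.ofReal_add (by positivity) (by positivity),
      ← ENNReal.ofReal_add (by positivity) (by positivity), Real.rpow_one,
      fourierCoef_pd hf, fourierCoef_pd hf]
    congr 1
    simp only [norm_mul, Complex.norm_I, one_mul, Complex.norm_intCast, mul_pow, sq_abs,
      Fin.sum_univ_two]
    ring
  rw [hsNormSq]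
  simp_rw [h]
  rw [ENNReal.tsum_add, ENNReal.tsum_add, tsum_sq_fourierCoef hf, tsum_sq_fourierCoef (hf.pd 0),
    tsum_sq_fourierCoef (hf.pd 1),
    ← ENNReal.ofReal_add (integ_sq_nonneg _) (integ_sq_nonneg _),
    ← ENNReal.ofReal_add (integ_sq_nonneg _) (add_nonneg (integ_sq_nonneg _) (integ_sq_nonneg _)),
    gradSq, Fin.sum_univ_two]

/-- `(1 + |n|²)² ≤ 2(1 + |n|⁴)`, and `|n|² f̂(n)` is, up to sign, the coefficient of `Δf`. -/
lemma hsNormSq_two_le (hf : TorusSmooth f) :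
    hsNormSq 2 f ≤
      ENNReal.ofReal (2 * ((integ fun x => f x ^ 2) + integ fun x => lap f x ^ 2)) := by
  have h : ∀ n : Fin 2 → ℤ, ENNReal.ofReal ((2 * Real.pi) ^ 2 *
      ((1 + ∑ i, (n i : ℝ) ^ 2) ^ (2 : ℝ) * ‖fourierCoef f n‖ ^ 2)) ≤
      ENNReal.ofReal 2 * (ENNReal.ofReal ((2 * Real.pi) ^ 2 * ‖fourierCoef f n‖ ^ 2) +
        ENNReal.ofReal ((2 * Real.pi) ^ 2 * ‖fourierCoef (lap f) n‖ ^ 2)) := by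
    intro n
    rw [← ENNReal.ofReal_add (by positivity) (by positivity),
      ← ENNReal.ofReal_mul (by norm_num), fourierCoef_lap hf, norm_mul, norm_neg,
      Complex.norm_real, Real.norm_eq_abs, mul_pow |_|, sq_abs]
    refine ENNReal.ofReal_le_ofReal ?_
    rw [Real.rpow_two]
    set m := ∑ i, (n i : ℝ) ^ 2
    have : (1 + m) ^ 2 ≤ 2 * (1 + m ^ 2) := by nlinarith [sq_nonneg (1 - m)]
    nlinarith [mul_le_mul_of_nonneg_left this
      (by positivity : 0 ≤ (2 * Real.pi) ^ 2 * ‖fourierCoef f n‖ ^ 2)]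
  refine (ENNReal.tsum_le_tsum h).trans (le_of_eq ?_)
  rw [ENNReal.tsum_mul_left, ENNReal.tsum_add, tsum_sq_fourierCoef hf, tsum_sq_fourierCoef hf.lap,
    ← ENNReal.ofReal_add (integ_sq_nonneg _) (integ_sq_nonneg _),
    ← ENNReal.ofReal_mul (by norm_num)]

lemma integrableOn_of_memLp (hf : MemLp f 2 (volume.restrict cell)) : IntegrableOn f cell := by
  have : IsFiniteMeasure (volume.restrict cell) := ⟨by
    simpa using isCompact_cell.measure_lt_top⟩
  exact hf.integrable (by norm_num)

/-- This carries the `H¹` bound of the initial datum to positive times. Square integrability is all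
that is asked, because the datum `g` need not be smooth. -/
lemma hsNormSq_one_le_add (hf : MemLp f 2 (volume.restrict cell))
    (hg : MemLp g 2 (volume.restrict cell)) {r : ℝ} (hr : 1 ≤ r) :
    hsNormSq 1 f ≤ 2 * hsNormSq r (fun x => f x - g x) + 2 * hsNormSq 1 g := by
  simp only [hsNormSq]
  rw [← ENNReal.tsum_mul_left, ← ENNReal.tsum_mul_left, ← ENNReal.tsum_add]
  refine ENNReal.tsum_le_tsum fun n => ?_
  rw [show (2 : ℝ≥0∞) = ENNReal.ofReal 2 by simp, ← ENNReal.ofReal_mul (by norm_num),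
    ← ENNReal.ofReal_mul (by norm_num),
    ← ENNReal.ofReal_add (by positivity) (by positivity)]
  refine ENNReal.ofReal_le_ofReal ?_
  have h1 : fourierCoef f n = fourierCoef (fun x => f x - g x) n + fourierCoef g n := by
    rw [← fourierCoef_add (f := fun x => f x - g x) (integrableOn_of_memLp (hf.sub hg))
      (integrableOn_of_memLp hg)]
    simp
  have h2 : ‖fourierCoef f n‖ ^ 2 ≤
      2 * ‖fourierCoef (fun x => f x - g x) n‖ ^ 2 + 2 * ‖fourierCoef g n‖ ^ 2 := by
    rw [h1]
    have h3 := norm_add_le (fourierCoef (fun x => f x - g x) n) (fourierCoef g n)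
    nlinarith [sq_nonneg (‖fourierCoef (fun x => f x - g x) n‖ - ‖fourierCoef g n‖),
      norm_nonneg (fourierCoef (fun x => f x - g x) n + fourierCoef g n)]
  have h4 : (1 + ∑ i, (n i : ℝ) ^ 2) ^ (1 : ℝ) ≤ (1 + ∑ i, (n i : ℝ) ^ 2) ^ r :=
    Real.rpow_le_rpow_of_exponent_le
      (by linarith [Finset.sum_nonneg fun i (_ : i ∈ Finset.univ) => sq_nonneg (n i : ℝ)]) hr
  have h5 : 0 ≤ (1 + ∑ i, (n i : ℝ) ^ 2) ^ (1 : ℝ) := by positivity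
  have h6 := mul_le_mul_of_nonneg_left h2 h5
  have h7 := mul_le_mul_of_nonneg_right h4 (sq_nonneg ‖fourierCoef (fun x => f x - g x) n‖)
  have h8 : (0 : ℝ) < (2 * Real.pi) ^ 2 := by positivity
  nlinarith

/-- Comparison with the lattice sum of `‖n‖^(-2s)` over `ℤ²`, convergent for `2s > 2`, since the
square of the sup norm is at most `1 + |n|²`. The comparison fails only at `n = 0`. -/
lemma summable_weight {s : ℝ} (hs : 1 < s) :
    Summable fun n : Fin 2 → ℤ => ((1 + ∑ i, (n i : ℝ) ^ 2) ^ s)⁻¹ := by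
  have h := EisensteinSeries.summable_one_div_norm_rpow (k := 2 * s) (by linarith)
  refine Summable.of_norm_bounded_eventually h ?_
  refine (Set.finite_singleton (0 : Fin 2 → ℤ)).subset fun n hn => ?_
  by_contra hne
  refine hn ?_
  have hpos : 0 < ‖n‖ := norm_pos_iff.2 hne
  change ‖((1 + ∑ i, (n i : ℝ) ^ 2) ^ s)⁻¹‖ ≤ ‖n‖ ^ (-(2 * s))
  rw [Real.norm_of_nonneg (by positivity), Real.rpow_neg (norm_nonneg _)]
  refine inv_anti₀ (by positivity) ?_
  rw [Real.rpow_mul (norm_nonneg _), Real.rpow_two]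
  refine Real.rpow_le_rpow (by positivity) ?_ (by linarith)
  have hn' : ‖n‖ ≤ max |(n 0 : ℝ)| |(n 1 : ℝ)| := by
    refine (pi_norm_le_iff_of_nonneg (by positivity)).2 fun i => ?_
    fin_cases i
    · simp [Int.norm_eq_abs]
    · simp [Int.norm_eq_abs]
  rw [Fin.sum_univ_two]
  rcases max_cases |(n 0 : ℝ)| |(n 1 : ℝ)| with ⟨h1, -⟩ | ⟨h1, -⟩ <;> rw [h1] at hn' <;>
    have := pow_le_pow_left₀ (norm_nonneg n) hn' 2 <;> rw [sq_abs] at this <;>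
    nlinarith [sq_nonneg (n 0 : ℝ), sq_nonneg (n 1 : ℝ)]

/-- The embedding `H^s ⊂ L^∞`, for `s > 1`. -/
lemma exists_ae_abs_le {s η : ℝ} (hs : 1 < s) (hη : 0 < η) :
    ∃ ε > 0, ∀ f : Plane → ℝ, MemLp f 2 (volume.restrict cell) →
      hsNormSq s f ≤ ENNReal.ofReal ε → ∀ᵐ x ∂volume.restrict cell, |f x| ≤ η := by
  set W : (Fin 2 → ℤ) → ℝ := fun n => (1 + ∑ i, (n i : ℝ) ^ 2) ^ s
  have hW : ∀ n, 0 < W n := fun n => by positivity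
  have hsum : Summable fun n => (W n)⁻¹ := summable_weight hs
  set K := ∑' n, (W n)⁻¹
  have hK : 0 ≤ K := tsum_nonneg fun n => (inv_pos.2 (hW n)).le
  -- `l` is the parameter in `|f̂| ≤ (l/2) W⁻¹ + (2l)⁻¹ W |f̂|²`. Summing gives `lK/2 + (ηl)/(2l) ≤
  -- η`; the `+ 1` keeps the denominator positive.
  set l := η / (K + 1)
  have hl : 0 < l := by positivity
  refine ⟨η * l, by positivity, fun f hf hle => ?_⟩
  have hp : ∀ n, 0 ≤ (2 * Real.pi) ^ 2 * (W n * ‖fourierCoef f n‖ ^ 2) := fun n =>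
    mul_nonneg (by positivity) (mul_nonneg (hW n).le (by positivity))
  have hs1 : Summable fun n => (2 * Real.pi) ^ 2 * (W n * ‖fourierCoef f n‖ ^ 2) := by
    have := ENNReal.summable_toReal (ne_top_of_le_ne_top ENNReal.ofReal_ne_top hle)
    refine this.congr fun n => ENNReal.toReal_ofReal (hp n)
  have hs2 : ∑' n, (2 * Real.pi) ^ 2 * (W n * ‖fourierCoef f n‖ ^ 2) ≤ η * l := by
    rw [hsNormSq, ← ENNReal.ofReal_tsum_of_nonneg hp hs1] at hle
    exact (ENNReal.ofReal_le_ofReal_iff (by positivity)).1 hle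
  have hpi : 1 ≤ (2 * Real.pi) ^ 2 := by nlinarith [Real.two_le_pi]
  have hb : ∀ n, ‖fourierCoef f n‖ ≤ l / 2 * (W n)⁻¹ +
      (2 * l)⁻¹ * ((2 * Real.pi) ^ 2 * (W n * ‖fourierCoef f n‖ ^ 2)) := by
    intro n
    have h1 : ‖fourierCoef f n‖ ≤ l / 2 * (W n)⁻¹ +
        (2 * l)⁻¹ * (W n * ‖fourierCoef f n‖ ^ 2) := by
      have hWn := hW n
      have : l / 2 * (W n)⁻¹ + (2 * l)⁻¹ * (W n * ‖fourierCoef f n‖ ^ 2) - ‖fourierCoef f n‖ =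
          (2 * l * W n)⁻¹ * (l - W n * ‖fourierCoef f n‖) ^ 2 := by
        field_simp; ring
      have h2 : 0 ≤ (2 * l * W n)⁻¹ * (l - W n * ‖fourierCoef f n‖) ^ 2 := by positivity
      linarith
    have h3 : W n * ‖fourierCoef f n‖ ^ 2 ≤ (2 * Real.pi) ^ 2 * (W n * ‖fourierCoef f n‖ ^ 2) :=
      le_mul_of_one_le_left (mul_nonneg (hW n).le (by positivity)) hpi
    linarith [mul_le_mul_of_nonneg_left h3 (by positivity : 0 ≤ (2 * l)⁻¹)]
  have hs3 := (hsum.mul_left (l / 2)).add (hs1.mul_left (2 * l)⁻¹)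
  have hs4 : Summable fun n => ‖fourierCoef f n‖ :=
    Summable.of_nonneg_of_le (fun n => norm_nonneg _) hb hs3
  have hs5 : ∑' n, ‖fourierCoef f n‖ ≤ η := by
    refine (hs4.tsum_le_tsum hb hs3).trans ?_
    rw [(hsum.mul_left (l / 2)).tsum_add (hs1.mul_left (2 * l)⁻¹), tsum_mul_left, tsum_mul_left]
    have h1 : l * K ≤ η := by
      simp only [l]
      rw [div_mul_eq_mul_div, div_le_iff₀ (by positivity)]
      nlinarith
    have h2 : (2 * l)⁻¹ * (∑' n, (2 * Real.pi) ^ 2 * (W n * ‖fourierCoef f n‖ ^ 2)) ≤ η / 2 := by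
      refine (mul_le_mul_of_nonneg_left hs2 (by positivity)).trans (le_of_eq ?_)
      field_simp
    have h3 : l / 2 * K ≤ η / 2 := by linarith
    linarith
  filter_upwards [ae_abs_le_tsum_fourierCoef hf hs4] with x hx using hx.trans hs5

/-! ### Scalar differential inequalities and the Gronwall argument. -/

/-- The differential inequalities satisfied by the norms of a solution: `a = ‖u‖²`, `y = ‖∇u‖²`,
`z = ‖Δu‖²`, `b = ‖∇θ‖²`, `w = ‖Δθ‖²`, `m = ‖∇μ‖²`, `U = ‖∂ₜu‖²`, `E` the total energy, `N` and `V`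
the squares of the norms of the convection term and of the lower order viscous term. -/
structure NormInequalities (κ κ' L α K Y₀ T : ℝ) (a y z b w m U N V E E' y' : ℝ → ℝ) : Prop where
  a_nonneg : ∀ t ∈ Ioo 0 T, 0 ≤ a t
  y_nonneg : ∀ t ∈ Ioo 0 T, 0 ≤ y t
  z_nonneg : ∀ t ∈ Ioo 0 T, 0 ≤ z t
  m_nonneg : ∀ t ∈ Ioo 0 T, 0 ≤ m t
  a_le : ∀ t ∈ Ioo 0 T, a t ≤ K
  b_le : ∀ t ∈ Ioo 0 T, b t ≤ K
  abs_E_le : ∀ t ∈ Ioo 0 T, |E t| ≤ K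
  E_deriv : ∀ t ∈ Ioo 0 T, HasDerivAt E (E' t) t
  E'_le : ∀ t ∈ Ioo 0 T, E' t ≤ -(κ * y t + m t)
  y_deriv : ∀ t ∈ Ioo 0 T, HasDerivAt y (y' t) t
  y'_le : ∀ t ∈ Ioo 0 T, y' t ≤ -(κ * z t) + 3 / κ * (N t + V t + m t)
  N_le : ∀ t ∈ Ioo 0 T, ∀ δ > 0, N t ≤ δ * (y t + z t) + 256 / δ * (a t * (a t + y t) * y t)
  V_le : ∀ t ∈ Ioo 0 T, ∀ δ > 0, V t ≤ δ * (y t + z t) + 9216 * L ^ 4 / δ * (w t * y t)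
  w_le : ∀ t ∈ Ioo 0 T, w t ≤ α * b t + (m t + b t) / 2
  U_le : ∀ t ∈ Ioo 0 T, U t ≤ 6 * (N t + κ' ^ 2 * z t + V t + m t)
  y_init : ∀ᶠ t in 𝓝[>] 0, y t ≤ Y₀
  z_cont : ContinuousOn z (Ioo 0 T)
  m_cont : ContinuousOn m (Ioo 0 T)

namespace NormInequalities

variable {κ κ' L α K Y₀ T : ℝ} {a y z b w m U N V E E' y' : ℝ → ℝ}

lemma w_le' (h : NormInequalities κ κ' L α K Y₀ T a y z b w m U N V E E' y') (hα : 0 < α)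
    (hK : 0 ≤ K) {t : ℝ} (ht : t ∈ Ioo 0 T) : w t ≤ (α + 1) * K + m t := by
  have h1 := h.w_le t ht
  have h2 := mul_le_mul_of_nonneg_left (h.b_le t ht) hα.le
  linarith [h.b_le t ht, h.m_nonneg t ht]

/-- The enstrophy inequality in a form suited to Gronwall's lemma. -/
lemma y'_le' (h : NormInequalities κ κ' L α K Y₀ T a y z b w m U N V E E' y') (hκ : 0 < κ)
    (hα : 0 < α) (hK : 0 ≤ K) :
    ∃ P, P = κ / 2 + 3 / κ + 3 / κ * (3072 / κ ^ 2 * (K ^ 2 + K) +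
        110592 * L ^ 4 / κ ^ 2 * ((α + 1) * K + 1)) ∧
      ∀ t ∈ Ioo 0 T, y' t ≤ -(κ / 2 * z t) + P * (1 + y t + m t) * y t + P * m t := by
  refine ⟨_, rfl, fun t ht => ?_⟩
  -- Chosen so that `N + V`, multiplied by `3/κ`, costs exactly `κ/2` of `z`: `(3/κ) * 2δ = κ/2`.
  have hδ : 0 < κ ^ 2 / 12 := by positivity
  have hN := h.N_le t ht _ hδ
  have hV := h.V_le t ht _ hδ
  have hw := h.w_le' hα hK ht
  have ha := h.a_le t ht
  have ha0 := h.a_nonneg t ht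
  have hy := h.y_nonneg t ht
  have hm := h.m_nonneg t ht
  have hz := h.z_nonneg t ht
  have h1 := h.y'_le t ht
  have e1 : 256 / (κ ^ 2 / 12) = 3072 / κ ^ 2 := by field_simp; norm_num
  have e2 : 9216 * L ^ 4 / (κ ^ 2 / 12) = 110592 * L ^ 4 / κ ^ 2 := by field_simp; ring
  rw [e1] at hN
  rw [e2] at hV
  have h2 : a t * (a t + y t) * y t ≤ (K ^ 2 + K) * (1 + y t + m t) * y t := by
    refine mul_le_mul_of_nonneg_right ?_ hy
    have : a t * (a t + y t) ≤ K * (K + y t) := by gcongr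
    nlinarith [mul_nonneg hK hy, mul_nonneg hK hm, mul_nonneg (sq_nonneg K) hy,
      mul_nonneg (sq_nonneg K) hm]
  have h3 : w t * y t ≤ ((α + 1) * K + 1) * (1 + y t + m t) * y t := by
    refine mul_le_mul_of_nonneg_right (hw.trans ?_) hy
    have : 0 ≤ (α + 1) * K := by positivity
    nlinarith [mul_nonneg this hy, mul_nonneg this hm]
  have h4 : N t + V t ≤ κ ^ 2 / 6 * (y t + z t) + (3072 / κ ^ 2 * (K ^ 2 + K) +
        110592 * L ^ 4 / κ ^ 2 * ((α + 1) * K + 1)) * ((1 + y t + m t) * y t) := by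
    have h5 := mul_le_mul_of_nonneg_left h2 (by positivity : 0 ≤ 3072 / κ ^ 2)
    have h6 := mul_le_mul_of_nonneg_left h3 (by positivity : 0 ≤ 110592 * L ^ 4 / κ ^ 2)
    linarith
  set Q := 3072 / κ ^ 2 * (K ^ 2 + K) + 110592 * L ^ 4 / κ ^ 2 * ((α + 1) * K + 1)
  have hQ : 0 ≤ Q := by positivity
  have h7 := mul_le_mul_of_nonneg_left h4 (by positivity : 0 ≤ 3 / κ)
  have e3 : 3 / κ * (κ ^ 2 / 6 * (y t + z t) + Q * ((1 + y t + m t) * y t)) =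
      κ / 2 * (y t + z t) + 3 / κ * Q * ((1 + y t + m t) * y t) := by field_simp; ring
  rw [e3] at h7
  have h8 : y t ≤ (1 + y t + m t) * y t := by nlinarith [mul_nonneg hm hy]
  have h9 : 0 ≤ 3 / κ * Q * m t := by positivity
  have h10 : 0 ≤ 3 / κ * ((1 + y t + m t) * y t) := by positivity
  have h11 := mul_le_mul_of_nonneg_left h8 (by positivity : 0 ≤ κ / 2)
  have h12 : 0 ≤ κ / 2 * m t := by positivity
  linarith

/-- Since `1 - E' ≥ 1 + κy + m`, the factor `G = exp(Q (E - t))` decays fast enough to cancel the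
growth `P (1 + y + m) y`, and `|E| ≤ K`, `0 < t < T` bound it above and below. Adding `cE` absorbs
the source `P m`, so `H = G y + c E` decreases at rate at least `D = l z + m`. The bound `R`
precedes the functions in the quantifiers, so it depends on the constants alone. -/
lemma exists_bound (κ κ' L α K Y₀ T : ℝ) (hκ : 0 < κ) (hα : 0 < α) (hK : 0 ≤ K) (hY₀ : 0 ≤ Y₀)
    (hT : 0 < T) :
    ∃ R, 0 ≤ R ∧ ∀ a y z b w m U N V E E' y' : ℝ → ℝ,
      NormInequalities κ κ' L α K Y₀ T a y z b w m U N V E E' y' →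
      ∃ D : ℝ → ℝ, ∫⁻ t in Ioo 0 T, ENNReal.ofReal (D t) ≤ ENNReal.ofReal R ∧
        ∀ t ∈ Ioo 0 T, 0 ≤ D t ∧ y t ≤ R ∧
          m t ≤ R * (1 + D t) ∧ z t ≤ R * (1 + D t) ∧ w t ≤ R * (1 + D t) ∧
            U t ≤ R * (1 + D t) := by
  set P := κ / 2 + 3 / κ + 3 / κ * (3072 / κ ^ 2 * (K ^ 2 + K) +
        110592 * L ^ 4 / κ ^ 2 * ((α + 1) * K + 1))
  have hP : 0 ≤ P := by positivity
  -- Both `Q ≥ P` and `Qκ ≥ P`, hence `Q (1 + κy + m) ≥ P (1 + y + m)`.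
  set Q := P * (1 + 1 / κ)
  have hQ : 0 ≤ Q := by positivity
  have hPQ : P ≤ Q := le_mul_of_one_le_right hP (by simp [hκ.le])
  have hPQ' : P ≤ Q * κ := by
    have : Q * κ = P * κ + P := by simp only [Q]; field_simp
    rw [this]
    linarith [mul_nonneg hP hκ.le]
  set g₁ := Real.exp (-(Q * (K + T)))
  set g₂ := Real.exp (Q * K)
  have hg₁ : 0 < g₁ := Real.exp_pos _
  have hg₂ : 0 < g₂ := Real.exp_pos _
  -- `g₂ P` pays for `G P m`; the extra `1` keeps `m` in the dissipation.
  set c := g₂ * P + 1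
  have hc : 0 < c := by positivity
  set B := g₂ * Y₀ + c * K
  have hB : 0 ≤ B := by positivity
  -- `B` bounds `H` by its values near `t = 0`, and then `g₁ y ≤ G y = H - cE ≤ B + cK`.
  set Y₁ := (B + c * K) / g₁
  have hY₁ : 0 ≤ Y₁ := by positivity
  set l := g₁ * (κ / 2)
  have hl : 0 < l := by positivity
  set W := 256 * (K * (K + Y₁) * Y₁)
  set X := 9216 * L ^ 4 * Y₁
  have hW : 0 ≤ W := by positivity
  have hX : 0 ≤ X := by positivity
  set J := 6 * (2 * Y₁ + W + X * ((α + 1) * K))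
  have hJ : 0 ≤ J := by positivity
  set J' := 6 * (2 + κ' ^ 2) * l⁻¹
  have hJ' : 0 ≤ J' := by positivity
  set J'' := 6 * (X + 1)
  have hJ'' : 0 ≤ J'' := by positivity
  set A := (α + 1) * K
  have hA : 0 ≤ A := by positivity
  have hli : 0 < l⁻¹ := by positivity
  refine ⟨2 * B + Y₁ + J + J' + J'' + A + 1 + l⁻¹, by positivity,
    fun a y z b w m U N V E E' y' h => ?_⟩
  obtain ⟨P', hP', hy'⟩ := h.y'_le' hκ hα hK
  replace hP' : P' = P := hP'
  subst hP'
  set G : ℝ → ℝ := fun t => Real.exp (Q * (E t - t))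
  have hG₁ : ∀ t ∈ Ioo 0 T, g₁ ≤ G t := fun t ht => by
    refine Real.exp_le_exp.2 ?_
    rw [← mul_neg]
    refine mul_le_mul_of_nonneg_left ?_ hQ
    linarith [(abs_le.1 (h.abs_E_le t ht)).1, ht.2]
  have hG₂ : ∀ t ∈ Ioo 0 T, G t ≤ g₂ := fun t ht => by
    refine Real.exp_le_exp.2 (mul_le_mul_of_nonneg_left ?_ hQ)
    linarith [(abs_le.1 (h.abs_E_le t ht)).2, ht.1]
  set H : ℝ → ℝ := fun t => G t * y t + c * E t
  set H' : ℝ → ℝ := fun t => G t * (Q * (E' t - 1)) * y t + G t * y' t + c * E' t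
  set D : ℝ → ℝ := fun t => l * z t + m t
  have hH : ∀ t ∈ Ioo 0 T, HasDerivAt H (H' t) t := fun t ht => by
    have h1 := (((h.E_deriv t ht).sub (hasDerivAt_id' t)).const_mul Q).exp
    exact (h1.mul (h.y_deriv t ht)).add ((h.E_deriv t ht).const_mul c)
  have hle : ∀ t ∈ Ioo 0 T, H' t ≤ -D t := fun t ht => by
    have hy := h.y_nonneg t ht
    have hm := h.m_nonneg t ht
    have hz := h.z_nonneg t ht
    have hE := h.E'_le t ht
    have hG0 : 0 < G t := Real.exp_pos _
    have h1 : Q * (E' t - 1) * y t + y' t ≤ -(κ / 2 * z t) + P * m t := by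
      have h2 : P * (1 + y t + m t) + Q * (E' t - 1) ≤ 0 := by
        have h3 := mul_le_mul_of_nonneg_left hE hQ
        have h4 := mul_le_mul_of_nonneg_right hPQ hm
        have h5 := mul_le_mul_of_nonneg_right hPQ' hy
        linarith
      have h6 := mul_nonpos_of_nonpos_of_nonneg h2 hy
      linarith [hy' t ht]
    have h7 := mul_le_mul_of_nonneg_left h1 hG0.le
    have h8 : G t * (P * m t) ≤ g₂ * (P * m t) :=
      mul_le_mul_of_nonneg_right (hG₂ t ht) (by positivity)
    have h9 : g₁ * (κ / 2 * z t) ≤ G t * (κ / 2 * z t) :=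
      mul_le_mul_of_nonneg_right (hG₁ t ht) (by positivity)
    have h10 : c * E' t ≤ -(c * m t) := by
      have := mul_le_mul_of_nonneg_left hE hc.le
      have h11 : 0 ≤ c * (κ * y t) := by positivity
      linarith
    simp only [H', D, l, c] at *
    linarith
  have hD0 : ∀ t ∈ Ioo 0 T, 0 ≤ D t := fun t ht =>
    add_nonneg (mul_nonneg hl.le (h.z_nonneg t ht)) (h.m_nonneg t ht)
  have hcE : ∀ t ∈ Ioo 0 T, |c * E t| ≤ c * K := fun t ht => by
    rw [abs_mul, abs_of_pos hc]
    exact mul_le_mul_of_nonneg_left (h.abs_E_le t ht) hc.le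
  have hHB : ∀ t ∈ Ioo 0 T, H t ≤ B := by
    refine le_of_deriv_nonpos hH (fun t ht => (hle t ht).trans (by linarith [hD0 t ht])) ?_
    filter_upwards [h.y_init, Ioo_mem_nhdsGT hT] with t hyt ht
    exact add_le_add (mul_le_mul (hG₂ t ht) hyt (h.y_nonneg t ht) hg₂.le)
      (le_of_abs_le (hcE t ht))
  have hHabs : ∀ t ∈ Ioo 0 T, |H t| ≤ B := fun t ht => by
    refine abs_le.2 ⟨?_, hHB t ht⟩
    have h1 : 0 ≤ G t * y t := mul_nonneg (Real.exp_pos _).le (h.y_nonneg t ht)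
    have h2 := (abs_le.1 (hcE t ht)).1
    have h3 : 0 ≤ g₂ * Y₀ := by positivity
    simp only [H, B]
    linarith
  have hyB : ∀ t ∈ Ioo 0 T, y t ≤ Y₁ := fun t ht => by
    rw [le_div_iff₀ hg₁]
    have h1 := mul_le_mul_of_nonneg_right (hG₁ t ht) (h.y_nonneg t ht)
    have h2 := hHB t ht
    have h3 := (abs_le.1 (hcE t ht)).1
    simp only [H] at h2
    linarith
  refine ⟨D, (lintegral_le_of_deriv_le hT hH ?_ hD0 hle hHabs).trans
    (ENNReal.ofReal_le_ofReal (by linarith)), fun t ht => ?_⟩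
  · exact (continuousOn_const.mul h.z_cont).add h.m_cont
  have hy := h.y_nonneg t ht
  have hm := h.m_nonneg t ht
  have hz := h.z_nonneg t ht
  have hy1 := hyB t ht
  have hw := h.w_le' hα hK ht
  have hD := hD0 t ht
  have hmD : m t ≤ D t := le_add_of_nonneg_left (mul_nonneg hl.le hz)
  have hzD : z t ≤ l⁻¹ * D t := by
    rw [← div_eq_inv_mul, le_div_iff₀ hl]
    simp only [D]
    linarith
  have hU : U t ≤ J + J' * D t + J'' * D t := by
    -- Smallness no longer matters, so `δ = 1`: `y` is now bounded, while `z` and `w` are bounded by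
    -- affine functions of the integrable `D`.
    have hN := h.N_le t ht 1 one_pos
    have hV := h.V_le t ht 1 one_pos
    have h1 : a t * (a t + y t) * y t ≤ K * (K + Y₁) * Y₁ := by
      have := h.a_le t ht
      have := h.a_nonneg t ht
      gcongr
    have h2 : w t * y t ≤ (A + D t) * Y₁ :=
      (mul_le_mul_of_nonneg_right (hw.trans (add_le_add_right hmD _)) hy).trans
        (mul_le_mul_of_nonneg_left hy1 (by positivity))
    have h3 := mul_le_mul_of_nonneg_left h2 (by positivity : 0 ≤ 9216 * L ^ 4)
    have h4 : N t ≤ Y₁ + z t + W := by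
      simp only [div_one, one_mul] at hN
      simp only [W]
      linarith
    have h5 : V t ≤ Y₁ + z t + X * (A + D t) := by
      simp only [div_one, one_mul] at hV
      simp only [X]
      linarith
    have h6 := mul_le_mul_of_nonneg_left hzD (by positivity : 0 ≤ 6 * (2 + κ' ^ 2))
    have h7 := h.U_le t ht
    simp only [J, J', J'']
    linarith
  have hexp : ∀ r s : ℝ, 0 ≤ r → 0 ≤ s → r + s * D t ≤ (r + s) * (1 + D t) := fun r s hr hs => by
    linarith [mul_nonneg hr hD]
  have hmono : ∀ r s : ℝ, r ≤ s → r * (1 + D t) ≤ s * (1 + D t) := fun r s hrs =>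
    mul_le_mul_of_nonneg_right hrs (by linarith)
  refine ⟨hD, by linarith, ?_, ?_, ?_, ?_⟩
  · refine (le_trans ?_ (hexp 0 1 le_rfl zero_le_one)).trans (hmono _ _ (by linarith))
    linarith
  · refine (le_trans ?_ (hexp 0 l⁻¹ le_rfl hli.le)).trans (hmono _ _ (by linarith))
    linarith
  · refine (le_trans ?_ (hexp A 1 hA zero_le_one)).trans (hmono _ _ (by linarith))
    linarith
  · refine (le_trans ?_ (hexp J (J' + J'') hJ (by positivity))).trans (hmono _ _ (by linarith))
    linarith

end NormInequalities

/-! ### Pointwise bounds from the cell, and properties of the potential and the viscosity. -/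

lemma Periodic.exists_mem_cell {E : Type*} {f : Plane → E} (hf : Periodic f) (x : Plane) :
    ∃ y ∈ cell, f y = f x := by
  have hshift : ∀ (x : Plane) (i : Fin 2) (k : ℤ),
      f (x + Pi.single i (k * (2 * Real.pi))) = f x := by
    intro x i k
    have hp : Function.Periodic (fun r : ℝ => f (x + Pi.single i r)) (2 * Real.pi) := by
      intro r
      simp only [Pi.single_add, ← add_assoc]
      exact hf _ i
    simpa using hp.int_mul_eq k
  set k : Fin 2 → ℤ := fun i => -⌊x i / (2 * Real.pi)⌋
  have hk : ∀ i, x i + k i * (2 * Real.pi) ∈ Icc 0 (2 * Real.pi) := by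
    intro i
    have hpi := Real.two_pi_pos
    have h1 := Int.floor_le (x i / (2 * Real.pi))
    have h2 := (Int.lt_floor_add_one (x i / (2 * Real.pi))).le
    rw [le_div_iff₀ hpi] at h1
    rw [div_le_iff₀ hpi] at h2
    simp only [k, Int.cast_neg]
    constructor <;> linarith
  refine ⟨x + Pi.single 0 (k 0 * (2 * Real.pi)) + Pi.single 1 (k 1 * (2 * Real.pi)), ?_, ?_⟩
  · refine ⟨fun i => ?_, fun i => ?_⟩
    · fin_cases i
      · simpa using (hk 0).1
      · simpa using (hk 1).1
    · fin_cases i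
      · simpa using (hk 0).2
      · simpa using (hk 1).2
  · rw [hshift, hshift]

/-- A continuous periodic function which is bounded almost everywhere on the cell is bounded. -/
lemma TorusSmooth.abs_le_of_ae {f : Plane → ℝ} (hf : TorusSmooth f) {c : ℝ}
    (h : ∀ᵐ x ∂volume.restrict cell, |f x| ≤ c) (x : Plane) : |f x| ≤ c := by
  obtain ⟨y, hy, hyx⟩ := hf.periodic.exists_mem_cell x
  rw [← hyx]
  -- In the open square the set `|f| > c` is open and null, hence empty; the square is dense in the
  -- cell.
  set Q : Set Plane := univ.pi fun _ => Ioo (0 : ℝ) (2 * Real.pi)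
  have hQo : IsOpen Q := isOpen_set_pi finite_univ fun _ _ => isOpen_Ioo
  have hQc : Q ⊆ cell := fun z hz => ⟨fun i => (hz i trivial).1.le, fun i => (hz i trivial).2.le⟩
  have hcl : cell ⊆ closure Q := by
    rw [closure_pi_set]
    intro z hz i _
    rw [closure_Ioo Real.two_pi_pos.ne]
    exact ⟨hz.1 i, hz.2 i⟩
  have hcont : Continuous fun z => |f z| := hf.continuous.abs
  have hopen : IsOpen {z | c < |f z|} := isOpen_lt continuous_const hcont
  have hempty : {z | c < |f z|} ∩ Q = ∅ := by
    rw [← (hopen.inter hQo).measure_eq_zero_iff (volume : Measure Plane)]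
    rw [ae_restrict_iff' measurableSet_cell, ae_iff] at h
    refine measure_mono_null (fun z hz => ?_) h
    simp only [mem_ofPred_eq, Classical.not_imp, not_le]
    exact ⟨hQc hz.2, hz.1⟩
  have hQ : closure Q ⊆ {z | |f z| ≤ c} := by
    refine closure_minimal (fun z hz => ?_) (isClosed_le hcont continuous_const)
    by_contra hzc
    have hz' : z ∈ {z | c < |f z|} ∩ Q := ⟨show c < |f z| from lt_of_not_ge hzc, hz⟩
    rw [hempty] at hz'
    exact hz'
  exact hQ (hcl hy)

/-- Compactness of `[-1, 1]`. The derivative is bounded on the open interval only, since at `±1`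
`deriv` would depend on values of `ν` outside. -/
lemma Viscosity.exists_bounds {ν : ℝ → ℝ} (hν : Viscosity ν) :
    ∃ κ κ' L : ℝ, 0 < κ ∧ 0 < L ∧ (∀ r ∈ Icc (-1 : ℝ) 1, κ ≤ ν r ∧ |ν r| ≤ κ') ∧
      ∀ r ∈ Ioo (-1 : ℝ) 1, |deriv ν r| ≤ L := by
  have hne : (Icc (-1 : ℝ) 1).Nonempty := ⟨0, by norm_num⟩
  obtain ⟨r₀, hr₀, hmin⟩ := isCompact_Icc.exists_isMinOn hne hν.smooth.continuousOn
  obtain ⟨κ', hκ'⟩ := isCompact_Icc.exists_bound_of_continuousOn hν.smooth.continuousOn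
  have hu : UniqueDiffOn ℝ (Icc (-1 : ℝ) 1) := uniqueDiffOn_Icc (by norm_num)
  obtain ⟨L, hL⟩ := isCompact_Icc.exists_bound_of_continuousOn
    (hν.smooth.continuousOn_derivWithin hu (by simp))
  refine ⟨ν r₀, κ', max L 1, hν.pos r₀ hr₀, by positivity, fun r hr => ⟨hmin hr, hκ' r hr⟩,
    fun r hr => ?_⟩
  rw [← derivWithin_of_mem_nhds (Icc_mem_nhds hr.1 hr.2)]
  exact (hL r (Ioo_subset_Icc_self hr)).trans (le_max_left _ _)

lemma SingularPotential.exists_abs_le {Φ : ℝ → ℝ} (hΦ : SingularPotential Φ) :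
    ∃ M, 0 ≤ M ∧ ∀ r ∈ Icc (-1 : ℝ) 1, |Φ r| ≤ M := by
  obtain ⟨M, hM⟩ := isCompact_Icc.exists_bound_of_continuousOn hΦ.cont
  exact ⟨M, (norm_nonneg _).trans (hM 0 (by norm_num)), hM⟩

/-- Where `φ` is bounded, its argument stays away from `±1`. -/
lemma SingularPotential.exists_separation {Φ : ℝ → ℝ} (hΦ : SingularPotential Φ) (C : ℝ) :
    ∃ c < 1, ∀ r ∈ Ioo (-1 : ℝ) 1, |deriv Φ r| ≤ C → |r| ≤ c := by
  have h1 := hΦ.lim_right.eventually (eventually_gt_atTop C)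
  have h2 := hΦ.lim_left.eventually (eventually_lt_atBot (-C))
  obtain ⟨l₁, hl₁, h1⟩ := mem_nhdsLT_iff_exists_Ioo_subset.1 h1
  obtain ⟨l₂, hl₂, h2⟩ := mem_nhdsGT_iff_exists_Ioo_subset.1 h2
  have hl₂' : -1 < l₂ := hl₂
  refine ⟨max l₁ (-l₂), max_lt hl₁ (by linarith), fun r hr hle => ?_⟩
  rw [abs_le] at hle
  by_contra hcon
  rcases lt_abs.1 (not_le.1 hcon) with h | h
  · have : C < deriv Φ r := h1 ⟨(le_max_left _ _).trans_lt h, hr.2⟩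
    linarith
  · have : deriv Φ r < -C := h2 ⟨hr.1, by linarith [(le_max_right l₁ (-l₂)).trans_lt h]⟩
    linarith

/-! ### Control of the solution just after the initial time. -/

section Initial

variable {T s : ℝ} {f : ℝ → Plane → ℝ} {f₀ : Plane → ℝ}

lemma ContHs.tendsto_zero (hf : ContHs s T f) (hT : 0 < T) :
    Tendsto (fun t => hsNormSq s (fun x => f t x - f 0 x)) (𝓝[>] 0) (𝓝 0) := by
  refine (hf.cont 0 ⟨le_rfl, hT⟩).mono_left ?_
  rw [nhdsWithin_le_iff]
  exact mem_of_superset (Ioo_mem_nhdsGT hT) Ioo_subset_Ico_self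

lemma hsNormSq_congr {r : ℝ} {g h : Plane → ℝ} (hgh : g =ᵐ[volume] h) :
    hsNormSq r g = hsNormSq r h := by
  have : fourierCoef g = fourierCoef h := by
    funext n
    rw [fourierCoef, fourierCoef]
    congr 1
    refine integral_congr_ae (ae_restrict_of_ae ?_)
    filter_upwards [hgh] with x hx
    rw [hx]
  rw [hsNormSq, hsNormSq, this]

lemma hsNormSq_mono {r r' : ℝ} (h : r ≤ r') (f : Plane → ℝ) : hsNormSq r f ≤ hsNormSq r' f := by
  refine ENNReal.tsum_le_tsum fun n => ENNReal.ofReal_le_ofReal ?_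
  have : (1 + ∑ i, (n i : ℝ) ^ 2) ^ r ≤ (1 + ∑ i, (n i : ℝ) ^ 2) ^ r' :=
    Real.rpow_le_rpow_of_exponent_le
      (by linarith [Finset.sum_nonneg fun i (_ : i ∈ Finset.univ) => sq_nonneg (n i : ℝ)]) h
  gcongr

/-- A bound for the `H¹` norm shortly after the initial time. -/
def initialBound (f₀ : Plane → ℝ) : ℝ := 2 + 2 * (hsNormSq 1 f₀).toReal

lemma initialBound_nonneg (f₀ : Plane → ℝ) : 0 ≤ initialBound f₀ := by
  have := ENNReal.toReal_nonneg (a := hsNormSq 1 f₀)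
  rw [initialBound]
  positivity

/-- Convergence in `H^s` makes the difference from the datum at most `1`. Only the `H¹` norm of the
datum is left in the bound, which is therefore independent of `s`. -/
lemma eventually_le_initialBound (hT : 0 < T) (hs : 1 < s) (hsm : SmoothOn T f)
    (hf : ContHs s T f) (h0 : f 0 =ᵐ[volume] f₀) :
    ∀ᶠ t in 𝓝[>] 0, integ (fun x => f t x ^ 2) + gradSq (f t) ≤ initialBound f₀ := by
  have h00 : (0 : ℝ) ∈ Ico 0 T := ⟨le_rfl, hT⟩
  -- `toReal` sends `⊤` to `0`, so `initialBound` is meaningful only once this is known.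
  have hfin : hsNormSq 1 f₀ ≠ ⊤ := by
    rw [← hsNormSq_congr h0]
    exact ((hsNormSq_mono hs.le _).trans_lt (hf.mem 0 h00).finite).ne
  filter_upwards [(hf.tendsto_zero hT).eventually (ge_mem_nhds zero_lt_one),
    Ioo_mem_nhdsGT hT] with t h1 ht
  have h2 := hsNormSq_one_le_add (hsm.torusSmooth ht).memLp (hf.mem 0 h00).memLp hs.le
  rw [hsNormSq_one (hsm.torusSmooth ht), hsNormSq_congr h0, ← ENNReal.ofReal_toReal hfin] at h2
  have h3 : 2 * hsNormSq s (fun x => f t x - f 0 x) +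
      2 * ENNReal.ofReal (hsNormSq 1 f₀).toReal ≤ ENNReal.ofReal (initialBound f₀) := by
    rw [initialBound, ENNReal.ofReal_add (by norm_num) (by positivity),
      ENNReal.ofReal_mul (by norm_num), ENNReal.ofReal_ofNat]
    gcongr
    simpa using mul_le_mul_right h1 2
  exact (ENNReal.ofReal_le_ofReal_iff (initialBound_nonneg _)).1 (h2.trans h3)

end Initial

/-! ### Range of the concentration, and the energy and enstrophy of a solution. -/

section Solution

variable {Φ ν : ℝ → ℝ} {T : ℝ} {u₀ : Plane → Plane} {θ₀ : Plane → ℝ}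
  {u : ℝ → Plane → Plane} {θ μ g : ℝ → Plane → ℝ}

/-- The concentration is separated from `±1` shortly after the initial time. -/
lemma eventually_abs_lt_one {s δ₀ : ℝ} (hT : 0 < T) (hs : 1 < s) (hδ : δ₀ ∈ Ioo (0 : ℝ) 1)
    (hdata : InitialData s δ₀ u₀ θ₀) (hθ : SmoothOn T θ) (hc : ContHs s T θ)
    (h0 : θ 0 =ᵐ[volume] θ₀) : ∀ᶠ t in 𝓝[>] 0, ∀ x, |θ t x| < 1 := by
  -- A sup distance of `δ₀/2` from the datum leaves `|θ| ≤ 1 - δ₀/2`.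
  obtain ⟨ε, hε, hsup⟩ := exists_ae_abs_le hs (half_pos hδ.1)
  have h00 : (0 : ℝ) ∈ Ico 0 T := ⟨le_rfl, hT⟩
  filter_upwards [(hc.tendsto_zero hT).eventually
    (ge_mem_nhds (ENNReal.ofReal_pos.2 hε)), Ioo_mem_nhdsGT hT] with t h1 ht x
  have hsm := hθ.torusSmooth ht
  have h2 := hsup _ (hsm.memLp.sub (hc.mem 0 h00).memLp) h1
  have h3 : ∀ᵐ x ∂volume.restrict cell, |θ₀ x| ≤ 1 - δ₀ := by
    have h4 := ae_le_eLpNormEssSup (f := θ₀) (μ := volume.restrict cell)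
    have h5 := hdata.separated
    rw [eLpNorm_exponent_top] at h5
    filter_upwards [h4] with x hx
    have h6 := hx.trans h5
    rw [Real.enorm_eq_ofReal_abs] at h6
    exact (ENNReal.ofReal_le_ofReal_iff (by linarith [hδ.2])).1 h6
  have h7 : ∀ᵐ x ∂volume.restrict cell, |θ t x| ≤ 1 - δ₀ / 2 := by
    filter_upwards [h2, h3, ae_restrict_of_ae h0] with x hx hx' hx0
    have h8 := abs_add_le (θ t x - θ 0 x) (θ 0 x)
    rw [sub_add_cancel, hx0] at h8
    simp only [Pi.sub_apply] at hx
    rw [hx0] at hx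
    linarith
  linarith [hsm.abs_le_of_ae h7 x, hδ.1]

/-- The concentration takes its values in `(-1, 1)`. -/
lemma IsSmoothSolution.abs_lt_one (hΦ : SingularPotential Φ) (hT : 0 < T)
    (h : IsSmoothSolution Φ ν T u₀ θ₀ u θ μ g)
    (hinit : ∀ᶠ t in 𝓝[>] 0, ∀ x, |θ t x| < 1) : ∀ t ∈ Ioo 0 T, ∀ x, |θ t x| < 1 := by
  set S : Set ℝ := {t | t ∈ Ioo 0 T ∧ ∀ x ∈ cell, |θ t x| < 1}
  have hS : IsOpen S := by
    rw [isOpen_iff_mem_nhds]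
    intro t ht
    refine (isOpen_Ioo.eventually_mem ht.1).and ?_
    refine isCompact_cell.eventually_forall_of_forall_eventually fun x hx => ?_
    have hc : ContinuousAt (fun p : ℝ × Plane => |θ p.1 p.2|) (t, x) :=
      (h.θ_smooth.contDiffAt ht.1 x).continuousAt.abs
    exact hc.eventually (gt_mem_nhds (ht.2 x hx))
  have hne : (Ioo 0 T ∩ S).Nonempty := by
    obtain ⟨t, h1, h2⟩ := (hinit.and (Ioo_mem_nhdsGT hT)).exists
    exact ⟨t, h2, h2, fun x _ => h1 x⟩
  have hcl : closure S ∩ Ioo 0 T ⊆ S := by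
    rintro t ⟨htS, ht⟩
    refine ⟨ht, fun x hx => ?_⟩
    -- `μ + Δθ = φ(θ)` is bounded near `t`. At times of `S`, where `θ` lies in `(-1, 1)`, this
    -- forces `|θ| ≤ c < 1` with a uniform `c`, and the bound survives in the limit.
    obtain ⟨s, hs, hsT, C, hC⟩ := (h.μ_smooth.add h.θ_smooth.lap).bounded_near ht
    obtain ⟨c, hc1, hc⟩ := hΦ.exists_separation C
    have hfreq : ∃ᶠ τ in 𝓝 t, |θ τ x| ≤ c := by
      refine ((mem_closure_iff_frequently.1 htS).and_eventually hs).mono ?_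
      rintro τ ⟨hτ, hτs⟩
      refine hc _ (abs_lt.1 (hτ.2 x hx)) ?_
      have := hC τ hτs x hx
      rwa [h.potential τ hτ.1 x, sub_add_cancel] at this
    have hcont : ContinuousAt (fun τ => |θ τ x|) t :=
      (h.θ_smooth.hasDerivAt ht x).continuousAt.abs
    exact (isClosed_Iic.mem_of_frequently_of_tendsto hfreq hcont).trans_lt hc1
  have hsub := isPreconnected_Ioo.subset_of_closure_inter_subset hS hne hcl
  intro t ht x
  obtain ⟨y, hy, hyx⟩ := ((h.θ_smooth.torusSmooth ht).periodic).exists_mem_cell x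
  rw [← hyx]
  exact (hsub ht).2 y hy

/-- The components of the velocity at time `t`. -/
def vel (u : ℝ → Plane → Plane) (t : ℝ) (i : Fin 2) (x : Plane) : ℝ := u t x i

/-- The components of the acceleration at time `t`. -/
def accel (u : ℝ → Plane → Plane) (t : ℝ) (i : Fin 2) : Plane → ℝ := dt (fun t x => u t x i) t

/-- The total energy. -/
def energy (Φ : ℝ → ℝ) (u : ℝ → Plane → Plane) (θ : ℝ → Plane → ℝ) (t : ℝ) : ℝ :=
  normSq (vel u t) / 2 + gradSq (θ t) / 2 + integ (fun x => Φ (θ t x))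

/-- The time derivative of the total energy. -/
def energyDeriv (Φ : ℝ → ℝ) (u : ℝ → Plane → Plane) (θ : ℝ → Plane → ℝ) (t : ℝ) : ℝ :=
  ∑ i, integ (fun x => vel u t i x * accel u t i x) +
    integ (fun x => -lap (θ t) x * dt θ t x) + integ (fun x => deriv Φ (θ t x) * dt θ t x)

lemma SingularPotential.contDiffOn_deriv (hΦ : SingularPotential Φ) :
    ContDiffOn ℝ ∞ (deriv Φ) (Ioo (-1) 1) :=
  hΦ.smooth.deriv_of_isOpen isOpen_Ioo (by simp)

namespace IsSmoothSolution

variable {t : ℝ}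

lemma momentumBalance (hν : Viscosity ν) (h : IsSmoothSolution Φ ν T u₀ θ₀ u θ μ g)
    (hb : ∀ t ∈ Ioo 0 T, ∀ x, |θ t x| < 1) (ht : t ∈ Ioo 0 T) :
    MomentumBalance (vel u t) (accel u t) (θ t) (μ t) (g t) (fun x => ν (θ t x)) where
  vel := ⟨fun i => (h.u_smooth.apply i).torusSmooth ht, h.div_free t ht⟩
  acc := by
    refine ⟨fun i => (h.u_smooth.apply i).dt.torusSmooth ht, fun x => ?_⟩
    -- The divergence of `∂ₜu` is the time derivative of `div u`, which is identically zero near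
    -- `t`.
    have h1 : ∀ i, pd i (accel u t i) x = dt (fun t => pd i fun y => u t y i) t x := fun i =>
      ((h.u_smooth.apply i).dt_pd ht i x).symm
    simp_rw [h1]
    have h2 := HasDerivAt.fun_sum fun i (_ : i ∈ (Finset.univ : Finset (Fin 2))) =>
      ((h.u_smooth.apply i).pd i).hasDerivAt ht x
    rw [← h2.deriv]
    have h3 : (fun τ => ∑ i, pd i (fun y => u τ y i) x) =ᶠ[𝓝 t] fun _ => (0 : ℝ) := by
      filter_upwards [isOpen_Ioo.mem_nhds ht] with τ hτ using h.div_free τ hτ x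
    rw [h3.deriv_eq]
    simp
  θ_smooth := h.θ_smooth.torusSmooth ht
  μ_smooth := h.μ_smooth.torusSmooth ht
  g_smooth := h.g_smooth.torusSmooth ht
  c_smooth := (h.θ_smooth.torusSmooth ht).comp isOpen_Ioo (hν.smooth.mono Ioo_subset_Icc_self)
    fun x => abs_lt.1 (hb t ht x)
  balance := fun x i => h.momentum t ht x i

lemma hasDerivAt_energy (hΦ : SingularPotential Φ) (h : IsSmoothSolution Φ ν T u₀ θ₀ u θ μ g)
    (hb : ∀ t ∈ Ioo 0 T, ∀ x, |θ t x| < 1) (ht : t ∈ Ioo 0 T) :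
    HasDerivAt (energy Φ u θ) (energyDeriv Φ u θ t) t := by
  have h1 := HasDerivAt.fun_sum fun i (_ : i ∈ (Finset.univ : Finset (Fin 2))) =>
    (h.u_smooth.apply i).hasDerivAt_integ_sq ht
  have h2 := h.θ_smooth.hasDerivAt_gradSq ht
  have h3 := (h.θ_smooth.comp hΦ.smooth fun t ht x => abs_lt.1 (hb t ht x)).hasDerivAt_integ ht
  refine (((h1.div_const 2).add (h2.div_const 2)).add h3).congr_deriv ?_
  rw [energyDeriv]
  congr 1
  · congr 1
    · rw [← Finset.mul_sum, mul_div_cancel_left₀ _ two_ne_zero]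
      rfl
    · rw [mul_div_cancel_left₀ _ two_ne_zero]
  · congr 1
    funext x
    have h4 := (hΦ.smooth.contDiffAt (isOpen_Ioo.mem_nhds (abs_lt.1 (hb t ht x)))).differentiableAt
      (by simp)
    exact (h4.hasDerivAt.comp t (h.θ_smooth.hasDerivAt ht x)).deriv

/-- The energy inequality. -/
lemma energyDeriv_le (hΦ : SingularPotential Φ) (hν : Viscosity ν)
    (h : IsSmoothSolution Φ ν T u₀ θ₀ u θ μ g)
    (hb : ∀ t ∈ Ioo 0 T, ∀ x, |θ t x| < 1) {κ : ℝ} (hκ : ∀ r ∈ Icc (-1 : ℝ) 1, κ ≤ ν r)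
    (ht : t ∈ Ioo 0 T) :
    energyDeriv Φ u θ t ≤ -(κ * vgradSq (vel u t) + gradSq (μ t)) := by
  have hm := h.momentumBalance hν hb ht
  have h1 := hm.sum_integ_vel_mul_acc_le fun x =>
    hκ (θ t x) (Ioo_subset_Icc_self (abs_lt.1 (hb t ht x)))
  have hθ := hm.θ_smooth
  have hμ := hm.μ_smooth
  have hdθ := h.θ_smooth.dt.torusSmooth ht
  have hφ : TorusSmooth fun x => deriv Φ (θ t x) :=
    hθ.comp isOpen_Ioo hΦ.contDiffOn_deriv fun x => abs_lt.1 (hb t ht x)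
  have hs : ∀ i, TorusSmooth fun x => μ t x * (vel u t i x * pd i (θ t) x) := fun i =>
    hμ.mul ((hm.vel.smooth i).mul (hθ.pd i))
  have hl : ∀ i, TorusSmooth fun x => μ t x * pd i (pd i (μ t)) x := fun i =>
    hμ.mul ((hμ.pd i).pd i)
  -- `∂ₜθ` is paired with `φ(θ) - Δθ = μ`. Inserting `∂ₜθ = Δμ - u·∇θ` produces `-‖∇μ‖²` and a
  -- transport term that cancels the capillary work in the kinetic balance.
  have h2 : integ (fun x => -lap (θ t) x * dt θ t x) +
      integ (fun x => deriv Φ (θ t x) * dt θ t x) =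
      -gradSq (μ t) - ∑ i, integ (fun x => μ t x * (vel u t i x * pd i (θ t) x)) := by
    have h3 : ∀ i, integ (fun x => μ t x * pd i (pd i (μ t)) x) =
        -integ (fun x => pd i (μ t) x ^ 2) := fun i => by
      rw [integ_mul_pd hμ (hμ.pd i)]
      simp only [sq]
    rw [gradSq, ← Finset.sum_neg_distrib]
    simp_rw [← h3]
    rw [← integ_sum fun i => (hl i).continuous, ← integ_sum fun i => (hs i).continuous,
      ← integ_add (hθ.lap.neg.mul hdθ).continuous (hφ.mul hdθ).continuous,
      ← integ_sub (TorusSmooth.sum hl).continuous (TorusSmooth.sum hs).continuous]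
    congr 1
    funext x
    have h4 := h.transport t ht x
    have h5 := h.potential t ht x
    rw [← Finset.mul_sum, ← Finset.mul_sum, ← mul_sub]
    have h6 : dt θ t x = lap (μ t) x - ∑ j, vel u t j x * pd j (θ t) x :=
      eq_sub_of_add_eq h4
    have h7 : ∑ i, pd i (pd i (μ t)) x = lap (μ t) x := rfl
    rw [h6, h5, h7]
    ring
  rw [energyDeriv]
  linarith

lemma hasDerivAt_vgradSq (h : IsSmoothSolution Φ ν T u₀ θ₀ u θ μ g) (ht : t ∈ Ioo 0 T) :
    HasDerivAt (fun t => vgradSq (vel u t))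
      (2 * ∑ i, integ (fun x => -lap (vel u t i) x * accel u t i x)) t := by
  have h1 := HasDerivAt.fun_sum fun i (_ : i ∈ (Finset.univ : Finset (Fin 2))) =>
    (h.u_smooth.apply i).hasDerivAt_gradSq ht
  refine h1.congr_deriv ?_
  rw [← Finset.mul_sum]
  rfl

end IsSmoothSolution

end Solution

/-! ### Verification of the differential inequalities and conversion of the norms. -/

lemma integ_one_pos : 0 ≤ integ fun _ => 1 := integ_nonneg fun _ => zero_le_one

lemma abs_integ_le {f : Plane → ℝ} (hf : Continuous f) {M : ℝ} (h : ∀ x, |f x| ≤ M) :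
    |integ f| ≤ M * integ fun _ => 1 := by
  have e : M * (integ fun _ => 1) = integ fun _ => M := by rw [← integ_const_mul]; simp
  rw [e, abs_le, ← integ_neg]
  exact ⟨integ_mono (by fun_prop) hf fun x => (abs_le.1 (h x)).1,
    integ_mono hf (by fun_prop) fun x => (abs_le.1 (h x)).2⟩

lemma SmoothOn.continuousOn_vlapSq {T : ℝ} {u : ℝ → Plane → Plane} (hu : SmoothOn T u) :
    ContinuousOn (fun t => vlapSq (vel u t)) (Ioo 0 T) :=
  continuousOn_finsetSum _ fun i _ => ((hu.apply i).lap.pow 2).continuousOn_integ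

lemma SmoothOn.continuousOn_gradSq {T : ℝ} {f : ℝ → Plane → ℝ} (hf : SmoothOn T f) :
    ContinuousOn (fun t => gradSq (f t)) (Ioo 0 T) :=
  continuousOn_finsetSum _ fun i _ => ((hf.pd i).pow 2).continuousOn_integ

/-- The differential inequalities hold for smooth solutions with constants depending only on the
data. -/
lemma IsSmoothSolution.normInequalities {Φ ν : ℝ → ℝ} {T κ κ' L α M s : ℝ}
    {u₀ : Plane → Plane} {θ₀ : Plane → ℝ} {u : ℝ → Plane → Plane} {θ μ g : ℝ → Plane → ℝ}
    (hΦ : SingularPotential Φ) (hν : Viscosity ν) (hT : 0 < T) (hκ : 0 < κ) (hL : 0 < L)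
    (hM : 0 ≤ M) (hs : 1 < s)
    (hνb : ∀ r ∈ Icc (-1 : ℝ) 1, κ ≤ ν r ∧ |ν r| ≤ κ') (hν' : ∀ r ∈ Ioo (-1 : ℝ) 1, |deriv ν r| ≤ L)
    (hΦα : ∀ r ∈ Ioo (-1 : ℝ) 1, -α ≤ deriv (deriv Φ) r) (hΦM : ∀ r ∈ Icc (-1 : ℝ) 1, |Φ r| ≤ M)
    (h : IsSmoothSolution Φ ν T u₀ θ₀ u θ μ g) (hsp : InSolutionSpace s T u θ)
    (hb : ∀ t ∈ Ioo 0 T, ∀ x, |θ t x| < 1) :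
    NormInequalities κ κ' L α
      (∑ i, initialBound (fun x => u₀ x i) + initialBound θ₀ + 4 * (M * integ fun _ => 1))
      (∑ i, initialBound (fun x => u₀ x i)) T
      (fun t => normSq (vel u t)) (fun t => vgradSq (vel u t)) (fun t => vlapSq (vel u t))
      (fun t => gradSq (θ t)) (fun t => integ fun x => lap (θ t) x ^ 2) (fun t => gradSq (μ t))
      (fun t => normSq (accel u t)) (fun t => normSq (convec (vel u t)))
      (fun t => normSq (viscRest (fun x => ν (θ t x)) (vel u t)))
      (energy Φ u θ) (energyDeriv Φ u θ)
      (fun t => 2 * ∑ i, integ (fun x => -lap (vel u t i) x * accel u t i x)) := by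
  have hIoo : ∀ t ∈ Ioo 0 T, ∀ x, θ t x ∈ Ioo (-1 : ℝ) 1 := fun t ht x => abs_lt.1 (hb t ht x)
  have hIcc : ∀ t ∈ Ioo 0 T, ∀ x, θ t x ∈ Icc (-1 : ℝ) 1 := fun t ht x =>
    Ioo_subset_Icc_self (hIoo t ht x)
  have hle : ∀ t ∈ Ioo 0 T, ∀ x, |θ t x| ≤ 1 := fun t ht x => (hb t ht x).le
  have hbal := fun t (ht : t ∈ Ioo 0 T) => h.momentumBalance hν hb ht
  have hE' : ∀ t ∈ Ioo 0 T, energyDeriv Φ u θ t ≤ -(κ * vgradSq (vel u t) + gradSq (μ t)) :=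
    fun t ht => h.energyDeriv_le hΦ hν hb (fun r hr => (hνb r hr).1) ht
  set V := M * integ fun _ => 1
  have hV : 0 ≤ V := mul_nonneg hM integ_one_pos
  set S := ∑ i, initialBound (fun x => u₀ x i)
  have hS : 0 ≤ S := Finset.sum_nonneg fun i _ => initialBound_nonneg _
  have hS' := initialBound_nonneg θ₀
  have hpot : ∀ t ∈ Ioo 0 T, |integ fun x => Φ (θ t x)| ≤ V := fun t ht =>
    abs_integ_le ((hbal t ht).θ_smooth.comp isOpen_Ioo hΦ.smooth (hIoo t ht)).continuous
      fun x => hΦM _ (hIcc t ht x)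
  have hu0 : ∀ᶠ t in 𝓝[>] 0, normSq (vel u t) + vgradSq (vel u t) ≤ S := by
    have h1 : ∀ i : Fin 2, (fun x => u 0 x i) =ᵐ[volume] fun x => u₀ x i := fun i => by
      filter_upwards [h.u_init] with x hx
      rw [hx]
    filter_upwards [eventually_le_initialBound hT hs (h.u_smooth.apply 0) (hsp.u_cont 0) (h1 0),
      eventually_le_initialBound hT hs (h.u_smooth.apply 1) (hsp.u_cont 1) (h1 1)] with t h2 h3
    have h4 : integ (fun x => vel u t 0 x ^ 2) + gradSq (vel u t 0) ≤ _ := h2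
    have h5 : integ (fun x => vel u t 1 x ^ 2) + gradSq (vel u t 1) ≤ _ := h3
    simp only [normSq, vgradSq, S, Fin.sum_univ_two]
    linarith
  have hE0 : ∀ᶠ t in 𝓝[>] 0, energy Φ u θ t ≤ (S + initialBound θ₀) / 2 + V := by
    filter_upwards [hu0, Ioo_mem_nhdsGT hT,
      eventually_le_initialBound hT hs h.θ_smooth hsp.θ_cont h.θ_init] with t h1 ht h2
    have h3 := integ_sq_nonneg (θ t)
    have h4 := vgradSq_nonneg (vel u t)
    have h5 := (abs_le.1 (hpot t ht)).2
    rw [energy]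
    linarith
  -- The energy stays below `(S + initialBound θ₀)/2 + V` and its potential part above `-V`. Hence
  -- `‖u‖²` and `‖∇θ‖²` are at most `S + initialBound θ₀ + 4V`.
  have hEle := le_of_deriv_nonpos (fun t ht => h.hasDerivAt_energy hΦ hb ht)
    (fun t ht => (hE' t ht).trans (by
      have := mul_nonneg hκ.le (vgradSq_nonneg (vel u t))
      linarith [gradSq_nonneg (μ t)])) hE0
  have hνt : ∀ t ∈ Ioo 0 T, ∀ j x,
      |pd j (fun x => ν (θ t x)) x| ≤ L * |pd j (θ t) x| := fun t ht j x => by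
    rw [pd_comp (hbal t ht).θ_smooth j x (((hν.smooth.contDiffAt
      (Icc_mem_nhds (hIoo t ht x).1 (hIoo t ht x).2))).differentiableAt (by simp)), abs_mul]
    exact mul_le_mul_of_nonneg_right (hν' _ (hIoo t ht x)) (abs_nonneg _)
  refine ⟨fun t _ => normSq_nonneg _, fun t _ => vgradSq_nonneg _, fun t _ => vlapSq_nonneg _,
    fun t _ => gradSq_nonneg _, fun t ht => ?_, fun t ht => ?_, fun t ht => ?_,
    fun t ht => h.hasDerivAt_energy hΦ hb ht, hE', fun t ht => h.hasDerivAt_vgradSq ht,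
    fun t ht => ?_, fun t ht δ hδ => normSq_convec_le (hbal t ht).vel.smooth hδ,
    fun t ht δ hδ => normSq_viscRest_le (hbal t ht).vel.smooth (hbal t ht).θ_smooth (hle t ht)
      (hbal t ht).c_smooth hL (hνt t ht) hδ, fun t ht => ?_,
    fun t ht => (hbal t ht).normSq_acc_le (fun x => (hνb _ (hIcc t ht x)).2) (hle t ht), ?_,
    h.u_smooth.continuousOn_vlapSq, h.μ_smooth.continuousOn_gradSq⟩
  · have h1 := hEle t ht
    have h2 := (abs_le.1 (hpot t ht)).1
    have h3 := gradSq_nonneg (θ t)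
    simp only [energy] at h1
    linarith
  · have h1 := hEle t ht
    have h2 := (abs_le.1 (hpot t ht)).1
    have h3 := normSq_nonneg (vel u t)
    simp only [energy] at h1
    linarith
  · have h1 := hEle t ht
    have h2 := (abs_le.1 (hpot t ht)).1
    have h3 := normSq_nonneg (vel u t)
    have h4 := gradSq_nonneg (θ t)
    refine abs_le.2 ⟨?_, by linarith⟩
    rw [energy]
    linarith
  · have h1 := (hbal t ht).sum_integ_neg_lap_mul_acc_le hκ
      (fun x => (hνb _ (hIcc t ht x)).1) (hle t ht)
    have e : 3 / κ = 2 * (3 / (2 * κ)) := by field_simp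
    rw [e]
    linarith
  · exact integ_lap_sq_le (hbal t ht).θ_smooth (hbal t ht).μ_smooth
      ((hbal t ht).θ_smooth.comp isOpen_Ioo hΦ.contDiffOn_deriv (hIoo t ht))
      (fun x => hΦα _ (hIoo t ht x))
      (fun i x => pd_comp (hbal t ht).θ_smooth i x ((hΦ.contDiffOn_deriv.contDiffAt
        (isOpen_Ioo.mem_nhds (hIoo t ht x))).differentiableAt (by simp)))
      (h.potential t ht)
  · filter_upwards [hu0] with t ht
    linarith [normSq_nonneg (vel u t)]

lemma lintegral_le_of_le_one_add {T R : ℝ} {D : ℝ → ℝ} {F : ℝ → ℝ≥0∞} (hR : 0 ≤ R)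
    (hD0 : ∀ t ∈ Ioo 0 T, 0 ≤ D t)
    (hD : ∫⁻ t in Ioo 0 T, ENNReal.ofReal (D t) ≤ ENNReal.ofReal R)
    (hF : ∀ t ∈ Ioo 0 T, F t ≤ ENNReal.ofReal (R * (1 + D t))) :
    ∫⁻ t in Ioo 0 T, F t ≤ ENNReal.ofReal R * (ENNReal.ofReal T + ENNReal.ofReal R) := by
  calc ∫⁻ t in Ioo 0 T, F t
      ≤ ∫⁻ t in Ioo 0 T, ENNReal.ofReal R * (1 + ENNReal.ofReal (D t)) := by
        refine setLIntegral_mono' measurableSet_Ioo fun t ht => (hF t ht).trans (le_of_eq ?_)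
        rw [ENNReal.ofReal_mul hR, ENNReal.ofReal_add zero_le_one (hD0 t ht), ENNReal.ofReal_one]
    _ = ENNReal.ofReal R * (ENNReal.ofReal T + ∫⁻ t in Ioo 0 T, ENNReal.ofReal (D t)) := by
        rw [lintegral_const_mul' _ _ ENNReal.ofReal_ne_top, lintegral_add_left measurable_const]
        simp
    _ ≤ _ := by gcongr

lemma lintegral_sq_eq {f : Plane → ℝ} (hf : TorusSmooth f) :
    ∫⁻ x in cell, ENNReal.ofReal (f x ^ 2) = ENNReal.ofReal (integ fun x => f x ^ 2) :=
  (ofReal_integral_eq_lintegral_ofReal (hf.pow 2).integrableOn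
    (Eventually.of_forall fun _ => sq_nonneg _)).symm

lemma LinftyHsSq_le {r T R : ℝ} {f : ℝ → Plane → ℝ}
    (h : ∀ t ∈ Ioo 0 T, hsNormSq r (f t) ≤ ENNReal.ofReal R) :
    LinftyHsSq r T f ≤ ENNReal.ofReal R :=
  essSup_le_of_ae_le _ (ae_restrict_of_forall_mem measurableSet_Ioo h)

end NSCH

end

/-! ### The a priori estimate. -/

open NSCH in
theorem lemma3p1 (Φ ν : ℝ → ℝ) (hΦ : NSCH.SingularPotential Φ) (hν : NSCH.Viscosity ν)
    (T : ℝ) (hT : 0 < T) (u₀ : NSCH.Plane → NSCH.Plane) (θ₀ : NSCH.Plane → ℝ) :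
    ∃ C : ℝ≥0, ∀ s δ₀ : ℝ, 1 < s → δ₀ ∈ Ioo (0 : ℝ) 1 → NSCH.InitialData s δ₀ u₀ θ₀ →
      ∀ (u : ℝ → NSCH.Plane → NSCH.Plane) (θ μ g : ℝ → NSCH.Plane → ℝ),
        NSCH.IsSmoothSolution Φ ν T u₀ θ₀ u θ μ g → NSCH.InSolutionSpace s T u θ →
        eLpNorm (fun p : ℝ × NSCH.Plane => θ p.1 p.2) ⊤
            (volume.restrict (Ioo 0 T ×ˢ NSCH.cell)) ≤ 1 ∧
        (∑ i, NSCH.LinftyHsSq 1 T (fun t x => u t x i))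
          + (∑ i, NSCH.L2L2Sq T (fun t x => deriv (fun τ => u τ x i) t))
          + (∑ i, NSCH.L2HsSq 2 T (fun t x => u t x i))
          + NSCH.LinftyHsSq 1 T θ + NSCH.L2HsSq 2 T θ
          + (∑ i, NSCH.L2L2Sq T (fun t x => NSCH.pd i (μ t) x)) ≤ (C : ℝ≥0∞) := by
  obtain ⟨κ, κ', L, hκ, hL, hνb, hν'⟩ := hν.exists_bounds
  obtain ⟨M, hM, hΦM⟩ := hΦ.exists_abs_le
  obtain ⟨α, _, _, _, hα, -, -, -, hΦα⟩ := hΦ.bounds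
  set I₁ := integ fun _ => 1
  have hI₁ : 0 ≤ I₁ := integ_one_pos
  set Y₀ := ∑ i, initialBound (fun x => u₀ x i)
  have hY₀ : 0 ≤ Y₀ := Finset.sum_nonneg fun i _ => initialBound_nonneg _
  have hB := initialBound_nonneg θ₀
  set K := Y₀ + initialBound θ₀ + 4 * (M * I₁)
  have hK : 0 ≤ K :=
    add_nonneg (add_nonneg hY₀ hB) (mul_nonneg zero_le_four (mul_nonneg hM hI₁))
  obtain ⟨R, hR, hmain⟩ := NormInequalities.exists_bound κ κ' L α K Y₀ T hκ hα hK hY₀ hT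
  -- The factor `2` is the one in `hsNormSq_two_le`; `K` and `I₁` bound the `L²` parts for `u` and
  -- `θ`.
  set R' := 2 * (K + R + I₁)
  have hR' : 0 ≤ R' := mul_nonneg zero_le_two (add_nonneg (add_nonneg hK hR) hI₁)
  set Z := ENNReal.ofReal R' * (ENNReal.ofReal T + ENNReal.ofReal R')
  have hZ : Z ≠ ⊤ := ENNReal.mul_ne_top ENNReal.ofReal_ne_top
    (ENNReal.add_ne_top.2 ⟨ENNReal.ofReal_ne_top, ENNReal.ofReal_ne_top⟩)
  set B := ∑ _i : Fin 2, ENNReal.ofReal R' + ∑ _i : Fin 2, Z + ∑ _i : Fin 2, Z +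
    ENNReal.ofReal R' + Z + ∑ _i : Fin 2, Z
  have hBtop : B ≠ ⊤ := by
    simp [B, ENNReal.add_eq_top, hZ, ENNReal.mul_eq_top]
  -- The constant is fixed before `s`, `δ₀` and the solution: the data enter only through their `H¹`
  -- norms.
  refine ⟨B.toNNReal, fun s δ₀ hs hδ hdata u θ μ g h hsp => ?_⟩
  have hb := h.abs_lt_one hΦ hT
    (eventually_abs_lt_one hT hs hδ hdata h.θ_smooth hsp.θ_cont h.θ_init)
  have hN := h.normInequalities hΦ hν hT hκ hL hM hs hνb hν' (fun r hr => (hΦα r hr).1) hΦM hsp hb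
  obtain ⟨D, hD, hDt⟩ := hmain _ _ _ _ _ _ _ _ _ _ _ _ hN
  have hD' := hD.trans (ENNReal.ofReal_le_ofReal (by simp only [R']; linarith : R ≤ R'))
  have hD0 : ∀ t ∈ Ioo 0 T, 0 ≤ D t := fun t ht => (hDt t ht).1
  have hRD : ∀ t ∈ Ioo 0 T, 2 * (K + I₁ + R * (1 + D t)) ≤ R' * (1 + D t) := fun t ht => by
    have := mul_nonneg (add_nonneg hK hI₁) (hD0 t ht)
    simp only [R']
    linarith
  have hRD' : ∀ t ∈ Ioo 0 T, R * (1 + D t) ≤ R' * (1 + D t) := fun t ht => by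
    have := mul_nonneg hR (by linarith [hD0 t ht] : 0 ≤ 1 + D t)
    linarith [hRD t ht]
  have hu := fun t (ht : t ∈ Ioo 0 T) i => (h.u_smooth.apply i).torusSmooth ht
  have hua : ∀ t ∈ Ioo 0 T, ∀ i, integ (fun x => u t x i ^ 2) ≤ K := fun t ht i =>
    (integ_sq_le_normSq (vel u t) i).trans (hN.a_le t ht)
  have hθs : ∀ t ∈ Ioo 0 T, integ (fun x => θ t x ^ 2) ≤ I₁ := fun t ht =>
    integ_mono ((h.θ_smooth.torusSmooth ht).pow 2).continuous (by fun_prop) fun x =>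
      (sq_le_one_iff_abs_le_one _).2 (hb t ht x).le
  refine ⟨?_, ?_⟩
  · rw [eLpNorm_exponent_top, ← ENNReal.ofReal_one]
    refine eLpNormEssSup_le_of_ae_bound ?_
    refine ae_restrict_of_forall_mem (measurableSet_Ioo.prod measurableSet_cell) fun p hp => ?_
    exact (hb p.1 hp.1 p.2).le
  rw [ENNReal.coe_toNNReal hBtop]
  refine add_le_add (add_le_add (add_le_add (add_le_add (add_le_add
    (Finset.sum_le_sum fun i _ => ?_) (Finset.sum_le_sum fun i _ => ?_))
    (Finset.sum_le_sum fun i _ => ?_)) ?_) ?_) (Finset.sum_le_sum fun i _ => ?_)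
  · refine LinftyHsSq_le fun t ht => ?_
    rw [hsNormSq_one (hu t ht i)]
    refine ENNReal.ofReal_le_ofReal ?_
    have h1 := hua t ht i
    have h2 : gradSq (fun x => u t x i) ≤ R :=
      (gradSq_le_vgradSq (vel u t) i).trans (hDt t ht).2.1
    simp only [R']
    linarith
  · refine lintegral_le_of_le_one_add hR' hD0 hD' fun t ht => ?_
    refine (lintegral_sq_eq ((h.u_smooth.apply i).dt.torusSmooth ht)).trans_le ?_
    exact ENNReal.ofReal_le_ofReal ((integ_sq_le_normSq (accel u t) i).trans
      ((hDt t ht).2.2.2.2.2.trans (hRD' t ht)))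
  · refine lintegral_le_of_le_one_add hR' hD0 hD' fun t ht => ?_
    refine (hsNormSq_two_le (hu t ht i)).trans (ENNReal.ofReal_le_ofReal (le_trans ?_ (hRD t ht)))
    have h1 := hua t ht i
    have h2 : integ (fun x => lap (fun x => u t x i) x ^ 2) ≤ R * (1 + D t) :=
      (integ_lap_sq_le_vlapSq (vel u t) i).trans (hDt t ht).2.2.2.1
    linarith
  · refine LinftyHsSq_le fun t ht => ?_
    rw [hsNormSq_one (h.θ_smooth.torusSmooth ht)]
    refine ENNReal.ofReal_le_ofReal ?_
    have h1 := hθs t ht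
    have h2 := hN.b_le t ht
    simp only [R']
    linarith
  · refine lintegral_le_of_le_one_add hR' hD0 hD' fun t ht => ?_
    refine (hsNormSq_two_le (h.θ_smooth.torusSmooth ht)).trans
      (ENNReal.ofReal_le_ofReal (le_trans ?_ (hRD t ht)))
    have h1 := hθs t ht
    have h2 := (hDt t ht).2.2.2.2.1
    linarith
  · refine lintegral_le_of_le_one_add hR' hD0 hD' fun t ht => ?_
    rw [lintegral_sq_eq ((h.μ_smooth.torusSmooth ht).pd i)]
    exact ENNReal.ofReal_le_ofReal ((integ_pd_sq_le_gradSq (μ t) i).trans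
      ((hDt t ht).2.2.1.trans (hRD' t ht)))
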